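/- A compact Coxeter polytope in $\mathbb{H}^3$ is a compact intersection $P$ of finitely many closed half-spaces, with non-empty interior, any two of whose bounding hyperplanes either do not intersect or form a dihedral angle $\pi/n$ with an integer $n\ge 2$. For an edge $E$ of $P$ let $F_1\ne F_2$ be the facets containing $E$ and let $F_3,F_4$ be its framing facets: they do not contain $E$, but $F_3$ contains one vertex of $E$ and $F_4$ the other. The collection $\Sigma_E=(F_1,\dots,F_4)$ is the ridge associated with $E$, its width is $\cosh\rho(F_3,F_4)$, where $\rho(F_3,F_4)$ is the hyperbolic distance between the facets $F_3$ and $F_4$, and its type is $\overline\alpha=(\alpha_{12},\alpha_{13},\alpha_{14},\alpha_{23},\alpha_{24})$, where $\alpha_{ij}$ is the dihedral angle between $F_i$ and $F_j$. Let $\Omega$ be the set of types of all ridges of compact Coxeter polytopes in $\mathbb{H}^3$. For an interior point $O$ of $P$, an edge $E$ is outermost from $O$ if $\rho(O,E)=\max_{E'}\rho(O,E')$ over all edges $E'$ of $P$. For $\overline\alpha\in\Omega$ define $\alpha_1,\dots,\alpha_4\in(0,\pi)$ by $$\cos\alpha_1=\frac{\cos\alpha_{23}+\cos\alpha_{12}\cos\alpha_{13}}{\sin\alpha_{12}\sin\alpha_{13}},\qquad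 \cos\alpha_2=\frac{\cos\alpha_{24}+\cos\alpha_{12}\cos\alpha_{14}}{\sin\alpha_{12}\sin\alpha_{14}},$$ $$\cos\alpha_3=\frac{\cos\alpha_{13}+\cos\alpha_{12}\cos\alpha_{23}}{\sin\alpha_{12}\sin\alpha_{23}},\qquad \cos\alpha_4=\frac{\cos\alpha_{14}+\cos\alpha_{12}\cos\alpha_{24}}{\sin\alpha_{12}\sin\alpha_{24}},$$ put $$F_{i,j}(\overline\alpha)=\operatorname{arcsinh}\frac{\cos(\alpha_{12}/2)}{\tan(\alpha_i/2)}+\operatorname{arcsinh}\frac{\cos(\alpha_{12}/2)}{\tan(\alpha_j/2)},\qquad F(\overline\alpha)=\max\{F_{1,2}(\overline\alpha),F_{3,4}(\overline\alpha)\},$$ $$G_{33}=1-\cos^2\alpha_{12}-\cos^2\alpha_{14}-\cos^2\alpha_{24}-2\cos\alpha_{12}\cos\alpha_{14}\cos\alpha_{24},$$ $$G_{44}=1-\cos^2\alpha_{12}-\cos^2\alpha_{13}-\cos^2\alpha_{23}-2\cos\alpha_{12}\cos\alpha_{13}\cos\alpha_{23},$$ $$g(\overline\alpha)=\cos\alpha_{12}\cos\alpha_{13}\cos\alpha_{24}+\cos\alpha_{12}\cos\alpha_{14}\cos\alpha_{23}+\cos\alpha_{13}\cos\alpha_{14}+\cos\alpha_{23}\cos\alpha_{24},$$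 $$\mathbf{t}_{\overline\alpha}=\frac{\cosh F(\overline\alpha)\,\sqrt{G_{33}G_{44}}-g(\overline\alpha)}{\sin^2\alpha_{12}}.$$ Theorem A. Every compact Coxeter polytope $P$ in $\mathbb{H}^3$ contains a ridge of width less than $\mathbf{t}_{\overline\alpha}$, where $\overline\alpha$ is the type of that ridge. More precisely, for every interior point $O$ of $P$ there is an edge that is outermost from $O$, every such edge has an associated ridge, and, however its facets are numbered, the width of that ridge is less than $\mathbf{t}_{\overline\alpha}$ for its type $\overline\alpha$. Moreover, $(\pi/5,\pi/3,\pi/3,\pi/2,\pi/2)\in\Omega$ and $$\max_{\overline\alpha\in\Omega}\mathbf{t}_{\overline\alpha}=\mathbf{t}_{(\pi/5,\pi/3,\pi/3,\pi/2,\pi/2)}<5.75 .$$ -/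

import Mathlib

noncomputable section

namespace LobachevskyThree

/-- The underlying vector space of Minkowski space of signature `(3, 1)`. -/
abbrev Mink : Type := Fin 4 → ℝ

/-- The Minkowski inner product `-x₀y₀ + x₁y₁ + x₂y₂ + x₃y₃`. -/
def mink (x y : Mink) : ℝ :=
  -(x 0 * y 0) + x 1 * y 1 + x 2 * y 2 + x 3 * y 3

/-- Hyperbolic 3-space: the future sheet of the hyperboloid `(x, x) = -1`, with the subspace
topology (which is the topology of the hyperbolic metric). The metric that the subtype inherits
from `Fin 4 → ℝ` is never used; the hyperbolic distance is `hdist`. -/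
abbrev Hyp3 : Type := {x : Mink // mink x x = -1 ∧ 0 < x 0}

/-- The hyperbolic distance: `cosh ρ(x, y) = -(x, y)`. -/
def hdist (x y : Hyp3) : ℝ := Real.arcosh (-(mink x y))

/-- The distance between two (nonempty) sets: the infimum of the distances between points. -/
def setDist (A B : Set Hyp3) : ℝ := sInf (Set.image2 hdist A B)

/-- The hyperplane `H_e` (used for unit vectors, `(e, e) = 1`). -/
def hyperplane (e : Mink) : Set Hyp3 := {x | mink x e = 0}

/-- The half-space `H_e^-`; the unit vector `e` is its outer normal. -/
def halfSpace (e : Mink) : Set Hyp3 := {x | mink x e ≤ 0}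

/-- A convex polytope: an intersection of finitely many half-spaces, with nonempty interior. -/
def IsConvexPolytope (P : Set Hyp3) : Prop :=
  (∃ S : Finset Mink, (∀ e ∈ S, mink e e = 1) ∧ P = ⋂ e ∈ S, halfSpace e) ∧
    (interior P).Nonempty

/-- `F` is a `k`-dimensional (proper) face of `P`: the intersection of `P` with a supporting
hyperplane, the smallest plane of `Hyp3` that contains it having dimension `k` (so that its
linear span has dimension `k + 1`). -/
def IsFace (k : ℕ) (P F : Set Hyp3) : Prop :=
  (∃ e : Mink, mink e e = 1 ∧ P ⊆ halfSpace e ∧ F = P ∩ hyperplane e) ∧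
    Module.finrank ℝ (Submodule.span ℝ ((fun x : Hyp3 => (x : Mink)) '' F)) = k + 1

/-- The set cut out on `P` by the hyperplane with normal `e`. -/
def faceOf (P : Set Hyp3) (e : Mink) : Set Hyp3 := P ∩ hyperplane e

/-- `e` is the unit outer normal of a facet (2-dimensional face) of `P`; the facet is then
`faceOf P e`, and `hyperplane e` is its bounding hyperplane. -/
def IsFacetNormal (P : Set Hyp3) (e : Mink) : Prop :=
  mink e e = 1 ∧ P ⊆ halfSpace e ∧ IsFace 2 P (faceOf P e)

/-- The angle of `H_e^- ∩ H_f^-` (for unit `e`, `f` whose hyperplanes intersect):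
`(e, f) = -cos` of it. -/
def dihedralAngle (e f : Mink) : ℝ := Real.arccos (-(mink e f))

/-- Coxeter polytopes: any two bounding hyperplanes either do not intersect or form a dihedral
angle `π / n` with an integer `n ≥ 2`. -/
def IsCoxeterPolytope (P : Set Hyp3) : Prop :=
  IsConvexPolytope P ∧
    ∀ e f : Mink, IsFacetNormal P e → IsFacetNormal P f → e ≠ f →
      (hyperplane e ∩ hyperplane f).Nonempty →
        ∃ n : ℕ, 2 ≤ n ∧ dihedralAngle e f = Real.pi / n

/-- Compact Coxeter polytopes in hyperbolic 3-space. -/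
def IsCompactCoxeterPolytope (P : Set Hyp3) : Prop :=
  IsCoxeterPolytope P ∧ IsCompact P

/-- Edges are the 1-dimensional faces. -/
def IsEdge (P E : Set Hyp3) : Prop := IsFace 1 P E

/-- Vertices are the 0-dimensional faces. -/
def IsVertex (P : Set Hyp3) (v : Hyp3) : Prop := IsFace 0 P {v}

/-- `E` is an edge of `P` that is outermost relative to the point `O`. -/
def IsOutermostEdge (P : Set Hyp3) (O : Hyp3) (E : Set Hyp3) : Prop :=
  IsEdge P E ∧ ∀ E' : Set Hyp3, IsEdge P E' → setDist {O} E' ≤ setDist {O} E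

/-- The ridge associated with the edge `E`, given by the unit outer normals
`u 0, u 1, u 2, u 3` of its facets `F₁, F₂, F₃, F₄`: the facets `F₁` and `F₂` contain `E`, and
`F₃`, `F₄` are the framing facets, which contain one vertex of `E` each, but not `E`. -/
structure IsRidge (P E : Set Hyp3) (u : Fin 4 → Mink) : Prop where
  edge : IsEdge P E
  facet : ∀ i, IsFacetNormal P (u i)
  ne : u 0 ≠ u 1
  left : E ⊆ faceOf P (u 0)
  right : E ⊆ faceOf P (u 1)
  framing : ∃ v w : Hyp3, IsVertex P v ∧ IsVertex P w ∧ v ≠ w ∧ v ∈ E ∧ w ∈ E ∧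
    v ∈ faceOf P (u 2) ∧ w ∈ faceOf P (u 3)
  not_left : ¬ E ⊆ faceOf P (u 2)
  not_right : ¬ E ⊆ faceOf P (u 3)

/-- The width of a ridge: `cosh` of the distance between the two framing facets. -/
def width (P : Set Hyp3) (u : Fin 4 → Mink) : ℝ :=
  Real.cosh (setDist (faceOf P (u 2)) (faceOf P (u 3)))

/-- A tuple of angles `(α₁₂, α₁₃, α₁₄, α₂₃, α₂₄)`. -/
@[ext] structure RidgeType where
  a12 : ℝ
  a13 : ℝ
  a14 : ℝ
  a23 : ℝ
  a24 : ℝ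

/-- The type of a ridge: the dihedral angles `α_ij` between its facets `F_i` and `F_j`. -/
def ridgeType (u : Fin 4 → Mink) : RidgeType where
  a12 := dihedralAngle (u 0) (u 1)
  a13 := dihedralAngle (u 0) (u 2)
  a14 := dihedralAngle (u 0) (u 3)
  a23 := dihedralAngle (u 1) (u 2)
  a24 := dihedralAngle (u 1) (u 3)

/-- The set `Ω` of all types of ridges of compact Coxeter polytopes in hyperbolic 3-space. -/
def allTypes : Set RidgeType :=
  {α | ∃ (P E : Set Hyp3) (u : Fin 4 → Mink),
    IsCompactCoxeterPolytope P ∧ IsRidge P E u ∧ ridgeType u = α}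

/-- The side opposite to the angle `a` of a spherical triangle with angles `a`, `b`, `c`. -/
def planeAngle (a b c : ℝ) : ℝ :=
  Real.arccos ((Real.cos a + Real.cos b * Real.cos c) / (Real.sin b * Real.sin c))

/-- The Gram determinant of three unit normals with mutual dihedral angles `a`, `b`, `c`. -/
def gramDet (a b c : ℝ) : ℝ :=
  Matrix.det !![1, -Real.cos a, -Real.cos b;
                -Real.cos a, 1, -Real.cos c;
                -Real.cos b, -Real.cos c, 1]

namespace RidgeType

variable (α : RidgeType)

/-- The plane angle `α₁` in `F₁` at the vertex `F₁ ∩ F₂ ∩ F₃`. -/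
def plane1 : ℝ := planeAngle α.a23 α.a12 α.a13

/-- The plane angle `α₂` in `F₁` at the vertex `F₁ ∩ F₂ ∩ F₄`. -/
def plane2 : ℝ := planeAngle α.a24 α.a12 α.a14

/-- The plane angle `α₃` in `F₂` at the vertex `F₁ ∩ F₂ ∩ F₃`. -/
def plane3 : ℝ := planeAngle α.a13 α.a12 α.a23

/-- The plane angle `α₄` in `F₂` at the vertex `F₁ ∩ F₂ ∩ F₄`. -/
def plane4 : ℝ := planeAngle α.a14 α.a12 α.a24

/-- The length bound with plane angles `x` and `y` at the ends of the edge. -/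
def lengthBound (x y : ℝ) : ℝ :=
  Real.arsinh (Real.cos (α.a12 / 2) / Real.tan (x / 2)) +
    Real.arsinh (Real.cos (α.a12 / 2) / Real.tan (y / 2))

/-- `F(α) = max {F₁₂(α), F₃₄(α)}`. -/
def maxLengthBound : ℝ :=
  max (α.lengthBound α.plane1 α.plane2) (α.lengthBound α.plane3 α.plane4)

/-- The cofactor `G₃₃` of the Gram matrix of the normals of the ridge. -/
def cofactor33 : ℝ := gramDet α.a12 α.a14 α.a24

/-- The cofactor `G₄₄` of the Gram matrix of the normals of the ridge. -/
def cofactor44 : ℝ := gramDet α.a12 α.a13 α.a23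

/-- The expression `g(α)`. -/
def gTerm : ℝ :=
  Real.cos α.a12 * Real.cos α.a13 * Real.cos α.a24 +
    Real.cos α.a12 * Real.cos α.a14 * Real.cos α.a23 +
    Real.cos α.a13 * Real.cos α.a14 + Real.cos α.a23 * Real.cos α.a24

/-- The bound `t_α`. -/
def t : ℝ :=
  (Real.cosh α.maxLengthBound * Real.sqrt (α.cofactor33 * α.cofactor44) - α.gTerm) /
    Real.sin α.a12 ^ 2

end RidgeType

/-- The type `(π/5, π/3, π/3, π/2, π/2)`. -/
def extremalType : RidgeType where
  a12 := Real.pi / 5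
  a13 := Real.pi / 3
  a14 := Real.pi / 3
  a23 := Real.pi / 2
  a24 := Real.pi / 2

end LobachevskyThree

end

open LobachevskyThree

/-! In the hyperboloid model facets are given by unit normals and `cosh` of a distance is minus a
product. All dihedral angles are at most π/2, so distinct facet normals have nonpositive products
(`IsIrredundant.mink_nonpos`). Hence the foot A of the perpendicular from an interior point O to the
intersection of two crossing facet planes lies in P (`foot_mem`): such planes always share an edge,
and the distance from O to it is an explicit function of the numbers βᵢ = -(O, uᵢ)
(`cosh_setDist_edge_sq`).

Let E = F₁ ∩ F₂ be outermost from O. Comparing E with F₁ ∩ F₃ and cancelling the common distance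
from O to F₁ shows that the projection O' of O to F₁ is at least as far from E as from F₁ ∩ F₃
(`outermost_inequality`). So at the common vertex V the angle AVO' is at least α₁/2, and the right
triangle VAO' gives sinh AV ≤ tanh AO' / tan(α₁/2). Moreover tanh AO' = tanh AO · cos θ < cos θ,
where θ is the angle between AO and F₁. If β₂ ≤ β₁ then θ ≥ α₁₂/2 (`edge_quotient_sq_le`), so sinh
AV < cos(α₁₂/2) / tan(α₁/2). The same holds at the other end of E, hence E is shorter than F₁₂; if
β₁ ≤ β₂, the facet F₂ gives F₃₄ instead.

Minus the product (u₃, u₄) is an increasing function of the length of E. The formal argument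
(`neg_mink_mul_add_lt`) never mentions that length: it decomposes the projections of u₃ and u₄ to
the plane of E along A, where `neg_mink_mul_le` plays the role of the addition formula for cosh.
Finally the width is at most max(1, -(u₃, u₄)) (`cosh_setDist_facets_le`), so 1 < t is needed as
well (`RidgeType.IsSpherical.one_lt_t`).

For the maximum, Ω is enlarged to all types whose two ends are spherical triangles with angles π/n
(`RidgeType.IsSpherical`). There t is rewritten in sines and cosines, AM–GM separates the two ends
of the edge (`edgeCosh_le`), and the few possible angles are checked. A compact Coxeter tetrahedron
realizes the extremal type. -/

namespace LobachevskyThree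

/-! ### The Minkowski form -/

lemma mink_comm (x y : Mink) : mink x y = mink y x := by simp only [mink]; ring

@[simp] lemma mink_add_left (x y z : Mink) : mink (x + y) z = mink x z + mink y z := by
  simp only [mink, Pi.add_apply]; ring

@[simp] lemma mink_add_right (x y z : Mink) : mink x (y + z) = mink x y + mink x z := by
  simp only [mink, Pi.add_apply]; ring

@[simp] lemma mink_smul_left (a : ℝ) (x y : Mink) : mink (a • x) y = a * mink x y := by
  simp only [mink, Pi.smul_apply, smul_eq_mul]; ring

@[simp] lemma mink_smul_right (a : ℝ) (x y : Mink) : mink x (a • y) = a * mink x y := by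
  simp only [mink, Pi.smul_apply, smul_eq_mul]; ring

@[simp] lemma mink_neg_left (x y : Mink) : mink (-x) y = -mink x y := by
  simp only [mink, Pi.neg_apply]; ring

@[simp] lemma mink_neg_right (x y : Mink) : mink x (-y) = -mink x y := by
  simp only [mink, Pi.neg_apply]; ring

@[simp] lemma mink_sub_left (x y z : Mink) : mink (x - y) z = mink x z - mink y z := by
  simp only [mink, Pi.sub_apply]; ring

@[simp] lemma mink_sub_right (x y z : Mink) : mink x (y - z) = mink x y - mink x z := by
  simp only [mink, Pi.sub_apply]; ring

@[simp] lemma mink_zero_left (x : Mink) : mink 0 x = 0 := by simp [mink]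

@[simp] lemma mink_zero_right (x : Mink) : mink x 0 = 0 := by simp [mink]

/-- The Minkowski inner product as a bilinear form. -/
def minkForm : LinearMap.BilinForm ℝ Mink :=
  LinearMap.mk₂ ℝ mink mink_add_left mink_smul_left mink_add_right mink_smul_right

@[simp] lemma minkForm_apply (x y : Mink) : minkForm x y = mink x y := rfl

lemma eq_zero_of_forall_mink_eq_zero {x : Mink} (h : ∀ y, mink x y = 0) : x = 0 := by
  ext i
  have := h (Pi.single i 1)
  fin_cases i <;> simpa [mink, Pi.single_apply] using this

lemma minkForm_nondegenerate : minkForm.Nondegenerate := by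
  refine ⟨fun x hx => eq_zero_of_forall_mink_eq_zero hx, fun x hx => ?_⟩
  exact eq_zero_of_forall_mink_eq_zero fun y => by rw [mink_comm]; exact hx y

lemma finrank_orthogonal_minkForm (W : Submodule ℝ Mink) :
    Module.finrank ℝ (minkForm.orthogonal W) = 4 - Module.finrank ℝ W := by
  rw [LinearMap.BilinForm.finrank_orthogonal minkForm_nondegenerate]; simp

/-- Orthogonality makes x₀y₀ equal to the spatial product, so Cauchy–Schwarz in ℝ³ together with
|x|² < x₀² is incompatible with |y|² ≤ y₀² unless y = 0. -/
lemma mink_self_pos_of_orthogonal {x y : Mink} (hx : mink x x < 0) (hxy : mink x y = 0)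
    (hy : y ≠ 0) : 0 < mink y y := by
  by_contra! h
  simp only [mink] at *
  have h1 : (x 0 * y 0) ^ 2 ≤ (x 1 ^ 2 + x 2 ^ 2 + x 3 ^ 2) * (y 1 ^ 2 + y 2 ^ 2 + y 3 ^ 2) := by
    rw [show x 0 * y 0 = x 1 * y 1 + x 2 * y 2 + x 3 * y 3 by linarith]
    nlinarith [sq_nonneg (x 1 * y 2 - x 2 * y 1), sq_nonneg (x 1 * y 3 - x 3 * y 1),
      sq_nonneg (x 2 * y 3 - x 3 * y 2)]
  have h2 : y 1 ^ 2 + y 2 ^ 2 + y 3 ^ 2 ≤ y 0 ^ 2 := by nlinarith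
  have h3 : x 1 ^ 2 + x 2 ^ 2 + x 3 ^ 2 < x 0 ^ 2 := by nlinarith
  have h0 : y 0 = 0 := by
    by_contra h0
    have : 0 < y 0 ^ 2 := by positivity
    have h4 : 0 ≤ x 1 ^ 2 + x 2 ^ 2 + x 3 ^ 2 := by positivity
    nlinarith [mul_le_mul_of_nonneg_left h2 h4, mul_lt_mul_of_pos_right h3 this]
  apply hy
  rw [h0] at h2
  ext i
  fin_cases i
  · exact h0
  all_goals
    simp only [Fin.mk_one, Fin.reduceFinMk, Pi.zero_apply]
    nlinarith [sq_nonneg (y 1), sq_nonneg (y 2), sq_nonneg (y 3)]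

lemma mink_self_nonneg_of_orthogonal {x y : Mink} (hx : mink x x < 0) (hxy : mink x y = 0) :
    0 ≤ mink y y := by
  rcases eq_or_ne y 0 with rfl | hy
  · simp
  · exact (mink_self_pos_of_orthogonal hx hxy hy).le

/-- Cauchy–Schwarz inequality on the orthogonal complement of a timelike vector. -/
lemma neg_mink_le_sqrt_mul_sqrt {x y z : Mink} (hx : mink x x < 0) (hy : mink x y = 0)
    (hz : mink x z = 0) : -mink y z ≤ √(mink y y) * √(mink z z) := by
  have h0 := mink_self_nonneg_of_orthogonal hx hy
  rcases eq_or_ne z 0 with rfl | hz0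
  · simp
  have h1 := mink_self_pos_of_orthogonal hx hz hz0
  have h2 : 0 ≤ mink (mink z z • y - mink y z • z) (mink z z • y - mink y z • z) :=
    mink_self_nonneg_of_orthogonal hx (by simp [hy, hz])
  have h3 : 0 ≤ mink z z * (mink y y * mink z z - mink y z ^ 2) := by
    simp only [mink_sub_left, mink_sub_right, mink_smul_left, mink_smul_right,
      mink_comm z y] at h2
    nlinarith
  have h4 : mink y z ^ 2 ≤ mink y y * mink z z := by
    have := nonneg_of_mul_nonneg_right h3 h1
    linarith
  rw [← Real.sqrt_mul h0]
  exact Real.le_sqrt_of_sq_le (by nlinarith)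

/-- Any two vectors, decomposed along a timelike vector `a`. -/
lemma neg_mink_mul_le {a y z : Mink} (ha : mink a a < 0) :
    -mink y z * -mink a a ≤ mink y a * mink z a +
      √(mink y y * -mink a a + mink y a ^ 2) * √(mink z z * -mink a a + mink z a ^ 2) := by
  set N := -mink a a with hN
  have hN0 : 0 < N := by linarith
  -- `N • w + mink w a • a` is N times the component of w orthogonal to a; the scaling avoids
  -- division.
  have key : ∀ w w' : Mink, mink (N • w + mink w a • a) (N • w' + mink w' a • a) =
      N * (mink w w' * N + mink w a * mink w' a) := fun w w' => by
    simp only [mink_add_left, mink_add_right, mink_smul_left, mink_smul_right, mink_comm a w']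
    rw [show mink a a = -N by linarith]; ring
  have horth : ∀ w, mink a (N • w + mink w a • a) = 0 := fun w => by
    simp only [mink_add_right, mink_smul_right, mink_comm a w, hN]; ring
  have h := neg_mink_le_sqrt_mul_sqrt ha (horth y) (horth z)
  rw [key, key, key, Real.sqrt_mul hN0.le, Real.sqrt_mul hN0.le] at h
  have hs : √N * √N = N := Real.mul_self_sqrt hN0.le
  have h' : N * (-mink y z * N - mink y a * mink z a) ≤ N *
      (√(mink y y * N + mink y a ^ 2) * √(mink z z * N + mink z a ^ 2)) := by
    simp only [sq]
    calc _ = -(N * (mink y z * N + mink y a * mink z a)) := by ring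
      _ ≤ _ := h
      _ = √N * √N * (√(mink y y * N + mink y a * mink y a) *
          √(mink z z * N + mink z a * mink z a)) := by ring
      _ = _ := by rw [hs]
  have := le_of_mul_le_mul_left h' hN0
  linarith

/-! ### Timelike vectors and their projections to hyperbolic space -/

/-- Future-directed timelike vectors. -/
def IsFuture (z : Mink) : Prop := mink z z < 0 ∧ 0 < z 0

lemma Hyp3.isFuture (x : Hyp3) : IsFuture x := ⟨by rw [x.2.1]; norm_num, x.2.2⟩

lemma abs_spatial_lt {x y : Mink} (hx : mink x x < 0) (hy : mink y y < 0) :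
    (x 1 * y 1 + x 2 * y 2 + x 3 * y 3) ^ 2 < (x 0 * y 0) ^ 2 := by
  simp only [mink] at *
  have h1 : (x 1 * y 1 + x 2 * y 2 + x 3 * y 3) ^ 2 ≤
      (x 1 ^ 2 + x 2 ^ 2 + x 3 ^ 2) * (y 1 ^ 2 + y 2 ^ 2 + y 3 ^ 2) := by
    nlinarith [sq_nonneg (x 1 * y 2 - x 2 * y 1), sq_nonneg (x 1 * y 3 - x 3 * y 1),
      sq_nonneg (x 2 * y 3 - x 3 * y 2)]
  have h2 : y 1 ^ 2 + y 2 ^ 2 + y 3 ^ 2 < y 0 ^ 2 := by nlinarith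
  have h3 : x 1 ^ 2 + x 2 ^ 2 + x 3 ^ 2 < x 0 ^ 2 := by nlinarith
  refine h1.trans_lt ?_
  rw [mul_pow]
  exact mul_lt_mul'' h3 h2 (by positivity) (by positivity)

lemma IsFuture.mink_neg {x y : Mink} (hx : IsFuture x) (hy : IsFuture y) : mink x y < 0 := by
  have := abs_lt_of_sq_lt_sq (abs_spatial_lt hx.1 hy.1) (mul_pos hx.2 hy.2).le
  simp only [mink]
  linarith [(abs_lt.mp this).2]

lemma isFuture_of_mink_neg {x y : Mink} (hx : mink x x < 0) (hy : IsFuture y)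
    (h : mink x y < 0) : IsFuture x := by
  refine ⟨hx, ?_⟩
  by_contra! h0
  have h1 : IsFuture (-x) := by
    refine ⟨by simpa using hx, ?_⟩
    rcases h0.lt_or_eq with h0 | h0
    · simpa using h0
    · have h2 := abs_spatial_lt hx hy.1
      rw [h0] at h2
      nlinarith [sq_nonneg (x 1 * y 1 + x 2 * y 2 + x 3 * y 3)]
  have := h1.mink_neg hy
  simp only [mink_neg_left] at this
  linarith

lemma IsFuture.add {x y : Mink} (hx : IsFuture x) (hy : IsFuture y) : IsFuture (x + y) := by
  refine ⟨?_, add_pos hx.2 hy.2⟩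
  have := hx.mink_neg hy
  simp only [mink_add_left, mink_add_right, mink_comm y x]
  linarith [hx.1, hy.1]

lemma IsFuture.smul {x : Mink} (hx : IsFuture x) {a : ℝ} (ha : 0 < a) : IsFuture (a • x) := by
  refine ⟨?_, mul_pos ha hx.2⟩
  simp only [mink_smul_left, mink_smul_right]
  exact mul_neg_of_pos_of_neg ha (mul_neg_of_pos_of_neg ha hx.1)

/-- The central projection of a future timelike vector to hyperbolic space. -/
noncomputable def toHyp (z : Mink) (h : IsFuture z) : Hyp3 :=
  ⟨(√(-mink z z))⁻¹ • z, by
    have h1 : 0 < √(-mink z z) := Real.sqrt_pos.mpr (by linarith [h.1])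
    refine ⟨?_, mul_pos (inv_pos.mpr h1) h.2⟩
    have h2 : √(-mink z z) ^ 2 = -mink z z := Real.sq_sqrt (by linarith [h.1])
    simp only [mink_smul_left, mink_smul_right]
    field_simp
    linarith⟩

lemma exists_toHyp_eq {z : Mink} (h : IsFuture z) :
    ∃ a : ℝ, 0 < a ∧ (toHyp z h : Mink) = a • z ∧ a ^ 2 * -mink z z = 1 := by
  have h1 : 0 < √(-mink z z) := Real.sqrt_pos.mpr (by linarith [h.1])
  refine ⟨_, inv_pos.mpr h1, rfl, ?_⟩
  rw [inv_pow, Real.sq_sqrt (by linarith [h.1])]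
  exact inv_mul_cancel₀ (by linarith [h.1])

lemma mink_toHyp_nonpos_iff {z : Mink} (h : IsFuture z) (e : Mink) :
    mink (toHyp z h) e ≤ 0 ↔ mink z e ≤ 0 := by
  obtain ⟨a, ha, h1, -⟩ := exists_toHyp_eq h
  rw [h1, mink_smul_left]
  constructor <;> intro h <;> nlinarith

lemma mink_toHyp_eq_zero_iff {z : Mink} (h : IsFuture z) (e : Mink) :
    mink (toHyp z h) e = 0 ↔ mink z e = 0 := by
  obtain ⟨a, ha, h1, -⟩ := exists_toHyp_eq h
  rw [h1, mink_smul_left]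
  simp [ha.ne']

lemma mink_toHyp_neg_iff {z : Mink} (h : IsFuture z) (e : Mink) :
    mink (toHyp z h) e < 0 ↔ mink z e < 0 := by
  obtain ⟨a, ha, h1, -⟩ := exists_toHyp_eq h
  rw [h1, mink_smul_left]
  constructor <;> intro h <;> nlinarith

/-- Reversed Cauchy–Schwarz: the component y + (x, y) x of y orthogonal to x has square (x, y)² - 1.
-/
lemma one_le_neg_mink (x y : Hyp3) : 1 ≤ -mink x y := by
  by_contra! h
  have h0 := x.isFuture.mink_neg y.isFuture
  have h1 : 0 ≤ mink ((y : Mink) + mink x y • (x : Mink)) ((y : Mink) + mink x y • (x : Mink)) :=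
    mink_self_nonneg_of_orthogonal x.isFuture.1 (by
      simp only [mink_add_right, mink_smul_right, x.2.1]; ring)
  simp only [mink_add_left, mink_add_right, mink_smul_left, mink_smul_right, mink_comm y x,
    x.2.1, y.2.1] at h1
  nlinarith

lemma cosh_hdist (x y : Hyp3) : Real.cosh (hdist x y) = -mink x y :=
  Real.cosh_arcosh (one_le_neg_mink x y)

lemma hdist_nonneg (x y : Hyp3) : 0 ≤ hdist x y := Real.arcosh_nonneg (one_le_neg_mink x y)

lemma hdist_le_iff {x y z w : Hyp3} : hdist x y ≤ hdist z w ↔ -mink x y ≤ -mink z w :=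
  Real.arcosh_le_arcosh (by linarith [one_le_neg_mink x y]) (by linarith [one_le_neg_mink z w])

lemma bddBelow_image2_hdist (A B : Set Hyp3) : BddBelow (Set.image2 hdist A B) :=
  ⟨0, by rintro _ ⟨x, -, y, -, rfl⟩; exact hdist_nonneg x y⟩

lemma setDist_nonneg (A B : Set Hyp3) : 0 ≤ setDist A B :=
  Real.sInf_nonneg (by rintro _ ⟨x, -, y, -, rfl⟩; exact hdist_nonneg x y)

lemma setDist_le {A B : Set Hyp3} {x y : Hyp3} (hx : x ∈ A) (hy : y ∈ B) :
    setDist A B ≤ hdist x y :=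
  csInf_le (bddBelow_image2_hdist A B) ⟨x, hx, y, hy, rfl⟩

lemma cosh_setDist_le {A B : Set Hyp3} {x y : Hyp3} (hx : x ∈ A) (hy : y ∈ B) :
    Real.cosh (setDist A B) ≤ -mink x y := by
  rw [← cosh_hdist, Real.cosh_le_cosh, abs_of_nonneg (setDist_nonneg A B),
    abs_of_nonneg (hdist_nonneg x y)]
  exact setDist_le hx hy

lemma setDist_singleton_eq {O A : Hyp3} {E : Set Hyp3} (hA : A ∈ E)
    (h : ∀ x ∈ E, -mink O A ≤ -mink O x) : setDist {O} E = hdist O A := by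
  refine le_antisymm (setDist_le rfl hA) (le_csInf ⟨_, O, rfl, A, hA, rfl⟩ ?_)
  rintro _ ⟨_, rfl, x, hx, rfl⟩
  exact hdist_le_iff.mpr (h x hx)

lemma mink_self_pos_of_hyp {v : Hyp3} {y : Mink} (hy : mink v y = 0) (h : y ≠ 0) :
    0 < mink y y := mink_self_pos_of_orthogonal v.isFuture.1 hy h

/-- Unit normals of two intersecting hyperplanes. -/
lemma abs_mink_lt_one {v : Hyp3} {e f : Mink} (he : mink e e = 1) (hf : mink f f = 1)
    (hve : mink v e = 0) (hvf : mink v f = 0) (h1 : e ≠ f) (h2 : e ≠ -f) :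
    -1 < mink e f ∧ mink e f < 1 := by
  have h3 := mink_self_pos_of_hyp (v := v) (y := e - f) (by simp [hve, hvf]) (sub_ne_zero.mpr h1)
  have h4 := mink_self_pos_of_hyp (v := v) (y := e + f) (by simp [hve, hvf])
    (by rwa [Ne, add_eq_zero_iff_eq_neg])
  simp only [mink_sub_left, mink_sub_right, mink_add_left, mink_add_right, he, hf,
    mink_comm f e] at h3 h4
  constructor <;> linarith

/-! ### Orthogonal complements -/

lemma mem_orthogonal_span_iff {s : Set Mink} {y : Mink} :
    y ∈ minkForm.orthogonal (Submodule.span ℝ s) ↔ ∀ e ∈ s, mink y e = 0 := by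
  rw [LinearMap.BilinForm.mem_orthogonal_iff]
  constructor
  · intro h e he
    have := h e (Submodule.subset_span he)
    rwa [minkForm_apply, mink_comm] at this
  · intro h e he
    rw [minkForm_apply]
    induction he using Submodule.span_induction with
    | mem x hx => rw [mink_comm]; exact h x hx
    | zero => simp
    | add x z _ _ hx hz => simp [hx, hz]
    | smul a x _ hx => simp [hx]

lemma finrank_orthogonal_span_range {k : ℕ} {v : Fin k → Mink} (hv : LinearIndependent ℝ v) :
    Module.finrank ℝ (minkForm.orthogonal (Submodule.span ℝ (Set.range v))) = 4 - k := by
  rw [finrank_orthogonal_minkForm, finrank_span_eq_card hv, Fintype.card_fin]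

lemma finrank_orthogonal_span_singleton {e : Mink} (he : e ≠ 0) :
    Module.finrank ℝ (minkForm.orthogonal (Submodule.span ℝ {e})) = 3 := by
  rw [finrank_orthogonal_minkForm, finrank_span_singleton he]

lemma ne_zero_of_mink_self {e : Mink} (he : mink e e = 1) : e ≠ 0 := by
  rintro rfl; simp at he

lemma linearIndependent_pair_of_unit {e f : Mink} (he : mink e e = 1) (hf : mink f f = 1)
    (h1 : e ≠ f) (h2 : e ≠ -f) : LinearIndependent ℝ ![e, f] := by
  rw [LinearIndependent.pair_iff' (ne_zero_of_mink_self he)]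
  rintro a rfl
  simp only [mink_smul_left, mink_smul_right, he] at hf
  have : (a - 1) * (a + 1) = 0 := by linarith
  rcases mul_eq_zero.mp this with h | h
  · exact h1 (by rw [show a = 1 by linarith, one_smul])
  · exact h2 (by rw [show a = -1 by linarith]; simp)

lemma finrank_orthogonal_span_pair {e f : Mink} (he : mink e e = 1) (hf : mink f f = 1)
    (h1 : e ≠ f) (h2 : e ≠ -f) :
    Module.finrank ℝ (minkForm.orthogonal (Submodule.span ℝ {e, f})) = 2 := by
  have := finrank_orthogonal_span_range (linearIndependent_pair_of_unit he hf h1 h2)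
  rwa [Matrix.range_cons_cons_empty] at this

/-- Three vectors leave a nonzero orthogonal vector in dimension four, and it is spacelike because x
is timelike. It serves as a tangent direction at x along the planes of e and f, which may coincide
with each other or with x when fewer conditions are wanted. -/
lemma exists_unit_orthogonal (x : Hyp3) (e f : Mink) :
    ∃ y : Mink, mink y y = 1 ∧ mink x y = 0 ∧ mink y e = 0 ∧ mink y f = 0 := by
  classical
  have h : 0 < Module.finrank ℝ
      (minkForm.orthogonal (Submodule.span ℝ (({(x : Mink), e, f} : Finset Mink) : Set Mink))) := by
    rw [finrank_orthogonal_minkForm]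
    have h1 := finrank_span_finset_le_card (R := ℝ) ({(x : Mink), e, f} : Finset Mink)
    have h2 := Finset.card_le_three (a := (x : Mink)) (b := e) (c := f)
    rw [Set.finrank] at h1
    omega
  obtain ⟨y, hy⟩ := (Module.finrank_pos_iff_exists_ne_zero).mp h
  have hy1 := mem_orthogonal_span_iff.mp y.2
  simp only [Finset.coe_insert, Finset.coe_singleton, Set.mem_insert_iff, Set.mem_singleton_iff,
    forall_eq_or_imp, forall_eq] at hy1
  obtain ⟨h1, h2, h3⟩ := hy1
  have hpos : 0 < mink y y := mink_self_pos_of_hyp (by rwa [mink_comm]) (by simpa using hy)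
  have hs : √(mink y y) ^ 2 = mink y y := Real.sq_sqrt hpos.le
  have hs0 : 0 < √(mink y y) := Real.sqrt_pos.mpr hpos
  refine ⟨(√(mink y y))⁻¹ • y, ?_, ?_, ?_, ?_⟩
  · simp only [mink_smul_left, mink_smul_right]
    field_simp
    linarith
  · rw [mink_comm]; simp [h1]
  · simp [h2]
  · simp [h3]

/-! ### Geodesics -/

lemma isFuture_add_smul {x : Hyp3} {y : Mink} (hxy : mink x y = 0) (hy : mink y y = 1) {s : ℝ}
    (hs : |s| < 1) : IsFuture ((x : Mink) + s • y) := by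
  have := (sq_lt_one_iff_abs_lt_one s).mpr hs
  refine isFuture_of_mink_neg ?_ x.isFuture ?_ <;>
    simp only [mink_add_left, mink_add_right, mink_smul_left, mink_smul_right, hxy, hy,
      mink_comm y x, x.2.1] <;> nlinarith

/-- The geodesic through `x` with the unit tangent vector `y`, parametrized by `sinh` of the
length. -/
noncomputable def geod (x : Hyp3) (y : Mink) (hxy : mink x y = 0) (hy : mink y y = 1) (r : ℝ) :
    Hyp3 :=
  ⟨√(1 + r ^ 2) • (x : Mink) + r • y, by
    have h0 : 0 < √(1 + r ^ 2) := Real.sqrt_pos.mpr (by positivity)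
    have h1 : √(1 + r ^ 2) ^ 2 = 1 + r ^ 2 := Real.sq_sqrt (by positivity)
    have h2 : mink (√(1 + r ^ 2) • (x : Mink) + r • y) (√(1 + r ^ 2) • (x : Mink) + r • y) = -1 := by
      simp only [mink_add_left, mink_add_right, mink_smul_left, mink_smul_right, hxy, hy,
        mink_comm y x, x.2.1]
      linarith
    refine ⟨h2, (isFuture_of_mink_neg (by rw [h2]; norm_num) x.isFuture ?_).2⟩
    simp only [mink_add_left, mink_smul_left, mink_comm y x, hxy, x.2.1]
    linarith⟩

lemma mink_geod (x : Hyp3) (y : Mink) (hxy : mink x y = 0) (hy : mink y y = 1) (r : ℝ) (e : Mink) :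
    mink (geod x y hxy hy r) e = √(1 + r ^ 2) * mink x e + r * mink y e := by
  simp [geod]

lemma continuous_geod (x : Hyp3) (y : Mink) (hxy : mink x y = 0) (hy : mink y y = 1) :
    Continuous (geod x y hxy hy) := by
  refine Continuous.subtype_mk ?_ _
  fun_prop

lemma geod_zero (x : Hyp3) (y : Mink) (hxy : mink x y = 0) (hy : mink y y = 1) :
    geod x y hxy hy 0 = x := by
  apply Subtype.ext; simp [geod]

/-- If O were on the bounding plane, the geodesic from O in the direction e would leave the
half-space at once. -/
lemma mink_neg_of_mem_interior {P : Set Hyp3} {O : Hyp3} (hO : O ∈ interior P) {e : Mink}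
    (he : mink e e = 1) (hP : P ⊆ halfSpace e) : mink O e < 0 := by
  refine lt_of_le_of_ne (hP (interior_subset hO)) fun h => ?_
  have h1 : ∀ᶠ r in nhds (0 : ℝ), geod O e h he r ∈ interior P :=
    (continuous_geod O e h he).continuousAt.eventually_mem
      (by rw [geod_zero]; exact isOpen_interior.mem_nhds hO)
  obtain ⟨r, hr, hr0⟩ := ((h1.filter_mono nhdsWithin_le_nhds).and
    (self_mem_nhdsWithin : Set.Ioi (0 : ℝ) ∈ nhdsWithin 0 (Set.Ioi 0))).exists
  have h2 : mink (geod O e h he r) e ≤ 0 := hP (interior_subset hr)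
  rw [mink_geod, h, he] at h2
  have : 0 < r := hr0
  linarith

/-! ### Irredundant presentations of polytopes -/

/-- `S` is the set of unit outer normals of the facets of `P`: no half-space is superfluous. -/
structure IsIrredundant (P : Set Hyp3) (S : Finset Mink) : Prop where
  unit : ∀ e ∈ S, mink e e = 1
  mem_iff : ∀ x : Hyp3, x ∈ P ↔ ∀ e ∈ S, mink x e ≤ 0
  exists_strict : ∃ O : Hyp3, ∀ e ∈ S, mink O e < 0
  exists_rel : ∀ e ∈ S, ∃ z : Hyp3, mink z e = 0 ∧ ∀ f ∈ S, f ≠ e → mink z f < 0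

/-- Take a presentation with the fewest half-spaces. Dropping e admits a point y that violates only
e; the segment from the interior point O to y crosses the plane of e at a point strictly inside all
other half-spaces. -/
lemma IsConvexPolytope.exists_isIrredundant {P : Set Hyp3} (hP : IsConvexPolytope P) :
    ∃ S, IsIrredundant P S := by
  classical
  obtain ⟨⟨S₀, hS₀, rfl⟩, O, hO⟩ := hP
  set P : Set Hyp3 := ⋂ e ∈ S₀, halfSpace e with hPdef
  let Q : Set (Finset Mink) := {S | (∀ e ∈ S, mink e e = 1) ∧
    ∀ x : Hyp3, x ∈ P ↔ ∀ e ∈ S, mink x e ≤ 0}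
  have hQ : Q.Nonempty := ⟨S₀, hS₀, fun x => by simp [hPdef, halfSpace]⟩
  obtain ⟨S, hS, hmin⟩ := WellFounded.has_min (measure Finset.card).wf Q hQ
  have hO' : ∀ e ∈ S, mink O e < 0 := fun e he =>
    mink_neg_of_mem_interior hO (hS.1 e he) fun x hx => (hS.2 x).mp hx e he
  refine ⟨S, hS.1, hS.2, ⟨O, hO'⟩, fun e he => ?_⟩
  have h1 : S.erase e ∉ Q := fun h => hmin _ h (Finset.card_erase_lt_of_mem he)
  have h2 : ∃ y : Hyp3, (∀ f ∈ S.erase e, mink y f ≤ 0) ∧ 0 < mink y e := by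
    by_contra! h
    refine h1 ⟨fun f hf => hS.1 f (Finset.mem_of_mem_erase hf), fun x => ?_⟩
    rw [hS.2]
    refine ⟨fun hx f hf => hx f (Finset.mem_of_mem_erase hf), fun hx f hf => ?_⟩
    by_cases hfe : f = e
    · rw [hfe]; exact h x hx
    · exact hx f (Finset.mem_erase.mpr ⟨hfe, hf⟩)
  obtain ⟨y, hy, hye⟩ := h2
  have hz : IsFuture (mink y e • (O : Mink) + (-mink O e) • (y : Mink)) :=
    (O.isFuture.smul hye).add (y.isFuture.smul (by linarith [hO' e he]))
  refine ⟨toHyp _ hz, ?_, fun f hf hfe => ?_⟩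
  · rw [mink_toHyp_eq_zero_iff]
    simp only [mink_add_left, mink_smul_left]; ring
  · rw [mink_toHyp_neg_iff]
    simp only [mink_add_left, mink_smul_left]
    have := hO' f hf
    have := hO' e he
    have := hy f (Finset.mem_erase.mpr ⟨hfe, hf⟩)
    nlinarith

namespace IsIrredundant

variable {P : Set Hyp3} {S : Finset Mink}

lemma subset_halfSpace (h : IsIrredundant P S) {e : Mink} (he : e ∈ S) : P ⊆ halfSpace e :=
  fun x hx => (h.mem_iff x).mp hx e he

lemma toHyp_mem_iff (h : IsIrredundant P S) {z : Mink} (hz : IsFuture z) :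
    toHyp z hz ∈ P ↔ ∀ e ∈ S, mink z e ≤ 0 := by
  rw [h.mem_iff]
  exact forall₂_congr fun e _ => mink_toHyp_nonpos_iff hz e

lemma ne_neg (h : IsIrredundant P S) {e f : Mink} (he : e ∈ S) (hf : f ∈ S) : e ≠ -f := by
  obtain ⟨O, hO⟩ := h.exists_strict
  rintro rfl
  have h1 := hO _ he
  have h2 := hO _ hf
  simp only [mink_neg_right] at h1
  linarith

/-- Planes through z contain the direction y, and the other inequalities are strict at z, so they
survive a small step. -/
lemma exists_perturbation {z y : Mink} (hz : IsFuture z)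
    (hS : ∀ f ∈ S, mink z f ≤ 0) (hy : ∀ f ∈ S, mink z f = 0 → mink y f = 0) :
    ∃ ε : ℝ, 0 < ε ∧ IsFuture (z + ε • y) ∧ ∀ f ∈ S, mink (z + ε • y) f ≤ 0 := by
  have hc : ∀ a b : ℝ, ContinuousAt (fun ε : ℝ => a + ε * b) 0 := fun a b => by fun_prop
  have h1 : ∀ᶠ ε in nhds (0 : ℝ), mink (z + ε • y) (z + ε • y) < 0 := by
    have : ContinuousAt (fun ε : ℝ => mink (z + ε • y) (z + ε • y)) 0 := by
      simp only [mink_add_left, mink_add_right, mink_smul_left, mink_smul_right]; fun_prop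
    exact this.eventually_lt continuousAt_const (by simpa using hz.1)
  have h2 : ∀ᶠ ε in nhds (0 : ℝ), mink (z + ε • y) z < 0 := by
    simp only [mink_add_left, mink_smul_left]
    exact (hc _ _).eventually_lt continuousAt_const (by simpa using hz.1)
  have h3 : ∀ᶠ ε in nhds (0 : ℝ), ∀ f ∈ S, mink (z + ε • y) f ≤ 0 := by
    rw [Filter.eventually_all_finset]
    intro f hf
    simp only [mink_add_left, mink_smul_left]
    rcases (hS f hf).lt_or_eq with h | h
    · exact ((hc _ _).eventually_lt continuousAt_const (by simpa using h)).mono fun _ h => h.le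
    · simp [h, hy f hf h]
  obtain ⟨ε, ⟨h1, h2, h3⟩, hε⟩ := (((h1.and (h2.and h3)).filter_mono nhdsWithin_le_nhds).and
    (self_mem_nhdsWithin : Set.Ioi (0 : ℝ) ∈ nhdsWithin 0 (Set.Ioi 0))).exists
  exact ⟨ε, hε, isFuture_of_mink_neg h1 hz h2, h3⟩

/-- Add to one point of F a further point for each facet plane that does not contain F. The sum is
again future-directed, and a sum of nonpositive products vanishes only if every summand does. -/
lemma exists_relative_interior (h : IsIrredundant P S) {F : Set Hyp3} (hF : F ⊆ P)
    (hne : F.Nonempty) {e : Mink} (he : ∀ x ∈ F, mink x e = 0) :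
    ∃ z : Mink, IsFuture z ∧ mink z e = 0 ∧ (∀ f ∈ S, mink z f ≤ 0) ∧
      ∀ f ∈ S, mink z f = 0 → ∀ x ∈ F, mink x f = 0 := by
  classical
  suffices ∀ T ⊆ S, ∃ z : Mink, IsFuture z ∧ mink z e = 0 ∧ (∀ f ∈ S, mink z f ≤ 0) ∧
      ∀ f ∈ T, mink z f = 0 → ∀ x ∈ F, mink x f = 0 from this S le_rfl
  intro T
  induction T using Finset.induction_on with
  | empty =>
    intro _
    obtain ⟨x, hx⟩ := hne
    exact ⟨x, x.isFuture, he x hx, (h.mem_iff x).mp (hF hx), by simp⟩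
  | insert f T _ ih =>
    intro hT
    obtain ⟨z, hz, hze, hzS, hzT⟩ := ih ((Finset.subset_insert f T).trans hT)
    by_cases hf : ∀ x ∈ F, mink x f = 0
    · exact ⟨z, hz, hze, hzS, fun g hg => (Finset.mem_insert.mp hg).elim
        (fun hgf _ => hgf ▸ hf) (hzT g)⟩
    · push Not at hf
      obtain ⟨x, hx, hxf⟩ := hf
      have hxP := (h.mem_iff x).mp (hF hx)
      refine ⟨z + x, hz.add x.isFuture, by simp [hze, he x hx], fun g hg => ?_, fun g hg h0 => ?_⟩
      · rw [mink_add_left]; linarith [hzS g hg, hxP g hg]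
      · rw [mink_add_left] at h0
        have hgS := hT hg
        have h1 := hzS g hgS
        have h2 := hxP g hgS
        rcases Finset.mem_insert.mp hg with rfl | hg
        · exact absurd (by linarith) hxf
        · exact hzT g hg (by linarith)

/-- The linear span of a face is cut out by the facet hyperplanes that contain the face. -/
lemma mem_span_face_iff (h : IsIrredundant P S) {e : Mink} (he : P ⊆ halfSpace e)
    (hne : (faceOf P e).Nonempty) (y : Mink) :
    y ∈ Submodule.span ℝ ((fun x : Hyp3 => (x : Mink)) '' faceOf P e) ↔
      ∀ f ∈ S, (∀ x ∈ faceOf P e, mink x f = 0) → mink y f = 0 := by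
  constructor
  · intro hy f _ hf
    induction hy using Submodule.span_induction with
    | mem x hx => obtain ⟨x, hx, rfl⟩ := hx; exact hf x hx
    | zero => simp
    | add x z _ _ hx hz => simp [hx, hz]
    | smul a x _ hx => simp [hx]
  · intro hy
    obtain ⟨z, hz, hze, hzS, hzF⟩ := h.exists_relative_interior (F := faceOf P e)
      (fun _ hx => hx.1) hne (fun _ hx => hx.2)
    have hy' : ∀ f ∈ S, mink z f = 0 → mink y f = 0 := fun f hf h0 => hy f hf (hzF f hf h0)
    -- Small steps from z along y and along -y both stay in P. Since e is nonpositive on P and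
    -- vanishes at z, it vanishes on y, so z and z + εy both lie in the cone over the face and y is
    -- a multiple of their difference.
    obtain ⟨ε, hε, h1, h2⟩ := exists_perturbation hz hzS hy'
    obtain ⟨δ, hδ, h3, h4⟩ := exists_perturbation (y := -y) hz hzS (by simpa using hy')
    have h5 : mink (toHyp _ h1) e ≤ 0 := he ((h.toHyp_mem_iff h1).mpr h2)
    have h6 : mink (toHyp _ h3) e ≤ 0 := he ((h.toHyp_mem_iff h3).mpr h4)
    rw [mink_toHyp_nonpos_iff] at h5 h6
    simp only [mink_add_left, mink_smul_left, mink_neg_left, hze, zero_add] at h5 h6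
    have hye : mink y e = 0 := by
      apply le_antisymm <;> nlinarith
    have key : ∀ w (hw : IsFuture w), (∀ f ∈ S, mink w f ≤ 0) → mink w e = 0 →
        w ∈ Submodule.span ℝ ((fun x : Hyp3 => (x : Mink)) '' faceOf P e) := by
      intro w hw hwS hwe
      obtain ⟨a, ha, ha1, -⟩ := exists_toHyp_eq hw
      have hmem : toHyp w hw ∈ faceOf P e :=
        ⟨(h.toHyp_mem_iff hw).mpr hwS, (mink_toHyp_eq_zero_iff hw e).mpr hwe⟩
      have := Submodule.smul_mem _ a⁻¹ (Submodule.subset_span (R := ℝ)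
        (Set.mem_image_of_mem (fun x : Hyp3 => (x : Mink)) hmem))
      simpa [ha1, smul_smul, inv_mul_cancel₀ ha.ne'] using this
    have h7 := key z hz hzS hze
    have h8 := key _ h1 h2 (by simp [hze, hye])
    have h9 := Submodule.smul_mem _ ε⁻¹ (Submodule.sub_mem _ h8 h7)
    simpa [smul_smul, inv_mul_cancel₀ hε.ne'] using h9

lemma mink_eq_zero_of_mem_span_face {e y : Mink}
    (hy : y ∈ Submodule.span ℝ ((fun x : Hyp3 => (x : Mink)) '' faceOf P e)) : mink y e = 0 := by
  induction hy using Submodule.span_induction with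
  | mem x hx => obtain ⟨x, hx, rfl⟩ := hx; exact hx.2
  | zero => simp
  | add x z _ _ hx hz => simp [hx, hz]
  | smul a x _ hx => simp [hx]

lemma faceOf_nonempty {k : ℕ} {e : Mink} (h : IsFace k P (faceOf P e)) :
    (faceOf P e).Nonempty := by
  by_contra! h0
  have := h.2
  rw [h0, Set.image_empty, Submodule.span_empty, finrank_bot] at this
  omega

/-- If no member of S vanished on the face of e, the span of the face would be everything and
contain e, although (e, e) = 1. A member f ≠ e vanishing on the face would confine its span to the
complement of e and f, of dimension 2 instead of 3. -/
lemma isFacetNormal_iff (h : IsIrredundant P S) {e : Mink} : IsFacetNormal P e ↔ e ∈ S := by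
  constructor
  · rintro ⟨he, hP, hface⟩
    have hne := faceOf_nonempty hface
    have hspan := h.mem_span_face_iff hP hne
    have h1 : ∃ f ∈ S, ∀ x ∈ faceOf P e, mink x f = 0 := by
      by_contra! h1
      have h2 : e ∈ Submodule.span ℝ ((fun x : Hyp3 => (x : Mink)) '' faceOf P e) := by
        rw [hspan]
        intro f hf h0
        obtain ⟨x, hx, hxf⟩ := h1 f hf
        exact absurd (h0 x hx) hxf
      have := mink_eq_zero_of_mem_span_face h2
      rw [he] at this
      norm_num at this
    obtain ⟨f, hf, hfe⟩ := h1
    by_cases hef : e = f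
    · rwa [hef]
    exfalso
    have hne' : e ≠ -f := by
      obtain ⟨O, hO⟩ := h.exists_strict
      rintro rfl
      have h2 : mink O (-f) ≤ 0 := hP ((h.mem_iff O).mpr fun g hg => (hO g hg).le)
      have h3 := hO f hf
      simp only [mink_neg_right] at h2
      linarith
    have h2 : Submodule.span ℝ ((fun x : Hyp3 => (x : Mink)) '' faceOf P e) ≤
        minkForm.orthogonal (Submodule.span ℝ {e, f}) := by
      intro y hy
      rw [mem_orthogonal_span_iff]
      rintro g (rfl | rfl)
      · exact mink_eq_zero_of_mem_span_face hy
      · exact (hspan y).mp hy _ hf hfe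
    have h3 := Submodule.finrank_mono h2
    rw [finrank_orthogonal_span_pair he (h.unit f hf) hef hne', hface.2] at h3
    omega
  · intro he
    have hP := h.subset_halfSpace he
    refine ⟨h.unit e he, hP, ⟨e, h.unit e he, hP, rfl⟩, ?_⟩
    obtain ⟨z, hze, hz⟩ := h.exists_rel e he
    have hzF : z ∈ faceOf P e := ⟨(h.mem_iff z).mpr fun f hf => by
      by_cases hfe : f = e
      · rw [hfe, hze]
      · exact (hz f hf hfe).le, hze⟩
    rw [show Submodule.span ℝ ((fun x : Hyp3 => (x : Mink)) '' faceOf P e) =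
        minkForm.orthogonal (Submodule.span ℝ {e}) from ?_]
    · exact finrank_orthogonal_span_singleton (ne_zero_of_mink_self (h.unit e he))
    ext y
    rw [h.mem_span_face_iff hP ⟨z, hzF⟩, mem_orthogonal_span_iff]
    constructor
    · rintro hy f rfl
      exact hy f he fun x hx => hx.2
    · intro hy f hf hfF
      by_cases hfe : f = e
      · rw [hfe]; exact hy e rfl
      · exact absurd (hfF z hzF) (hz f hf hfe).ne

/-- An edge is the intersection of any two facets that contain it. -/
lemma edge_spec (h : IsIrredundant P S) {E : Set Hyp3} (hE : IsEdge P E) {e f : Mink}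
    (he : e ∈ S) (hf : f ∈ S) (hef : e ≠ f) (hEe : ∀ x ∈ E, mink x e = 0)
    (hEf : ∀ x ∈ E, mink x f = 0) :
    E = faceOf P e ∩ faceOf P f ∧
      ∀ g ∈ S, (∀ x ∈ E, mink x g = 0) → ∀ y : Mink, mink y e = 0 → mink y f = 0 →
        mink y g = 0 := by
  obtain ⟨⟨n, hn, hPn, hEn⟩, hdim⟩ := hE
  have hEF : E = faceOf P n := hEn
  subst hEF
  have hne : (faceOf P n).Nonempty := by
    by_contra! h0
    rw [h0, Set.image_empty, Submodule.span_empty, finrank_bot] at hdim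
    omega
  have hspan := h.mem_span_face_iff hPn hne
  have hle : Submodule.span ℝ ((fun x : Hyp3 => (x : Mink)) '' faceOf P n) ≤
      minkForm.orthogonal (Submodule.span ℝ {e, f}) := by
    intro y hy
    rw [mem_orthogonal_span_iff]
    rintro g (rfl | rfl)
    · exact (hspan y).mp hy _ he hEe
    · exact (hspan y).mp hy _ hf hEf
  have heq := Submodule.eq_of_le_of_finrank_eq hle (by
    rw [finrank_orthogonal_span_pair (h.unit e he) (h.unit f hf) hef (h.ne_neg he hf), hdim])
  have hmem : ∀ y : Mink, mink y e = 0 → mink y f = 0 →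
      y ∈ Submodule.span ℝ ((fun x : Hyp3 => (x : Mink)) '' faceOf P n) := by
    intro y hye hyf
    rw [heq, mem_orthogonal_span_iff]
    rintro g (rfl | rfl) <;> assumption
  constructor
  · ext x
    constructor
    · exact fun hx => ⟨⟨hx.1, hEe x hx⟩, hx.1, hEf x hx⟩
    · exact fun hx => ⟨hx.1.1, mink_eq_zero_of_mem_span_face (hmem x hx.1.2 hx.2.2)⟩
  · intro g hg hgE y hye hyf
    exact (hspan y).mp (hmem y hye hyf) g hg hgE

/-- The span of E has dimension 2 and is the orthogonal complement of the facet normals vanishing on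
E, so there are at least two such normals. -/
lemma exists_facets_of_isEdge (h : IsIrredundant P S) {E : Set Hyp3} (hE : IsEdge P E) :
    ∃ e ∈ S, ∃ f ∈ S, e ≠ f ∧ (∀ x ∈ E, mink x e = 0) ∧ ∀ x ∈ E, mink x f = 0 := by
  classical
  obtain ⟨⟨n, hn, hPn, hEn⟩, hdim⟩ := hE
  have hEF : E = faceOf P n := hEn
  subst hEF
  have hne : (faceOf P n).Nonempty := by
    by_contra! h0
    rw [h0, Set.image_empty, Submodule.span_empty, finrank_bot] at hdim
    omega
  set T := S.filter fun f => ∀ x ∈ faceOf P n, mink x f = 0 with hT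
  have heq : Submodule.span ℝ ((fun x : Hyp3 => (x : Mink)) '' faceOf P n) =
      minkForm.orthogonal (Submodule.span ℝ (T : Set Mink)) := by
    ext y
    rw [h.mem_span_face_iff hPn hne, mem_orthogonal_span_iff]
    simp only [hT, Finset.coe_filter, Set.mem_ofPred_eq, and_imp]
  rw [heq, finrank_orthogonal_minkForm] at hdim
  have hcard := finrank_span_finset_le_card (R := ℝ) T
  rw [Set.finrank] at hcard
  obtain ⟨e, he, f, hf, hef⟩ := Finset.one_lt_card.mp (show 1 < T.card by omega)
  rw [hT, Finset.mem_filter] at he hf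
  exact ⟨e, he.1, f, hf.1, hef, he.2, hf.2⟩

lemma finite_setOf_isEdge (h : IsIrredundant P S) : {E | IsEdge P E}.Finite := by
  refine ((S ×ˢ S).finite_toSet.image fun p => faceOf P p.1 ∩ faceOf P p.2).subset fun E hE => ?_
  obtain ⟨e, he, f, hf, hef, h1, h2⟩ := h.exists_facets_of_isEdge hE
  exact ⟨(e, f), by simp [he, hf], (h.edge_spec hE he hf hef h1 h2).1.symm⟩

/-- Supplies the supporting plane of an edge or a vertex: n is taken to be the sum of the normals of
its facets, which vanishes at a point of P only if every summand does. -/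
lemma exists_faceOf_eq {v : Hyp3} {n : Mink} (hn0 : n ≠ 0) (hvn : mink v n = 0)
    (hP : ∀ x ∈ P, mink x n ≤ 0) :
    ∃ m : Mink, mink m m = 1 ∧ P ⊆ halfSpace m ∧ ∀ x : Hyp3, x ∈ faceOf P m ↔
      x ∈ P ∧ mink x n = 0 := by
  have hpos := mink_self_pos_of_hyp hvn hn0
  have hs : √(mink n n) ^ 2 = mink n n := Real.sq_sqrt hpos.le
  have hs0 : 0 < √(mink n n) := Real.sqrt_pos.mpr hpos
  refine ⟨(√(mink n n))⁻¹ • n, ?_, fun x hx => ?_, fun x => ?_⟩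
  · simp only [mink_smul_left, mink_smul_right]
    field_simp
    linarith
  · change mink x _ ≤ 0
    rw [mink_smul_right]
    exact mul_nonpos_of_nonneg_of_nonpos (inv_pos.mpr hs0).le (hP x hx)
  · simp [faceOf, hyperplane, hs0.ne']

lemma isEdge_inter (h : IsIrredundant P S) {e f : Mink} (he : e ∈ S) (hf : f ∈ S) (hef : e ≠ f)
    {z : Hyp3} (hze : mink z e = 0) (hzf : mink z f = 0)
    (hz : ∀ g ∈ S, g ≠ e → g ≠ f → mink z g < 0) : IsEdge P (faceOf P e ∩ faceOf P f) := by
  have hzP : z ∈ P := (h.mem_iff z).mpr fun g hg => by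
    by_cases h1 : g = e
    · rw [h1, hze]
    by_cases h2 : g = f
    · rw [h2, hzf]
    exact (hz g hg h1 h2).le
  obtain ⟨m, hm, hPm, hmF⟩ := exists_faceOf_eq (P := P) (v := z) (n := e + f)
    (by rw [Ne, add_eq_zero_iff_eq_neg]; exact h.ne_neg he hf) (by simp [hze, hzf])
    (fun x hx => by
      rw [mink_add_right]; linarith [(h.mem_iff x).mp hx e he, (h.mem_iff x).mp hx f hf])
  have hEq : faceOf P e ∩ faceOf P f = faceOf P m := by
    ext x
    rw [hmF]
    constructor
    · rintro ⟨⟨hx, h1⟩, -, h2⟩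
      exact ⟨hx, by rw [mink_add_right, show mink x e = 0 from h1, show mink x f = 0 from h2]; simp⟩
    · rintro ⟨hx, h1⟩
      rw [mink_add_right] at h1
      have h2 := (h.mem_iff x).mp hx e he
      have h3 := (h.mem_iff x).mp hx f hf
      exact ⟨⟨hx, show mink x e = 0 by linarith⟩, hx, show mink x f = 0 by linarith⟩
  have hzm : z ∈ faceOf P m := by rw [← hEq]; exact ⟨⟨hzP, hze⟩, hzP, hzf⟩
  refine ⟨⟨m, hm, hPm, hEq⟩, ?_⟩
  rw [hEq, show Submodule.span ℝ ((fun x : Hyp3 => (x : Mink)) '' faceOf P m) =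
        minkForm.orthogonal (Submodule.span ℝ {e, f}) from ?_]
  · exact finrank_orthogonal_span_pair (h.unit e he) (h.unit f hf) hef (h.ne_neg he hf)
  ext y
  rw [h.mem_span_face_iff hPm ⟨z, hzm⟩, mem_orthogonal_span_iff]
  constructor
  · rintro hy g (rfl | rfl)
    · exact hy _ he fun x hx => by rw [← hEq] at hx; exact hx.1.2
    · exact hy _ hf fun x hx => by rw [← hEq] at hx; exact hx.2.2
  · intro hy g hg hgF
    by_cases h1 : g = e
    · rw [h1]; exact hy e (by simp)
    by_cases h2 : g = f
    · rw [h2]; exact hy f (by simp)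
    · exact absurd (hgF z hzm) (hz g hg h1 h2).ne

/-- The vector y certifies that g is independent of e and f, so the three planes have only one
common point. -/
lemma isVertex_of_mem (h : IsIrredundant P S) {e f g : Mink} (he : e ∈ S) (hf : f ∈ S) (hg : g ∈ S)
    (hef : e ≠ f) {v : Hyp3} (hv : v ∈ P) (hve : mink v e = 0) (hvf : mink v f = 0)
    (hvg : mink v g = 0) {y : Mink} (hye : mink y e = 0) (hyf : mink y f = 0)
    (hyg : mink y g ≠ 0) : IsVertex P v := by
  have hle : ∀ x ∈ P, mink x e ≤ 0 ∧ mink x f ≤ 0 ∧ mink x g ≤ 0 := fun x hx =>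
    ⟨(h.mem_iff x).mp hx e he, (h.mem_iff x).mp hx f hf, (h.mem_iff x).mp hx g hg⟩
  have hind : LinearIndependent ℝ ![e, f, g] := by
    have h1 := LinearIndependent.pair_iff.mp (linearIndependent_pair_of_unit (h.unit e he)
      (h.unit f hf) hef (h.ne_neg he hf))
    rw [Fintype.linearIndependent_iff]
    intro a ha
    simp only [Fin.sum_univ_three, Matrix.cons_val_zero, Matrix.cons_val_one,
      Matrix.cons_val] at ha
    have h2 : mink y (a 0 • e + a 1 • f + a 2 • g) = 0 := by rw [ha]; simp
    simp only [mink_add_right, mink_smul_right, hye, hyf, mul_zero, zero_add] at h2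
    have h3 : a 2 = 0 := (mul_eq_zero.mp h2).resolve_right hyg
    rw [h3, zero_smul, add_zero] at ha
    have h4 := h1 _ _ ha
    intro i
    fin_cases i
    exacts [h4.1, h4.2, h3]
  obtain ⟨m, hm, hPm, hmF⟩ := exists_faceOf_eq (P := P) (v := v) (n := e + f + g)
    (by
      obtain ⟨O, hO⟩ := h.exists_strict
      intro h0
      have : mink O (e + f + g) = 0 := by rw [h0]; simp
      simp only [mink_add_right] at this
      linarith [hO e he, hO f hf, hO g hg])
    (by simp [hve, hvf, hvg])
    (fun x hx => by
      simp only [mink_add_right]; linarith [(hle x hx).1, (hle x hx).2.1, (hle x hx).2.2])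
  have hfin := finrank_orthogonal_span_range hind
  have hmem : ∀ x : Mink, mink x e = 0 → mink x f = 0 → mink x g = 0 →
      x ∈ minkForm.orthogonal (Submodule.span ℝ (Set.range ![e, f, g])) := by
    intro x h1 h2 h3
    rw [mem_orthogonal_span_iff]
    rintro _ ⟨i, rfl⟩
    fin_cases i
    exacts [h1, h2, h3]
  have hv0 : (v : Mink) ≠ 0 := by
    intro h0
    have := v.2.1
    rw [h0] at this
    simp at this
  have huniq : ∀ x : Hyp3, mink x e = 0 → mink x f = 0 → mink x g = 0 → x = v := by
    intro x h1 h2 h3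
    obtain ⟨a, ha⟩ := (finrank_eq_one_iff_of_nonzero'
      (⟨v, hmem v hve hvf hvg⟩ : minkForm.orthogonal (Submodule.span ℝ (Set.range ![e, f, g])))
      (by simpa using hv0)).mp hfin ⟨x, hmem x h1 h2 h3⟩
    have ha' : a • (v : Mink) = x := congrArg Subtype.val ha
    have h4 := x.2.1
    have h5 := x.2.2
    rw [← ha'] at h4 h5
    simp only [mink_smul_left, mink_smul_right, v.2.1, Pi.smul_apply, smul_eq_mul] at h4 h5
    have h6 : 0 < a := pos_of_mul_pos_left h5 v.2.2.le
    have h7 : a = 1 := by nlinarith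
    apply Subtype.ext
    rw [← ha', h7, one_smul]
  refine ⟨⟨m, hm, hPm, ?_⟩, ?_⟩
  · ext x
    change x = v ↔ x ∈ faceOf P m
    rw [hmF]
    constructor
    · rintro rfl
      exact ⟨hv, by simp [hve, hvf, hvg]⟩
    · rintro ⟨hx, h0⟩
      obtain ⟨h1, h2, h3⟩ := hle x hx
      simp only [mink_add_right] at h0
      exact huniq x (by linarith) (by linarith) (by linarith)
  · rw [Set.image_singleton, finrank_span_singleton hv0]

end IsIrredundant

/-! ### Feet of perpendiculars on edges -/

lemma continuous_mink_left (e : Mink) : Continuous fun x : Hyp3 => mink x e := by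
  have h (i : Fin 4) : Continuous fun x : Hyp3 => (x : Mink) i * e i :=
    ((continuous_apply i).comp continuous_subtype_val).mul continuous_const
  exact (((h 0).neg.add (h 1)).add (h 2)).add (h 3)

/-- A positive multiple of the orthogonal projection of `O` to the intersection of the hyperplanes
with unit normals `e` and `f`. -/
def foot (O : Hyp3) (e f : Mink) : Mink :=
  (1 - mink e f ^ 2) • (O : Mink) + (mink e f * mink O f - mink O e) • e +
    (mink e f * mink O e - mink O f) • f

section Foot

variable {O : Hyp3} {e f : Mink}

lemma mink_foot_left (he : mink e e = 1) : mink (foot O e f) e = 0 := by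
  simp only [foot, mink_add_left, mink_smul_left, he, mink_comm f e]; ring

lemma mink_foot_right (hf : mink f f = 1) : mink (foot O e f) f = 0 := by
  simp only [foot, mink_add_left, mink_smul_left, hf]; ring

lemma mink_foot (g : Mink) : mink (foot O e f) g = (1 - mink e f ^ 2) * mink O g +
    (mink e f * mink O f - mink O e) * mink e g + (mink e f * mink O e - mink O f) * mink f g := by
  simp only [foot, mink_add_left, mink_smul_left]

lemma mink_foot_base : mink (foot O e f) O = -(1 - mink e f ^ 2 +
    (mink O e ^ 2 + mink O f ^ 2 - 2 * mink e f * (mink O e * mink O f))) := by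
  rw [mink_foot, O.2.1, mink_comm e O, mink_comm f O]; ring

lemma mink_foot_of_orthogonal {x : Mink} (hxe : mink x e = 0) (hxf : mink x f = 0) :
    mink (foot O e f) x = (1 - mink e f ^ 2) * mink O x := by
  rw [mink_foot, mink_comm e x, mink_comm f x, hxe, hxf]; ring

lemma mink_foot_self (he : mink e e = 1) (hf : mink f f = 1) :
    mink (foot O e f) (foot O e f) = -((1 - mink e f ^ 2) * (1 - mink e f ^ 2 +
    (mink O e ^ 2 + mink O f ^ 2 - 2 * mink e f * (mink O e * mink O f)))) := by
  rw [mink_foot_of_orthogonal (mink_foot_left he) (mink_foot_right hf), mink_comm O,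
    mink_foot_base]; ring

lemma edge_form_nonneg {m p q : ℝ} (h : m ^ 2 < 1) : 0 ≤ p ^ 2 + q ^ 2 - 2 * m * (p * q) := by
  nlinarith [sq_nonneg (p - m * q), mul_nonneg (sub_nonneg.mpr h.le) (sq_nonneg q)]

lemma isFuture_foot (he : mink e e = 1) (hf : mink f f = 1) (h : mink e f ^ 2 < 1) :
    IsFuture (foot O e f) := by
  have h1 := edge_form_nonneg (p := mink O e) (q := mink O f) h
  refine isFuture_of_mink_neg ?_ O.isFuture ?_
  · rw [mink_foot_self he hf]
    have : 0 < (1 - mink e f ^ 2) * (1 - mink e f ^ 2 +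
      (mink O e ^ 2 + mink O f ^ 2 - 2 * mink e f * (mink O e * mink O f))) := by
      apply mul_pos <;> linarith
    linarith
  · rw [mink_foot_base]; linarith

end Foot

lemma exists_mem_hyperplanes {e f : Mink} (he : mink e e = 1) (hf : mink f f = 1)
    (h : mink e f ^ 2 < 1) (O : Hyp3) : (hyperplane e ∩ hyperplane f).Nonempty :=
  ⟨toHyp _ (isFuture_foot (O := O) he hf h), (mink_toHyp_eq_zero_iff _ _).mpr (mink_foot_left he),
    (mink_toHyp_eq_zero_iff _ _).mpr (mink_foot_right hf)⟩

/-! ### Nonobtuse angles, edges, and their distance from an interior point -/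

namespace IsIrredundant

variable {P : Set Hyp3} {S : Finset Mink}

lemma exists_dihedralAngle (h : IsIrredundant P S) (hC : IsCoxeterPolytope P) {e f : Mink}
    (he : e ∈ S) (hf : f ∈ S) (hef : e ≠ f) {v : Hyp3} (hve : mink v e = 0) (hvf : mink v f = 0) :
    ∃ n : ℕ, 2 ≤ n ∧ dihedralAngle e f = Real.pi / n ∧ -mink e f = Real.cos (Real.pi / n) := by
  obtain ⟨n, hn, hang⟩ := hC.2 e f (h.isFacetNormal_iff.mpr he) (h.isFacetNormal_iff.mpr hf) hef
    ⟨v, hve, hvf⟩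
  have := abs_mink_lt_one (h.unit e he) (h.unit f hf) hve hvf hef (h.ne_neg he hf)
  refine ⟨n, hn, hang, ?_⟩
  rw [← hang, dihedralAngle, Real.cos_arccos] <;> linarith

/-- A product in (0, 1) means crossing planes, and the Coxeter condition makes their angle at most
π/2. A product of at least 1 is excluded by irredundance: a positive combination of relative
interior points of the two facets is orthogonal to e - f, which is therefore spacelike, whereas (e -
f, e - f) = 2 - 2(e, f). -/
lemma mink_nonpos (h : IsIrredundant P S) (hC : IsCoxeterPolytope P) {e f : Mink}
    (he : e ∈ S) (hf : f ∈ S) (hef : e ≠ f) : mink e f ≤ 0 := by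
  by_contra! hpos
  obtain ⟨O, -⟩ := h.exists_strict
  rcases lt_or_ge (mink e f) 1 with h1 | h1
  · obtain ⟨v, hve, hvf⟩ := exists_mem_hyperplanes (h.unit e he) (h.unit f hf) (by nlinarith) O
    obtain ⟨n, hn, -, hcos⟩ := h.exists_dihedralAngle hC he hf hef hve hvf
    have h2 : (2 : ℝ) ≤ n := by exact_mod_cast hn
    have h3 : 0 ≤ Real.cos (Real.pi / n) := by
      apply Real.cos_nonneg_of_neg_pi_div_two_le_of_le
      · have : 0 ≤ Real.pi / n := by positivity
        linarith [Real.pi_pos]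
      · gcongr
    linarith
  · obtain ⟨z, hze, hz⟩ := h.exists_rel e he
    obtain ⟨w, hwf, hw⟩ := h.exists_rel f hf
    have h2 := hz f hf hef.symm
    have h3 := hw e he hef
    have h4 : IsFuture ((-mink w e) • (z : Mink) + (-mink z f) • (w : Mink)) :=
      (z.isFuture.smul (by linarith)).add (w.isFuture.smul (by linarith))
    have h5 := mink_self_pos_of_orthogonal (y := e - f) h4.1 (by
      simp only [mink_add_left, mink_sub_right, mink_smul_left, hze, hwf]; ring)
      (sub_ne_zero.mpr hef)
    simp only [mink_sub_left, mink_sub_right, h.unit e he, h.unit f hf, mink_comm f e] at h5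
    linarith

lemma mink_sq_lt_one (h : IsIrredundant P S) (hC : IsCoxeterPolytope P) {e f : Mink}
    (he : e ∈ S) (hf : f ∈ S) (hef : e ≠ f) (h1 : -1 < mink e f) : mink e f ^ 2 < 1 := by
  nlinarith [h.mink_nonpos hC he hf hef]

lemma mink_sq_lt_one_of_mem (h : IsIrredundant P S) {e f : Mink}
    (he : e ∈ S) (hf : f ∈ S) (hef : e ≠ f) {v : Hyp3} (hve : mink v e = 0) (hvf : mink v f = 0) :
    mink e f ^ 2 < 1 := by
  have := abs_mink_lt_one (h.unit e he) (h.unit f hf) hve hvf hef (h.ne_neg he hf)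
  nlinarith

/-- Since (e, f) ≤ 0, the foot is a positive multiple of O plus nonnegative multiples of e and f,
and the latter can only lower the product with any other normal. -/
lemma mink_foot_neg (h : IsIrredundant P S) (hC : IsCoxeterPolytope P) {e f g : Mink}
    (he : e ∈ S) (hf : f ∈ S) (hef : e ≠ f) (hm : mink e f ^ 2 < 1) {O : Hyp3}
    (hO : ∀ e ∈ S, mink O e < 0) (hg : g ∈ S) (hge : g ≠ e) (hgf : g ≠ f) :
    mink (foot O e f) g < 0 := by
  rw [mink_foot]
  have h1 := h.mink_nonpos hC he hf hef
  have h2 := h.mink_nonpos hC he hg hge.symm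
  have h3 := h.mink_nonpos hC hf hg hgf.symm
  have h4 := hO e he
  have h5 := hO f hf
  have h6 := mul_neg_of_pos_of_neg (sub_pos.mpr hm) (hO g hg)
  have h7 : 0 ≤ mink e f * mink O f - mink O e := by nlinarith
  have h8 : 0 ≤ mink e f * mink O e - mink O f := by nlinarith
  linarith [mul_nonpos_of_nonneg_of_nonpos h7 h2, mul_nonpos_of_nonneg_of_nonpos h8 h3]

lemma foot_mem (h : IsIrredundant P S) (hC : IsCoxeterPolytope P) {e f : Mink}
    (he : e ∈ S) (hf : f ∈ S) (hef : e ≠ f) (hm : mink e f ^ 2 < 1) {O : Hyp3}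
    (hO : ∀ e ∈ S, mink O e < 0) :
    toHyp _ (isFuture_foot (O := O) (h.unit e he) (h.unit f hf) hm) ∈
      faceOf P e ∩ faceOf P f := by
  have hP : toHyp _ (isFuture_foot (O := O) (h.unit e he) (h.unit f hf) hm) ∈ P := by
    rw [h.toHyp_mem_iff]
    intro g hg
    by_cases hge : g = e
    · rw [hge, mink_foot_left (h.unit e he)]
    by_cases hgf : g = f
    · rw [hgf, mink_foot_right (h.unit f hf)]
    exact (h.mink_foot_neg hC he hf hef hm hO hg hge hgf).le
  exact ⟨⟨hP, (mink_toHyp_eq_zero_iff _ _).mpr (mink_foot_left (h.unit e he))⟩, hP,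
    (mink_toHyp_eq_zero_iff _ _).mpr (mink_foot_right (h.unit f hf))⟩

lemma isEdge_of_mink_sq_lt_one (h : IsIrredundant P S) (hC : IsCoxeterPolytope P) {e f : Mink}
    (he : e ∈ S) (hf : f ∈ S) (hef : e ≠ f) (hm : mink e f ^ 2 < 1) :
    IsEdge P (faceOf P e ∩ faceOf P f) := by
  obtain ⟨O, hO⟩ := h.exists_strict
  have hmem := h.foot_mem hC he hf hef hm hO
  exact h.isEdge_inter he hf hef hmem.1.2 hmem.2.2 fun g hg hge hgf =>
    (mink_toHyp_neg_iff _ _).mpr (h.mink_foot_neg hC he hf hef hm hO hg hge hgf)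

/-- The distance from an interior point to an edge. -/
lemma cosh_setDist_edge_sq (h : IsIrredundant P S) (hC : IsCoxeterPolytope P) {e f : Mink}
    (he : e ∈ S) (hf : f ∈ S) (hef : e ≠ f) (hm : mink e f ^ 2 < 1) {O : Hyp3}
    (hO : ∀ e ∈ S, mink O e < 0) :
    Real.cosh (setDist {O} (faceOf P e ∩ faceOf P f)) ^ 2 =
      1 + (mink O e ^ 2 + mink O f ^ 2 - 2 * mink e f * (mink O e * mink O f)) /
        (1 - mink e f ^ 2) := by
  have hfut := isFuture_foot (O := O) (h.unit e he) (h.unit f hf) hm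
  have hs : 0 < 1 - mink e f ^ 2 := sub_pos.mpr hm
  obtain ⟨a, ha, ha1, ha2⟩ := exists_toHyp_eq hfut
  rw [mink_foot_self (h.unit e he) (h.unit f hf)] at ha2
  have hQ := edge_form_nonneg (p := mink O e) (q := mink O f) hm
  rw [setDist_singleton_eq (h.foot_mem hC he hf hef hm hO), cosh_hdist, mink_comm, ha1,
    mink_smul_left, mink_foot_base]
  · set Q := mink O e ^ 2 + mink O f ^ 2 - 2 * mink e f * (mink O e * mink O f) with hQdef
    set s := 1 - mink e f ^ 2 with hsdef
    have h1 : (-(a * -(s + Q))) ^ 2 * s = s + Q := by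
      calc _ = (a ^ 2 * - -(s * (s + Q))) * (s + Q) := by ring
        _ = s + Q := by rw [ha2, one_mul]
    field_simp
    linarith
  · rintro x ⟨⟨-, hxe⟩, -, hxf⟩
    -- On the edge, the product with O is proportional to the product with the foot, so the nearest
    -- point follows from the reversed Cauchy–Schwarz inequality.
    have h2 := one_le_neg_mink (toHyp _ hfut) x
    rw [ha1, mink_smul_left, mink_foot_of_orthogonal hxe hxf] at h2
    rw [mink_comm O, ha1, mink_smul_left, mink_foot_base]
    set Q := mink O e ^ 2 + mink O f ^ 2 - 2 * mink e f * (mink O e * mink O f) with hQdef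
    set s := 1 - mink e f ^ 2 with hsdef
    have h3 : 0 < a * s := mul_pos ha hs
    have h4 : a * s * (a * (s + Q)) = 1 := by linarith
    nlinarith

/-! ### Compactness -/

/-- The ray from x in the direction y tends to the ideal point x + y. If that point satisfied all
the inequalities, the whole ray would stay in P, contrary to boundedness. -/
lemma exists_mink_add_pos (h : IsIrredundant P S) (hc : IsCompact P) {x : Hyp3} (hx : x ∈ P)
    {y : Mink} (hxy : mink x y = 0) (hy : mink y y = 1) : ∃ f ∈ S, 0 < mink x f + mink y f := by
  by_contra! h0
  have h1 : ∀ r : ℝ, 0 ≤ r → geod x y hxy hy r ∈ P := by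
    intro r hr
    rw [h.mem_iff]
    intro f hf
    rw [mink_geod]
    have h2 := h0 f hf
    have h3 := (h.mem_iff x).mp hx f hf
    have h4 : r ≤ √(1 + r ^ 2) := Real.le_sqrt_of_sq_le (by linarith)
    nlinarith
  have h2 := continuous_mink_left (x : Mink)
  obtain ⟨C, hC⟩ := hc.bddBelow_image h2.continuousOn
  have h3 := hC ⟨_, h1 (|C| + 1) (by positivity), rfl⟩
  simp only [mink_geod, x.2.1, mink_comm y x, hxy] at h3
  have h4 : |C| + 1 ≤ √(1 + (|C| + 1) ^ 2) := Real.le_sqrt_of_sq_le (by linarith)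
  linarith [neg_abs_le C]

/-- Every geodesic ray that starts in a compact polytope leaves it through some facet. -/
lemma exists_exit (h : IsIrredundant P S) (hc : IsCompact P) {x : Hyp3} (hx : x ∈ P)
    {y : Mink} (hxy : mink x y = 0) (hy : mink y y = 1) :
    ∃ f ∈ S, 0 < mink y f ∧ ∃ v ∈ P, mink v f = 0 ∧ (mink x f < 0 → 0 < mink v y) ∧
      ∀ g : Mink, mink x g = 0 → mink y g = 0 → mink v g = 0 := by
  classical
  obtain ⟨f₀, hf₀, h0⟩ := h.exists_mink_add_pos hc hx hxy hy
  have hxS := (h.mem_iff x).mp hx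
  obtain ⟨f, hf, hmin⟩ := Finset.exists_min_image (S.filter fun f => 0 < mink y f)
    (fun f => -mink x f / mink y f)
    ⟨f₀, Finset.mem_filter.mpr ⟨hf₀, by linarith [hxS f₀ hf₀]⟩⟩
  obtain ⟨hfS, hfy⟩ := Finset.mem_filter.mp hf
  set s := -mink x f / mink y f with hs
  have hs0 : 0 ≤ s := div_nonneg (by linarith [hxS f hfS]) hfy.le
  have hy0 : 0 < mink y f₀ := by linarith [hxS f₀ hf₀]
  -- The facet `f₀` is crossed before the line x + s y reaches the light cone at s = 1.
  have hs1 : s < 1 := by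
    refine (hmin f₀ (Finset.mem_filter.mpr ⟨hf₀, hy0⟩)).trans_lt ?_
    rw [div_lt_one hy0]; linarith
  have hfut : IsFuture ((x : Mink) + s • y) :=
    isFuture_add_smul hxy hy (by rwa [abs_of_nonneg hs0])
  refine ⟨f, hfS, hfy, toHyp _ hfut, ?_, ?_, fun hxf => ?_, fun g hg1 hg2 => ?_⟩
  · rw [h.toHyp_mem_iff]
    intro g hg
    rw [mink_add_left, mink_smul_left]
    by_cases hgy : 0 < mink y g
    · have := hmin g (Finset.mem_filter.mpr ⟨hg, hgy⟩)
      rw [le_div_iff₀ hgy] at this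
      linarith
    · nlinarith [hxS g hg]
  · rw [mink_toHyp_eq_zero_iff, mink_add_left, mink_smul_left, hs]
    field_simp
    ring
  · obtain ⟨a, ha, ha1, -⟩ := exists_toHyp_eq hfut
    rw [ha1, mink_smul_left, mink_add_left, mink_smul_left, hxy, hy, zero_add, mul_one]
    exact mul_pos ha (div_pos (by linarith) hfy)
  · rw [mink_toHyp_eq_zero_iff, mink_add_left, mink_smul_left, hg1, hg2]; ring

/-- Compactness provides a facet; a ray inside its plane must leave P through a second facet, whose
plane crosses the first. -/
lemma exists_isEdge (h : IsIrredundant P S) (hC : IsCompactCoxeterPolytope P) :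
    ∃ E, IsEdge P E := by
  obtain ⟨O, hO⟩ := h.exists_strict
  have hOP : O ∈ P := (h.mem_iff O).mpr fun f hf => (hO f hf).le
  obtain ⟨y, hy, hOy, -⟩ := exists_unit_orthogonal O O O
  obtain ⟨e, he, -⟩ := h.exists_mink_add_pos hC.2 hOP hOy hy
  obtain ⟨z, hze, hz⟩ := h.exists_rel e he
  have hzP : z ∈ P := (h.mem_iff z).mpr fun f hf => by
    by_cases hfe : f = e
    · rw [hfe, hze]
    · exact (hz f hf hfe).le
  obtain ⟨y, hy, hzy, hye, -⟩ := exists_unit_orthogonal z e e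
  obtain ⟨f, hf, hyf, v, hv, hvf, -, hvg⟩ := h.exists_exit hC.2 hzP hzy hy
  have hef : e ≠ f := by rintro rfl; linarith
  exact ⟨_, h.isEdge_of_mink_sq_lt_one hC.1 he hf hef
    (h.mink_sq_lt_one_of_mem he hf hef (hvg e hze hye) hvf)⟩

lemma exists_isOutermostEdge (h : IsIrredundant P S) (hC : IsCompactCoxeterPolytope P)
    (O : Hyp3) : ∃ E, IsOutermostEdge P O E := by
  obtain ⟨E, hE, hmax⟩ := h.finite_setOf_isEdge.exists_maximalFor (fun E => setDist {O} E) _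
    (h.exists_isEdge hC)
  refine ⟨E, hE, fun E' hE' => ?_⟩
  by_contra! h0
  exact absurd (hmax hE' h0.le) (not_le.mpr h0)

/-- The foot of an interior point lies strictly inside E. Following E from it in both directions, P
is left through the two framing facets. -/
lemma exists_isRidge (h : IsIrredundant P S) (hC : IsCompactCoxeterPolytope P) {E : Set Hyp3}
    (hE : IsEdge P E) : ∃ u, IsRidge P E u := by
  obtain ⟨e, he, f, hf, hef, hEe, hEf⟩ := h.exists_facets_of_isEdge hE
  have hEeq := (h.edge_spec hE he hf hef hEe hEf).1
  have hne : E.Nonempty := by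
    by_contra! h0
    have := hE.2
    rw [h0, Set.image_empty, Submodule.span_empty, finrank_bot] at this
    omega
  obtain ⟨x₀, hx₀⟩ := hne
  obtain ⟨O, hO⟩ := h.exists_strict
  have hm := h.mink_sq_lt_one_of_mem he hf hef (hEe x₀ hx₀) (hEf x₀ hx₀)
  have hxE := h.foot_mem hC.1 he hf hef hm hO
  have hxneg : ∀ g ∈ S, g ≠ e → g ≠ f →
      mink (toHyp _ (isFuture_foot (O := O) (h.unit e he) (h.unit f hf) hm)) g < 0 :=
    fun g hg hge hgf => (mink_toHyp_neg_iff _ _).mpr (h.mink_foot_neg hC.1 he hf hef hm hO hg hge hgf)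
  set x := toHyp _ (isFuture_foot (O := O) (h.unit e he) (h.unit f hf) hm)
  have hx : x ∈ E := by rw [hEeq]; exact hxE
  have hxP : x ∈ P := hxE.1.1
  obtain ⟨y, hy, hxy, hye, hyf⟩ := exists_unit_orthogonal x e f
  obtain ⟨g, hg, hyg, v, hv, hvg, hvy, hvE⟩ := h.exists_exit hC.2 hxP hxy hy
  obtain ⟨k, hk, hyk, w, hw, hwk, hwy, hwE⟩ := h.exists_exit hC.2 hxP (y := -y) (by simpa using hxy)
    (by simpa using hy)
  have hve := hvE e (hEe x hx) hye
  have hvf := hvE f (hEf x hx) hyf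
  have hwe := hwE e (hEe x hx) (by simpa using hye)
  have hwf := hwE f (hEf x hx) (by simpa using hyf)
  simp only [mink_neg_left, Left.neg_pos_iff] at hyk
  have spec := (h.edge_spec hE he hf hef hEe hEf).2
  refine ⟨![e, f, g, k], hE, ?_, hef, fun z hz => ?_, fun z hz => ?_,
    ⟨v, w, ?_, ?_, ?_, ?_, ?_, ?_, ?_⟩, fun h0 => ?_, fun h0 => ?_⟩
  · intro i
    rw [h.isFacetNormal_iff]
    fin_cases i
    exacts [he, hf, hg, hk]
  · rw [hEeq] at hz; exact hz.1
  · rw [hEeq] at hz; exact hz.2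
  · exact h.isVertex_of_mem he hf hg hef hv hve hvf hvg hye hyf hyg.ne'
  · exact h.isVertex_of_mem he hf hk hef hw hwe hwf hwk hye hyf hyk.ne
  -- The exit points lie strictly on opposite sides of the foot along y.
  · rintro rfl
    have h1 := hvy (hxneg g hg (by rintro rfl; linarith) (by rintro rfl; linarith))
    have h2 := hwy (hxneg k hk (by rintro rfl; linarith) (by rintro rfl; linarith))
    rw [mink_neg_right] at h2
    linarith
  · rw [hEeq]; exact ⟨⟨hv, hve⟩, hv, hvf⟩
  · rw [hEeq]; exact ⟨⟨hw, hwe⟩, hw, hwf⟩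
  · exact ⟨hv, hvg⟩
  · exact ⟨hw, hwk⟩
  · have h1 := spec g hg (fun z hz => (h0 hz).2) y hye hyf
    linarith
  · have h1 := spec k hk (fun z hz => (h0 hz).2) y hye hyf
    linarith

/-! ### The distance between two facets -/

/-- Ultraparallel planes have their common perpendicular inside P, crossing planes share an edge,
and asymptotic planes do not occur in a compact polytope. -/
lemma cosh_setDist_facets_le (h : IsIrredundant P S) (hC : IsCompactCoxeterPolytope P)
    {e f : Mink} (he : e ∈ S) (hf : f ∈ S) :
    Real.cosh (setDist (faceOf P e) (faceOf P f)) ≤ max 1 (-mink e f) := by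
  obtain ⟨O, hO⟩ := h.exists_strict
  have hOP : O ∈ P := (h.mem_iff O).mpr fun f hf => (hO f hf).le
  have he1 := h.unit e he
  have hf1 := h.unit f hf
  have hself : ∀ x : Hyp3, x ∈ faceOf P e → x ∈ faceOf P f →
      Real.cosh (setDist (faceOf P e) (faceOf P f)) ≤ max 1 (-mink e f) := fun x hx hx' => by
    refine (cosh_setDist_le hx hx').trans ?_
    rw [x.2.1, neg_neg]
    exact le_max_left _ _
  by_cases hef : e = f
  · subst hef
    obtain ⟨x, hx⟩ := faceOf_nonempty (h.isFacetNormal_iff.mpr he).2.2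
    exact hself x hx hx
  rcases lt_trichotomy (mink e f) (-1) with hm | hm | hm
  · refine le_trans ?_ (le_max_right _ _)
    -- The component of f' orthogonal to e' represents the end of the common perpendicular on the
    -- first facet. It is f' plus a positive multiple of e', so its products with the remaining
    -- normals are nonpositive.
    have key : ∀ e' ∈ S, ∀ f' ∈ S, e' ≠ f' → mink e' f' = mink e f →
        ∃ hz : IsFuture (f' - mink e f • e'), toHyp _ hz ∈ faceOf P e' := by
      intro e' he' f' hf' hef' hm'
      have h1 := hO e' he'
      have h2 := hO f' hf'
      have hz : IsFuture (f' - mink e f • e') := by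
        refine isFuture_of_mink_neg ?_ O.isFuture ?_
        · simp only [mink_sub_left, mink_sub_right, mink_smul_left, mink_smul_right,
            h.unit e' he', h.unit f' hf', mink_comm f' e', hm']
          nlinarith
        · rw [mink_comm _ (O : Mink)]
          simp only [mink_sub_right, mink_smul_right]
          nlinarith
      refine ⟨hz, ?_, ?_⟩
      · rw [h.toHyp_mem_iff]
        intro g hg
        simp only [mink_sub_left, mink_smul_left]
        by_cases hge : g = e'
        · rw [hge, h.unit e' he', mink_comm, hm']; linarith
        by_cases hgf : g = f'
        · rw [hgf, h.unit f' hf', hm']; nlinarith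
        · nlinarith [h.mink_nonpos hC.1 he' hg (Ne.symm hge),
            h.mink_nonpos hC.1 hf' hg (Ne.symm hgf)]
      · change mink _ _ = 0
        rw [mink_toHyp_eq_zero_iff, mink_sub_left, mink_smul_left, h.unit e' he', mink_comm, hm']
        ring
    obtain ⟨hz, hzE⟩ := key e he f hf hef rfl
    obtain ⟨hw, hwF⟩ := key f hf e he (Ne.symm hef) (mink_comm f e)
    refine (cosh_setDist_le hzE hwF).trans ?_
    obtain ⟨a, ha, ha1, ha2⟩ := exists_toHyp_eq hz
    obtain ⟨b, hb, hb1, hb2⟩ := exists_toHyp_eq hw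
    rw [ha1, hb1]
    simp only [mink_sub_left, mink_sub_right, mink_smul_left, mink_smul_right, he1, hf1,
      mink_comm f e] at *
    set m := mink e f
    have hab : a = b := by
      have h1 : a ^ 2 * (m ^ 2 - 1) = b ^ 2 * (m ^ 2 - 1) := by linarith
      have h2 := mul_right_cancel₀ (show m ^ 2 - 1 ≠ 0 by nlinarith) h1
      exact (pow_left_inj₀ ha.le hb.le two_ne_zero).mp h2
    subst hab
    refine le_of_eq ?_
    linear_combination (-m) * ha2
  -- Now e + f is lightlike, a common ideal point of the two planes, with nonpositive products with
  -- all of S. The direction at O pointing to it contradicts `exists_mink_add_pos`.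
  · exfalso
    set a := -mink O e - mink O f with ha
    have ha0 : 0 < a := by linarith [hO e he, hO f hf]
    obtain ⟨g, hg, hpos⟩ := h.exists_mink_add_pos hC.2 hOP (y := a⁻¹ • (e + f) - (O : Mink))
      (by
        simp only [mink_sub_right, mink_smul_right, mink_add_right, O.2.1]
        rw [show mink O e + mink O f = -a by rw [ha]; ring]
        field_simp; ring)
      (by
        simp only [mink_sub_right, mink_sub_left, mink_smul_left, mink_add_left, mink_smul_right,
          mink_add_right, O.2.1, he1, hf1, mink_comm f e, hm, mink_comm e O, mink_comm f O]
        rw [show mink O e + mink O f = -a by rw [ha]; ring]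
        field_simp; ring)
    simp only [mink_sub_left, mink_smul_left, mink_add_left] at hpos
    have h1 : mink e g + mink f g ≤ 0 := by
      by_cases hge : g = e
      · rw [hge, he1, mink_comm f e, hm]; norm_num
      by_cases hgf : g = f
      · rw [hgf, hf1, hm]; norm_num
      · linarith [h.mink_nonpos hC.1 he hg (Ne.symm hge), h.mink_nonpos hC.1 hf hg (Ne.symm hgf)]
    have := mul_nonpos_of_nonneg_of_nonpos (inv_pos.mpr ha0).le h1
    linarith
  · have hmem := h.foot_mem hC.1 he hf hef (h.mink_sq_lt_one hC.1 he hf hef hm) hO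
    exact hself _ hmem.1 hmem.2

end IsIrredundant

/-! ### The bound `t` in terms of cosines -/

lemma gramDet_eq (a b c : ℝ) : gramDet a b c = 1 - Real.cos a ^ 2 - Real.cos b ^ 2 -
    Real.cos c ^ 2 - 2 * Real.cos a * Real.cos b * Real.cos c := by
  rw [gramDet, Matrix.det_fin_three]
  simp
  ring

lemma gramDet_swap (a b c : ℝ) : gramDet a b c = gramDet a c b := by
  rw [gramDet_eq, gramDet_eq]; ring

/-- `√G sinh x`, where `x` bounds the distance from a vertex to the foot point on the edge. -/
noncomputable def vertexSinh (a b c : ℝ) : ℝ :=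
  Real.cos (a / 2) * (Real.sin a * Real.sin b + Real.cos a * Real.cos b + Real.cos c)

/-- `√G cosh x`, where `x` bounds the distance from a vertex to the foot point on the edge. -/
noncomputable def vertexCosh (a b c : ℝ) : ℝ := √(gramDet a b c + vertexSinh a b c ^ 2)

/-- `√(G₃₃ G₄₄) cosh (x + y)` for the bounds `x`, `y` at the two ends of an edge. -/
noncomputable def edgeCosh (a b c d e : ℝ) : ℝ :=
  vertexCosh a b c * vertexCosh a d e + vertexSinh a b c * vertexSinh a d e

lemma tan_half_arccos {q : ℝ} (h1 : -1 < q) (h2 : q ≤ 1) :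
    Real.tan (Real.arccos q / 2) = √(1 - q ^ 2) / (1 + q) := by
  have hcos := Real.cos_arccos h1.le h2
  have hsin := Real.sin_arccos q
  set y := Real.arccos q / 2 with hy
  have hxy : Real.arccos q = 2 * y := by rw [hy]; ring
  rw [hxy] at hcos hsin
  rw [Real.cos_two_mul] at hcos
  rw [Real.sin_two_mul] at hsin
  have h0 : Real.cos y ≠ 0 := by
    intro h; rw [h] at hcos; norm_num at hcos; linarith
  rw [Real.tan_eq_sin_div_cos, ← hsin, show 1 + q = 2 * Real.cos y ^ 2 by linarith]
  field_simp

/-- With q the cosine of the plane angle, the cotangent of its half is (1 + q)/√(1 - q²), and 1 - q²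
= G/(sin a sin b)². Multiplication by √G therefore clears the root. -/
lemma div_tan_mul_sqrt {a b c : ℝ} (ha : 0 < Real.sin a) (hb : 0 < Real.sin b)
    (hG : 0 < gramDet a b c) :
    Real.cos (a / 2) / Real.tan (planeAngle c a b / 2) * √(gramDet a b c) = vertexSinh a b c := by
  have hs : 0 < Real.sin a * Real.sin b := mul_pos ha hb
  have hGq : gramDet a b c = (Real.sin a * Real.sin b) ^ 2 -
      (Real.cos c + Real.cos a * Real.cos b) ^ 2 := by
    rw [gramDet_eq, mul_pow, Real.sin_sq, Real.sin_sq]; ring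
  set q := (Real.cos c + Real.cos a * Real.cos b) / (Real.sin a * Real.sin b) with hq
  have hG2 : 1 - q ^ 2 = gramDet a b c / (Real.sin a * Real.sin b) ^ 2 := by
    rw [hGq, hq]; field_simp
  have hq1 : q ^ 2 < 1 := by
    have : 0 < gramDet a b c / (Real.sin a * Real.sin b) ^ 2 := by positivity
    linarith
  obtain ⟨hq2, hq3⟩ := abs_lt.mp ((sq_lt_one_iff_abs_lt_one q).mp hq1)
  have hqn : (Real.sin a * Real.sin b) * (1 + q) =
      Real.sin a * Real.sin b + Real.cos a * Real.cos b + Real.cos c := by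
    rw [hq]; field_simp; ring
  have hr : 0 < √(gramDet a b c) := Real.sqrt_pos.mpr hG
  have h1q : 0 < 1 + q := by linarith
  rw [planeAngle, ← hq, tan_half_arccos hq2 hq3.le, hG2, Real.sqrt_div hG.le,
    Real.sqrt_sq hs.le, vertexSinh, ← hqn]
  field_simp

lemma cosh_arsinh_add_arsinh (x y : ℝ) : Real.cosh (Real.arsinh x + Real.arsinh y) =
    √(1 + x ^ 2) * √(1 + y ^ 2) + x * y := by
  rw [Real.cosh_add, Real.cosh_arsinh, Real.cosh_arsinh, Real.sinh_arsinh, Real.sinh_arsinh]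

lemma cosh_lengthBound_mul_sqrt {a b c d e : ℝ} (ha : 0 < Real.sin a) (hb : 0 < Real.sin b)
    (hd : 0 < Real.sin d) (hG : 0 < gramDet a b c) (hG' : 0 < gramDet a d e) :
    Real.cosh (Real.arsinh (Real.cos (a / 2) / Real.tan (planeAngle c a b / 2)) +
      Real.arsinh (Real.cos (a / 2) / Real.tan (planeAngle e a d / 2))) *
        √(gramDet a d e * gramDet a b c) = edgeCosh a b c d e := by
  have h1 := div_tan_mul_sqrt ha hb hG
  have h2 := div_tan_mul_sqrt ha hd hG'
  rw [cosh_arsinh_add_arsinh, edgeCosh, vertexCosh, vertexCosh, ← h1, ← h2, Real.sqrt_mul hG'.le]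
  set x := Real.cos (a / 2) / Real.tan (planeAngle c a b / 2)
  set y := Real.cos (a / 2) / Real.tan (planeAngle e a d / 2)
  have h3 : ∀ z G : ℝ, 0 < G → √(G + (z * √G) ^ 2) = √G * √(1 + z ^ 2) := by
    intro z G hG
    rw [← Real.sqrt_mul hG.le, mul_pow, Real.sq_sqrt hG.le]
    congr 1; ring
  rw [h3 _ _ hG, h3 _ _ hG']
  ring

/-- The angles `π / n` with `n ≥ 2`. -/
def IsSubmultiple (a : ℝ) : Prop := ∃ n : ℕ, 2 ≤ n ∧ a = Real.pi / n

namespace RidgeType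

/-- The angles at the two ends of an edge are those of spherical triangles, and submultiples
of `π`. -/
structure IsSpherical (α : RidgeType) : Prop where
  a12 : IsSubmultiple α.a12
  a13 : IsSubmultiple α.a13
  a14 : IsSubmultiple α.a14
  a23 : IsSubmultiple α.a23
  a24 : IsSubmultiple α.a24
  cofactor33 : 0 < α.cofactor33
  cofactor44 : 0 < α.cofactor44

end RidgeType

lemma IsSubmultiple.sin_pos {a : ℝ} (h : IsSubmultiple a) : 0 < Real.sin a := by
  obtain ⟨n, hn, rfl⟩ := h
  have h2 : (2 : ℝ) ≤ n := by exact_mod_cast hn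
  apply Real.sin_pos_of_pos_of_lt_pi
  · have := Real.pi_pos; positivity
  · rw [div_lt_iff₀ (by linarith)]; nlinarith [Real.pi_pos]

lemma IsSubmultiple.cos_nonneg {a : ℝ} (h : IsSubmultiple a) :
    0 ≤ Real.cos a := by
  obtain ⟨n, hn, rfl⟩ := h
  have h2 : (2 : ℝ) ≤ n := by exact_mod_cast hn
  apply Real.cos_nonneg_of_neg_pi_div_two_le_of_le
  · have : 0 ≤ Real.pi / n := by positivity
    linarith [Real.pi_pos]
  · gcongr

lemma IsSubmultiple.cos_half_pos {a : ℝ} (h : IsSubmultiple a) :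
    0 < Real.cos (a / 2) := by
  obtain ⟨n, hn, rfl⟩ := h
  have h2 : (2 : ℝ) ≤ n := by exact_mod_cast hn
  apply Real.cos_pos_of_mem_Ioo
  constructor
  · have : 0 ≤ Real.pi / n / 2 := by positivity
    linarith [Real.pi_pos]
  · have : Real.pi / n ≤ Real.pi / 2 := by gcongr
    linarith [Real.pi_pos]

lemma cos_half_sq (a : ℝ) : Real.cos (a / 2) ^ 2 = (1 + Real.cos a) / 2 := by
  rw [Real.cos_sq, show 2 * (a / 2) = a by ring]; ring

namespace RidgeType.IsSpherical

variable {α : RidgeType}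

/-- The half plane angles lie in [0, π/2], so both length bounds are nonnegative, and `cosh`,
monotone there, commutes with the maximum. -/
lemma t_eq (h : α.IsSpherical) : α.t = (max (edgeCosh α.a12 α.a13 α.a23 α.a14 α.a24)
    (edgeCosh α.a12 α.a23 α.a13 α.a24 α.a14) - α.gTerm) / Real.sin α.a12 ^ 2 := by
  have h12 := h.a12.sin_pos
  have h13 := h.a13.sin_pos
  have h14 := h.a14.sin_pos
  have h23 := h.a23.sin_pos
  have h24 := h.a24.sin_pos
  have hG := h.cofactor44
  have hG' := h.cofactor33
  rw [RidgeType.cofactor44] at hG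
  rw [RidgeType.cofactor33] at hG'
  have e1 := cosh_lengthBound_mul_sqrt h12 h13 h14 hG hG'
  rw [gramDet_swap] at hG hG'
  have e2 := cosh_lengthBound_mul_sqrt h12 h23 h24 hG hG'
  have key : Real.cosh α.maxLengthBound * √(α.cofactor33 * α.cofactor44) =
      max (edgeCosh α.a12 α.a13 α.a23 α.a14 α.a24)
        (edgeCosh α.a12 α.a23 α.a13 α.a24 α.a14) := by
    rw [← e1, ← e2, gramDet_swap α.a12 α.a24, gramDet_swap α.a12 α.a23,
      ← max_mul_of_nonneg _ _ (Real.sqrt_nonneg _), RidgeType.maxLengthBound,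
      RidgeType.cofactor33, RidgeType.cofactor44]
    congr 1
    have hk := h.a12.cos_half_pos
    have hpos : ∀ q : ℝ, 0 ≤ Real.arsinh (Real.cos (α.a12 / 2) / Real.tan (Real.arccos q / 2)) := by
      intro q
      rw [Real.arsinh_nonneg_iff]
      refine div_nonneg hk.le (Real.tan_nonneg_of_nonneg_of_le_pi_div_two ?_ ?_)
      · linarith [Real.arccos_nonneg q]
      · linarith [Real.arccos_le_pi q]
    have hmono : MonotoneOn Real.cosh (Set.Ici 0) := Real.cosh_strictMonoOn.monotoneOn
    exact hmono.map_max (add_nonneg (hpos _) (hpos _)) (add_nonneg (hpos _) (hpos _))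
  rw [RidgeType.t, key]

end RidgeType.IsSpherical

/-! ### The key inequality -/

/-- Put c = cos α, b₁ = r sin θ and b₂ = r sin(α - θ), where θ is the angle between AO and F₁. The
left side is (r sin α cos θ)² and the quadratic form on the right is (r sin α)², so the claim is cos
θ ≤ cos(α/2). It holds because b₂ ≤ b₁ puts O in the half of the angle next to F₂. -/
lemma edge_quotient_sq_le {c b₁ b₂ : ℝ} (hc : 0 ≤ c) (hc1 : c ≤ 1) (h2 : 0 ≤ b₂) (h : b₂ ≤ b₁) :
    (b₂ + c * b₁) ^ 2 ≤ (1 + c) / 2 * (b₁ ^ 2 + b₂ ^ 2 + 2 * c * (b₁ * b₂)) := by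
  have : 0 ≤ (1 - c) * ((b₁ - b₂) * ((1 + 2 * c) * b₁ + b₂)) :=
    mul_nonneg (by linarith) (mul_nonneg (by linarith)
      (add_nonneg (mul_nonneg (by linarith) (by linarith)) h2))
  nlinarith

lemma sqrt_cauchy_le {s R τ S G : ℝ} (hs : 0 < s) (hR : 0 < R) (hτ : 0 < τ) (h : τ < √R * S) :
    √(s * G * (s * R) + (-(s * τ)) ^ 2) ≤ s * (√R * √(G + S ^ 2)) := by
  have h1 : τ ^ 2 ≤ R * S ^ 2 := by
    have := pow_le_pow_left₀ hτ.le h.le 2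
    rwa [mul_pow, Real.sq_sqrt hR.le] at this
  have h2 : s * (√R * √(G + S ^ 2)) = √(s ^ 2 * (R * (G + S ^ 2))) := by
    rw [Real.sqrt_mul (sq_nonneg s), Real.sqrt_sq hs.le, Real.sqrt_mul hR.le]
  rw [h2]
  apply Real.sqrt_le_sqrt
  have := mul_le_mul_of_nonneg_left h1 (sq_nonneg s)
  linarith

/-- Here s = sin² α₁₂, sR = -(A, A), and τ/√R is √G times sinh of the distance from A to a vertex.
The hypotheses bound both values of sinh, and cosh of the sum of the two distances increases with
them. -/
lemma lt_of_cauchy {s R τ τ' S S' G G' m g : ℝ} (hs : 0 < s) (hR : 0 < R) (hτ : 0 < τ)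
    (hτ' : 0 < τ') (h : τ < √R * S) (h' : τ' < √R * S')
    (cauchy : -(s * (s * m - g)) * (s * R) ≤ -(s * τ) * -(s * τ') +
      √(s * G * (s * R) + (-(s * τ)) ^ 2) * √(s * G' * (s * R) + (-(s * τ')) ^ 2)) :
    s * -m + g < √(G + S ^ 2) * √(G' + S' ^ 2) + S * S' := by
  have r := sqrt_cauchy_le (G := G) hs hR hτ h
  have r' := sqrt_cauchy_le (G := G') hs hR hτ' h'
  have p := mul_le_mul r r' (Real.sqrt_nonneg _) ((Real.sqrt_nonneg _).trans r)
  have p' := mul_lt_mul_of_pos_left (mul_lt_mul'' h h' hτ.le hτ'.le) (mul_pos hs hs)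
  have hRR : √R * √R = R := Real.mul_self_sqrt hR.le
  generalize √(G + S ^ 2) = C at *
  generalize √(G' + S' ^ 2) = C' at *
  rw [show s * (√R * C) * (s * (√R * C')) = s * s * R * (C * C') by
    linear_combination s * s * C * C' * hRR] at p
  rw [show s * s * (√R * S * (√R * S')) = s * s * R * (S * S') by
    linear_combination s * s * S * S' * hRR] at p'
  have final : s * s * R * (s * -m + g) < s * s * R * (C * C' + S * S') := by linarith
  exact lt_of_mul_lt_mul_left final (by positivity)

/-- An upper bound for `-(u₃, u₄)`, when the interior point `O` is farther from the edge `F₁ ∩ F₂`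
than from the edges `F₁ ∩ F₃` and `F₁ ∩ F₄`. -/
lemma neg_mink_mul_add_lt {O : Hyp3} {u₁ u₂ u₃ u₄ : Mink} {a12 a13 a14 a23 a24 : ℝ}
    (h1 : mink u₁ u₁ = 1) (h2 : mink u₂ u₂ = 1) (h3 : mink u₃ u₃ = 1) (h4 : mink u₄ u₄ = 1)
    (h12 : -mink u₁ u₂ = Real.cos a12) (h13 : -mink u₁ u₃ = Real.cos a13)
    (h14 : -mink u₁ u₄ = Real.cos a14) (h23 : -mink u₂ u₃ = Real.cos a23)
    (h24 : -mink u₂ u₄ = Real.cos a24)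
    (p12 : 0 ≤ Real.cos a12) (p13 : 0 ≤ Real.cos a13) (p14 : 0 ≤ Real.cos a14)
    (p23 : 0 ≤ Real.cos a23) (p24 : 0 ≤ Real.cos a24)
    (s12 : 0 < Real.sin a12) (s13 : 0 < Real.sin a13) (s14 : 0 < Real.sin a14)
    (hk : 0 < Real.cos (a12 / 2))
    (b1 : mink O u₁ < 0) (b2 : mink O u₂ < 0) (b3 : mink O u₃ < 0) (b4 : mink O u₄ < 0)
    (hb : -mink O u₂ ≤ -mink O u₁)
    (out13 : (-mink O u₃ + Real.cos a13 * -mink O u₁) * Real.sin a12 ≤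
      Real.sin a13 * (-mink O u₂ + Real.cos a12 * -mink O u₁))
    (out14 : (-mink O u₄ + Real.cos a14 * -mink O u₁) * Real.sin a12 ≤
      Real.sin a14 * (-mink O u₂ + Real.cos a12 * -mink O u₁)) :
    Real.sin a12 ^ 2 * -mink u₃ u₄ + (Real.cos a12 * Real.cos a13 * Real.cos a24 +
      Real.cos a12 * Real.cos a14 * Real.cos a23 +
      Real.cos a13 * Real.cos a14 + Real.cos a23 * Real.cos a24) <
      edgeCosh a12 a13 a23 a14 a24 := by
  have hk2 := cos_half_sq a12
  have hsc := Real.sin_sq_add_cos_sq a12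
  have hc1 := Real.cos_le_one a12
  have vS : ∀ b c, vertexSinh a12 b c = Real.cos (a12 / 2) * (Real.sin a12 * Real.sin b +
    Real.cos a12 * Real.cos b + Real.cos c) := fun _ _ => rfl
  have vC : ∀ b c, vertexCosh a12 b c = √(gramDet a12 b c + vertexSinh a12 b c ^ 2) :=
    fun _ _ => rfl
  have gD := gramDet_eq a12
  rw [edgeCosh]
  generalize Real.cos (a12 / 2) = k at *
  have e23 : mink u₂ u₃ = -Real.cos a23 := by linarith
  have e24 : mink u₂ u₄ = -Real.cos a24 := by linarith
  have e12 : mink u₁ u₂ = -Real.cos a12 := by linarith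
  have e13 : mink u₁ u₃ = -Real.cos a13 := by linarith
  have e14 : mink u₁ u₄ = -Real.cos a14 := by linarith
  have hss : Real.sin a12 ^ 2 = 1 - Real.cos a12 ^ 2 := by linarith
  have hm : mink u₁ u₂ ^ 2 < 1 := by rw [e12]; nlinarith
  set A := foot O u₁ u₂ with hA
  have hA1 : mink u₁ A = 0 := by rw [mink_comm, hA, mink_foot_left h1]
  have hA2 : mink u₂ A = 0 := by rw [mink_comm, hA, mink_foot_right h2]
  have hAA := mink_foot_self (O := O) h1 h2
  have hAlt := (isFuture_foot (O := O) h1 h2 hm).1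
  rw [← hA] at hAA hAlt
  obtain ⟨β₁, hβ1⟩ : ∃ β, β = -mink O u₁ := ⟨_, rfl⟩
  obtain ⟨β₂, hβ2⟩ : ∃ β, β = -mink O u₂ := ⟨_, rfl⟩
  -- -(u, A) is linear in -(O, u), β₁ and β₂. The outermost inequality eliminates -(O, u), after
  -- which β₂ + cos α₁₂ · β₁ factors out.
  have bound : ∀ (u : Mink) (x y b : ℝ), mink u₁ u = -x → mink u₂ u = -Real.cos y → 0 ≤ x →
      0 ≤ Real.cos y → mink O u < 0 → 0 < Real.sin b →
      (-mink O u + x * -mink O u₁) * Real.sin a12 ≤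
        Real.sin b * (-mink O u₂ + Real.cos a12 * -mink O u₁) →
      0 < -mink u A ∧ -mink u A ≤ (β₂ + Real.cos a12 * β₁) *
        (Real.sin a12 * Real.sin b + Real.cos a12 * x + Real.cos y) := by
    intro u x y b hx hy hx0 hy0 hu hsb hout
    rw [← hβ1, ← hβ2] at hout
    have hβ1' : 0 < β₁ := by linarith
    have hβ2' : 0 < β₂ := by linarith
    rw [mink_comm u A, hA, mink_foot, e12, hx, hy, show mink O u₁ = -β₁ by linarith,
      show mink O u₂ = -β₂ by linarith, ← sub_eq_zero.mp (show Real.sin a12 ^ 2 -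
        (1 - (-Real.cos a12) ^ 2) = 0 by rw [hss]; ring)]
    constructor
    · have t1 : 0 < Real.sin a12 ^ 2 * -mink O u := mul_pos (by positivity) (by linarith)
      have t2 : 0 ≤ (β₁ + Real.cos a12 * β₂) * x := by positivity
      have t3 : 0 ≤ (β₂ + Real.cos a12 * β₁) * Real.cos y := by positivity
      linarith
    · have t1 := mul_le_mul_of_nonneg_right hout s12.le
      have t2 : x * (Real.cos a12 * β₂ + Real.cos a12 ^ 2 * β₁) = x * (Real.cos a12 * β₂ + β₁ - Real.sin a12 ^ 2 * β₁) := by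
        rw [hss]; ring
      linarith
  obtain ⟨τ3pos, τ3le⟩ := bound u₃ (Real.cos a13) a23 a13 e13 e23 p13 p23 b3 s13 out13
  obtain ⟨τ4pos, τ4le⟩ := bound u₄ (Real.cos a14) a24 a14 e14 e24 p14 p24 b4 s14 out14
  have hβ1' : 0 < β₁ := by linarith
  have hβ2' : 0 < β₂ := by linarith
  obtain ⟨R, hR⟩ : ∃ R, R = Real.sin a12 ^ 2 + (β₁ ^ 2 + β₂ ^ 2 + 2 * Real.cos a12 * (β₁ * β₂)) := ⟨_, rfl⟩
  have hR0 : 0 < R := by rw [hR]; positivity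
  have hAR : -mink A A = Real.sin a12 ^ 2 * R := by
    rw [hAA, e12, show mink O u₁ = -β₁ by linarith, show mink O u₂ = -β₂ by linarith, hR, hss]
    ring
  -- Strictness comes from the summand sin² α₁₂ of R, the algebraic form of tanh AO < 1.
  have hquot : (β₂ + Real.cos a12 * β₁) ^ 2 < k ^ 2 * R := by
    have := edge_quotient_sq_le p12 hc1 hβ2'.le (show β₂ ≤ β₁ by linarith)
    rw [← hk2] at this
    have t1 : 0 < k ^ 2 * Real.sin a12 ^ 2 := by positivity
    rw [hR]
    linarith
  have fin : ∀ τ X : ℝ, 0 < τ → τ ≤ (β₂ + Real.cos a12 * β₁) * X → τ < √R * (k * X) := by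
    intro τ X hτ hle
    have hq : 0 < β₂ + Real.cos a12 * β₁ := by positivity
    have hX : 0 < X := pos_of_mul_pos_right (hτ.trans_le hle) hq.le
    refine hle.trans_lt ?_
    have : β₂ + Real.cos a12 * β₁ < √R * k := by
      refine lt_of_pow_lt_pow_left₀ 2 (by positivity) ?_
      rw [mul_pow, Real.sq_sqrt hR0.le]; linarith
    calc _ < √R * k * X := mul_lt_mul_of_pos_right this hX
      _ = _ := by ring
  have f3 := fin _ _ τ3pos τ3le
  have f4 := fin _ _ τ4pos τ4le
  rw [← vS] at f3 f4
  -- the projections of `u₃` and `u₄` to the orthogonal complement of `u₁` and `u₂`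
  let W (u : Mink) (x y : ℝ) : Mink := Real.sin a12 ^ 2 • u + (x + Real.cos a12 * y) • u₁ +
    (y + Real.cos a12 * x) • u₂
  have hWA : ∀ u x y, mink (W u x y) A = -(Real.sin a12 ^ 2 * -mink u A) := fun u x y => by
    simp only [W, mink_add_left, mink_smul_left, hA1, hA2]; ring
  have hWW : ∀ u u' x y x' y', mink u₁ u = -x → mink u₂ u = -y → mink u₁ u' = -x' →
      mink u₂ u' = -y' → mink (W u x y) (W u' x' y') = Real.sin a12 ^ 2 *
        (Real.sin a12 ^ 2 * mink u u' - (Real.cos a12 * x * y' + Real.cos a12 * x' * y +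
          x * x' + y * y')) := by
    intro u u' x y x' y' hx hy hx' hy'
    simp only [W, mink_add_left, mink_add_right, mink_smul_left, mink_smul_right, h1, h2, hx', hy',
      mink_comm u u₁, mink_comm u u₂, hx, hy, mink_comm u₂ u₁, e12]
    rw [hss]; ring
  have cauchy := neg_mink_mul_le (y := W u₃ (Real.cos a13) (Real.cos a23))
    (z := W u₄ (Real.cos a14) (Real.cos a24)) hAlt
  rw [hWW _ _ _ _ _ _ e13 e23 e13 e23, hWW _ _ _ _ _ _ e14 e24 e14 e24,
    hWW _ _ _ _ _ _ e13 e23 e14 e24, hWA, hWA, hAR, h3, h4] at cauchy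
  have g3 : Real.sin a12 ^ 2 * 1 - (Real.cos a12 * Real.cos a13 * Real.cos a23 +
      Real.cos a12 * Real.cos a13 * Real.cos a23 + Real.cos a13 * Real.cos a13 +
      Real.cos a23 * Real.cos a23) = gramDet a12 a13 a23 := by rw [gD, hss]; ring
  have g4 : Real.sin a12 ^ 2 * 1 - (Real.cos a12 * Real.cos a14 * Real.cos a24 +
      Real.cos a12 * Real.cos a14 * Real.cos a24 + Real.cos a14 * Real.cos a14 +
      Real.cos a24 * Real.cos a24) = gramDet a12 a14 a24 := by rw [gD, hss]; ring
  rw [g3, g4] at cauchy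
  rw [vC, vC]
  exact lt_of_cauchy (by positivity) hR0 τ3pos τ4pos f3 f4 cauchy

/-! ### Submultiples of `π` -/

namespace IsSubmultiple

variable {a : ℝ}

/-- The angles π/n with n ≥ 6 need no separation: beside such an edge angle all other angles at the
vertex are right. -/
lemma cos_cases (h : IsSubmultiple a) : Real.cos a = 0 ∨ Real.cos a = 1 / 2 ∨
    Real.cos a = √2 / 2 ∨ Real.cos a = (1 + √5) / 4 ∨ √3 / 2 ≤ Real.cos a := by
  obtain ⟨n, hn, rfl⟩ := h
  rcases le_or_gt 6 n with h6 | h6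
  · right; right; right; right
    rw [← Real.cos_pi_div_six]
    have : (6 : ℝ) ≤ n := by exact_mod_cast h6
    apply Real.cos_le_cos_of_nonneg_of_le_pi
    · positivity
    · linarith [Real.pi_pos]
    · gcongr
  · interval_cases n
    · left; exact_mod_cast Real.cos_pi_div_two
    · right; left; exact_mod_cast Real.cos_pi_div_three
    · right; right; left; exact_mod_cast Real.cos_pi_div_four
    · right; right; right; left; exact_mod_cast Real.cos_pi_div_five

end IsSubmultiple

lemma sqrt_two_bounds : 1.41421 < √2 ∧ √2 < 1.41422 :=
  ⟨Real.lt_sqrt_of_sq_lt (by norm_num), (Real.sqrt_lt' (by norm_num)).mpr (by norm_num)⟩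

lemma sqrt_three_bounds : 1.73205 < √3 ∧ √3 < 1.73206 :=
  ⟨Real.lt_sqrt_of_sq_lt (by norm_num), (Real.sqrt_lt' (by norm_num)).mpr (by norm_num)⟩

lemma sqrt_five_bounds : 2.23606 < √5 ∧ √5 < 2.23607 :=
  ⟨Real.lt_sqrt_of_sq_lt (by norm_num), (Real.sqrt_lt' (by norm_num)).mpr (by norm_num)⟩

lemma sin_bounds {a l u : ℝ} (h : 0 < Real.sin a) (hl : l ^ 2 < 1 - Real.cos a ^ 2)
    (hu : 1 - Real.cos a ^ 2 < u ^ 2) (hu0 : 0 ≤ u) : l < Real.sin a ∧ Real.sin a < u := by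
  have := Real.sin_sq a
  exact ⟨lt_of_pow_lt_pow_left₀ 2 h.le (by linarith), lt_of_pow_lt_pow_left₀ 2 hu0 (by linarith)⟩

namespace IsSubmultiple

lemma half_le_cos {a : ℝ} (h : IsSubmultiple a) (h0 : Real.cos a ≠ 0) : 1 / 2 ≤ Real.cos a := by
  have := sqrt_two_bounds; have := sqrt_three_bounds; have := sqrt_five_bounds
  rcases h.cos_cases with h | h | h | h | h
  · exact absurd h h0
  all_goals linarith

lemma cos_eq_half {a : ℝ} (h : IsSubmultiple a) (h0 : Real.cos a ≠ 0)
    (h1 : Real.cos a < 0.7) : Real.cos a = 1 / 2 := by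
  have := sqrt_two_bounds; have := sqrt_three_bounds; have := sqrt_five_bounds
  rcases h.cos_cases with h | h | h | h | h
  · exact absurd h h0
  · exact h
  all_goals linarith

/-- A spherical triangle with angles `π / p`, `π / q`, `π / r` has a right angle. -/
lemma cos_eq_zero_or {a b c : ℝ} (ha : IsSubmultiple a) (hb : IsSubmultiple b)
    (hc : IsSubmultiple c) (hG : 0 < gramDet a b c) (ha0 : Real.cos a ≠ 0) :
    Real.cos b = 0 ∨ Real.cos c = 0 := by
  by_contra! h
  have h1 := ha.half_le_cos ha0
  have h2 := hb.half_le_cos h.1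
  have h3 := hc.half_le_cos h.2
  rw [gramDet_eq] at hG
  have h4 : (1 / 2 : ℝ) * (1 / 2) ≤ Real.cos a * Real.cos b := by gcongr
  have h5 : (1 / 2 : ℝ) * (1 / 2) * (1 / 2) ≤ Real.cos a * Real.cos b * Real.cos c := by gcongr
  nlinarith

end IsSubmultiple

/-! ### Bounds for `edgeCosh` -/

/-- The expression `G cosh 2x`, where `x` bounds the distance from a vertex to the foot point on
the edge. -/
noncomputable def vertexNorm (a b c : ℝ) : ℝ := gramDet a b c + 2 * vertexSinh a b c ^ 2

lemma vertexSinh_sq (a b c : ℝ) : vertexSinh a b c ^ 2 = (1 + Real.cos a) / 2 *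
    (Real.sin a * Real.sin b + Real.cos a * Real.cos b + Real.cos c) ^ 2 := by
  rw [vertexSinh, mul_pow, cos_half_sq]

lemma vertexNorm_eq (a b c : ℝ) : vertexNorm a b c = gramDet a b c + (1 + Real.cos a) *
    (Real.sin a * Real.sin b + Real.cos a * Real.cos b + Real.cos c) ^ 2 := by
  rw [vertexNorm, vertexSinh_sq]; ring

lemma vertexCosh_sq {a b c : ℝ} (hG : 0 < gramDet a b c) :
    vertexCosh a b c ^ 2 = gramDet a b c + vertexSinh a b c ^ 2 :=
  Real.sq_sqrt (by positivity)

/-- AM–GM on both products. It separates the two ends of the edge, with equality when they agree. -/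
lemma edgeCosh_le {a b c d e : ℝ} (hG : 0 < gramDet a b c) (hG' : 0 < gramDet a d e) :
    edgeCosh a b c d e ≤ (vertexNorm a b c + vertexNorm a d e) / 2 := by
  have h1 := vertexCosh_sq hG
  have h2 := vertexCosh_sq hG'
  rw [edgeCosh, vertexNorm, vertexNorm]
  nlinarith [sq_nonneg (vertexCosh a b c - vertexCosh a d e),
    sq_nonneg (vertexSinh a b c - vertexSinh a d e)]

lemma edgeCosh_self {a b c : ℝ} (hG : 0 < gramDet a b c) :
    edgeCosh a b c b c = vertexNorm a b c := by
  rw [edgeCosh, ← sq, ← sq, vertexCosh_sq hG, vertexNorm]; ring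

/-- This is cosh(x + y) ≥ 1 + 2 sinh x sinh y, scaled by √(GG'), and it removes the nested roots. -/
lemma le_edgeCosh {a b c d e : ℝ} (hG : 0 < gramDet a b c) (hG' : 0 < gramDet a d e) :
    √(gramDet a b c) * √(gramDet a d e) + (1 + Real.cos a) *
      ((Real.sin a * Real.sin b + Real.cos a * Real.cos b + Real.cos c) *
        (Real.sin a * Real.sin d + Real.cos a * Real.cos d + Real.cos e)) ≤
      edgeCosh a b c d e := by
  have h1 := vertexCosh_sq hG
  have h2 := vertexCosh_sq hG'
  have h3 : √(gramDet a b c) * √(gramDet a d e) + vertexSinh a b c * vertexSinh a d e ≤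
      vertexCosh a b c * vertexCosh a d e := by
    have h0 : 0 ≤ vertexCosh a b c * vertexCosh a d e :=
      mul_nonneg (Real.sqrt_nonneg _) (Real.sqrt_nonneg _)
    refine abs_le_of_sq_le_sq' ?_ h0 |>.2
    rw [mul_pow, h1, h2]
    have h4 := Real.sq_sqrt hG.le
    have h5 := Real.sq_sqrt hG'.le
    rw [← h4, ← h5, Real.sqrt_sq (Real.sqrt_nonneg _), Real.sqrt_sq (Real.sqrt_nonneg _)]
    nlinarith [sq_nonneg (√(gramDet a b c) * vertexSinh a d e -
      √(gramDet a d e) * vertexSinh a b c)]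
  have h4 : vertexSinh a b c * vertexSinh a d e = (1 + Real.cos a) / 2 *
      ((Real.sin a * Real.sin b + Real.cos a * Real.cos b + Real.cos c) *
        (Real.sin a * Real.sin d + Real.cos a * Real.cos d + Real.cos e)) := by
    rw [← cos_half_sq, vertexSinh, vertexSinh]; ring
  rw [edgeCosh]
  linarith

/-- The expression `g(α)` as a function of the angles `α₁₂`, `α₁₃`, `α₂₃`, `α₁₄`, `α₂₄`. -/
noncomputable def edgeTerm (a b c d e : ℝ) : ℝ :=
  Real.cos a * Real.cos b * Real.cos e + Real.cos a * Real.cos d * Real.cos c +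
    Real.cos b * Real.cos d + Real.cos c * Real.cos e

lemma edgeTerm_nonneg {a b c d e : ℝ} (ha : IsSubmultiple a) (hb : IsSubmultiple b)
    (hc : IsSubmultiple c) (hd : IsSubmultiple d) (he : IsSubmultiple e) :
    0 ≤ edgeTerm a b c d e := by
  have := ha.cos_nonneg; have := hb.cos_nonneg; have := hc.cos_nonneg
  have := hd.cos_nonneg; have := he.cos_nonneg
  rw [edgeTerm]; positivity

lemma edgeTerm_swap (a b c d e : ℝ) : edgeTerm a b c d e = edgeTerm a c b e d := by
  rw [edgeTerm, edgeTerm]; ring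

/-- The vertex with right angle and angle with cosine `z`. -/
lemma vertexNorm_le {a b c z : ℝ} (ha : IsSubmultiple a) (hb : IsSubmultiple b)
    (hc : IsSubmultiple c) (h : Real.cos b = 0 ∨ Real.cos c = 0)
    (hbz : Real.cos b ≤ z) (hcz : Real.cos c ≤ z) :
    vertexNorm a b c ≤ Real.sin a ^ 2 - z ^ 2 + (1 + Real.cos a) * (Real.sin a + z) ^ 2 := by
  rw [vertexNorm_eq, gramDet_eq]
  have h1 := Real.sin_sq a
  have h2 := ha.sin_pos
  have h3 := ha.cos_nonneg
  -- Once one angle is right, the estimate depends on the other cosine x alone, and it is increasing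
  -- in x.
  have mono : ∀ x : ℝ, 0 ≤ x → x ≤ z → Real.sin a ^ 2 - x ^ 2 + (1 + Real.cos a) *
      (Real.sin a + x) ^ 2 ≤ Real.sin a ^ 2 - z ^ 2 + (1 + Real.cos a) * (Real.sin a + z) ^ 2 := by
    intro x hx hxz
    have : 0 ≤ (z - x) * ((1 + Real.cos a) * (2 * Real.sin a) + Real.cos a * (x + z)) := by
      apply mul_nonneg (by linarith)
      have : 0 ≤ z := hx.trans hxz
      positivity
    nlinarith
  rcases h with h | h
  · refine le_trans (le_of_eq ?_) (mono _ hc.cos_nonneg hcz)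
    have : Real.sin b = 1 := by
      have h4 := Real.sin_sq b
      rw [h] at h4
      nlinarith [hb.sin_pos]
    rw [h, this, h1]; ring
  · refine le_trans ?_ (mono _ hb.cos_nonneg hbz)
    have h4 := hb.cos_nonneg
    have h5 := Real.sin_le_one b
    have h6 := Real.cos_le_one a
    have h7 := hb.sin_pos
    have : (Real.sin a * Real.sin b + Real.cos a * Real.cos b + Real.cos c) ^ 2 ≤
        (Real.sin a + Real.cos b) ^ 2 := by
      rw [h]
      apply pow_le_pow_left₀ (by positivity)
      nlinarith
    have := mul_le_mul_of_nonneg_left this (show 0 ≤ 1 + Real.cos a by linarith)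
    rw [h] at this ⊢
    linarith

lemma cos_sq_lt_of_gramDet_pos {a b c : ℝ} (ha : IsSubmultiple a) (hb : IsSubmultiple b)
    (hc : IsSubmultiple c) (hG : 0 < gramDet a b c) :
    Real.cos b ^ 2 < 1 - Real.cos a ^ 2 ∧ Real.cos c ^ 2 < 1 - Real.cos a ^ 2 := by
  rw [gramDet_eq] at hG
  have := ha.cos_nonneg; have := hb.cos_nonneg; have := hc.cos_nonneg
  have : 0 ≤ Real.cos a * Real.cos b * Real.cos c := by positivity
  constructor <;> nlinarith [sq_nonneg (Real.cos b), sq_nonneg (Real.cos c)]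


/-! ### The maximum of the bound -/

lemma sin_eq_one_of_cos_eq_zero {a : ℝ} (ha : IsSubmultiple a) (h : Real.cos a = 0) :
    Real.sin a = 1 := by
  have := Real.sin_sq a
  rw [h] at this
  nlinarith [ha.sin_pos]

lemma isSubmultiple_pi_div (n : ℕ) (hn : 2 ≤ n) : IsSubmultiple (Real.pi / n) := ⟨n, hn, rfl⟩

lemma sin_pi_div_five_bounds : 0.58778 < Real.sin (Real.pi / 5) ∧
    Real.sin (Real.pi / 5) < 0.58779 := by
  have h5 := sqrt_five_bounds
  have hsq : √5 ^ 2 = (5 : ℝ) := Real.sq_sqrt (by norm_num)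
  apply sin_bounds (isSubmultiple_pi_div 5 (by norm_num)).sin_pos
  · rw [Nat.cast_ofNat, Real.cos_pi_div_five]; nlinarith
  · rw [Nat.cast_ofNat, Real.cos_pi_div_five]; nlinarith
  · norm_num

lemma vertexNorm_of_cos_eq_zero_half {a b c : ℝ} (hb : IsSubmultiple b) (h0 : Real.cos b = 0)
    (h1 : Real.cos c = 1 / 2) : vertexNorm a b c =
      Real.sin a ^ 2 - 1 / 4 + (1 + Real.cos a) * (Real.sin a + 1 / 2) ^ 2 := by
  rw [vertexNorm_eq, gramDet_eq, h0, h1, sin_eq_one_of_cos_eq_zero hb h0, Real.sin_sq]; ring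

/-- The value of `t` at the extremal type. -/
noncomputable def extremalValue : ℝ := (Real.sin (Real.pi / 5) ^ 2 - 1 / 4 +
  (1 + Real.cos (Real.pi / 5)) * (Real.sin (Real.pi / 5) + 1 / 2) ^ 2 - 1 / 4) /
    Real.sin (Real.pi / 5) ^ 2

lemma extremalValue_bounds : 5.74 < extremalValue ∧ extremalValue < 5.75 := by
  obtain ⟨h1, h2⟩ := sin_pi_div_five_bounds
  have h5 := sqrt_five_bounds
  have hsq : √5 ^ 2 = (5 : ℝ) := Real.sq_sqrt (by norm_num)
  have h3 := Real.sin_sq (Real.pi / 5)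
  rw [extremalValue]
  rw [Real.cos_pi_div_five] at *
  set s := Real.sin (Real.pi / 5)
  have h4 : s ^ 2 = (5 - √5) / 8 := by rw [h3]; linarith
  have h0 : 0 < s ^ 2 := by positivity
  rw [lt_div_iff₀ h0, div_lt_iff₀ h0]
  have e : (s + 1 / 2) ^ 2 = s ^ 2 + s + 1 / 4 := by ring
  rw [e, h4]
  constructor <;> nlinarith

lemma vertexNorm_le_four {a b c : ℝ} (ha : IsSubmultiple a) (hb : IsSubmultiple b)
    (hc : IsSubmultiple c) (hG : 0 < gramDet a b c) (h0 : Real.cos a = 0) :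
    vertexNorm a b c ≤ 4 := by
  rw [vertexNorm_eq, gramDet_eq, h0, sin_eq_one_of_cos_eq_zero ha h0]
  rw [gramDet_eq, h0] at hG
  have h1 := Real.sin_sq b
  have h2 : Real.cos c < Real.sin b :=
    lt_of_pow_lt_pow_left₀ 2 hb.sin_pos.le (by linarith)
  have h3 := hc.cos_nonneg
  have h4 := Real.sin_le_one b
  have h5 := hb.sin_pos
  nlinarith

/-- 4.305 is exactly 5.74 · 3/4, what `extremalValue_bounds` allows for α₁₂ = π/3. The estimate has
less than 0.001 to spare; the cosine bound 0.809018 is that of π/5, the smallest angle possible next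
to π/3. -/
lemma vertexNorm_le_of_cos_eq_half {a b c : ℝ} (ha : IsSubmultiple a) (hb : IsSubmultiple b)
    (hc : IsSubmultiple c) (hG : 0 < gramDet a b c) (h0 : Real.cos a = 1 / 2) :
    vertexNorm a b c ≤ 4.305 := by
  have h5 := sqrt_five_bounds
  have h2 := sqrt_two_bounds
  have h3 := Real.sq_sqrt (show (0 : ℝ) ≤ 3 by norm_num)
  have le : ∀ x : ℝ, IsSubmultiple x → Real.cos x ^ 2 < 1 - Real.cos a ^ 2 →
      Real.cos x ≤ 0.809018 := by
    intro x hx hlt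
    rw [h0] at hlt
    rcases hx.cos_cases with h | h | h | h | h
    · linarith
    · linarith
    · linarith
    · linarith
    · nlinarith [Real.sqrt_nonneg 3]
  obtain ⟨hb1, hc1⟩ := cos_sq_lt_of_gramDet_pos ha hb hc hG
  refine (vertexNorm_le ha hb hc (ha.cos_eq_zero_or hb hc hG (by rw [h0]; norm_num))
    (le b hb hb1) (le c hc hc1)).trans ?_
  have h6 := (sin_bounds (l := 0) (u := 0.86603) ha.sin_pos (by rw [h0]; norm_num)
    (by rw [h0]; norm_num) (by norm_num)).2
  have := ha.sin_pos
  rw [h0]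
  nlinarith

lemma cos_le_half {a x : ℝ} (hx : IsSubmultiple x) (ha : √2 / 2 ≤ Real.cos a)
    (h : Real.cos x ^ 2 < 1 - Real.cos a ^ 2) : Real.cos x = 0 ∨ Real.cos x = 1 / 2 := by
  have h2 := sqrt_two_bounds
  have h3 := Real.sq_sqrt (show (0 : ℝ) ≤ 2 by norm_num)
  by_contra! h0
  refine h0.2 (hx.cos_eq_half h0.1 ?_)
  by_contra! h4
  have h5 : √2 / 2 ≤ Real.cos x := by
    have := sqrt_five_bounds; have := sqrt_three_bounds
    rcases hx.cos_cases with h | h | h | h | h <;> linarith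
  nlinarith

lemma vertexNorm_le_of_cos_eq_sqrt_two {a b c : ℝ} (ha : IsSubmultiple a) (hb : IsSubmultiple b)
    (hc : IsSubmultiple c) (hG : 0 < gramDet a b c) (h0 : Real.cos a = √2 / 2) :
    vertexNorm a b c ≤ 2.75 := by
  have h2 := sqrt_two_bounds
  have h3 := Real.sq_sqrt (show (0 : ℝ) ≤ 2 by norm_num)
  have le : ∀ x : ℝ, IsSubmultiple x → Real.cos x ^ 2 < 1 - Real.cos a ^ 2 →
      Real.cos x ≤ 1 / 2 := fun x hx hlt => by
    rcases cos_le_half hx h0.ge hlt with h | h <;> linarith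
  obtain ⟨hb1, hc1⟩ := cos_sq_lt_of_gramDet_pos ha hb hc hG
  refine (vertexNorm_le ha hb hc (ha.cos_eq_zero_or hb hc hG (by rw [h0]; linarith))
    (le b hb hb1) (le c hc hc1)).trans ?_
  have h6 := (sin_bounds (l := 0) (u := 0.7072) ha.sin_pos (by rw [h0]; nlinarith)
    (by rw [h0]; nlinarith) (by norm_num)).2
  have := ha.sin_pos
  rw [h0]
  nlinarith

/-- The vertices of an edge with dihedral angle `π / 5`. -/
lemma vertexNorm_pi_div_five {a b c : ℝ} (ha : IsSubmultiple a) (hb : IsSubmultiple b)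
    (hc : IsSubmultiple c) (hG : 0 < gramDet a b c) (h0 : Real.cos a = (1 + √5) / 4) :
    (Real.cos b = 0 ∧ Real.cos c = 1 / 2) ∨ vertexNorm a b c ≤ 1.61 := by
  have h5 := sqrt_five_bounds
  have h2 := sqrt_two_bounds
  have hsq : √5 ^ 2 = (5 : ℝ) := Real.sq_sqrt (by norm_num)
  have ha2 : √2 / 2 ≤ Real.cos a := by linarith
  have hs := (sin_bounds (l := 0) (u := 0.58779) ha.sin_pos (by rw [h0]; nlinarith)
    (by rw [h0]; nlinarith) (by norm_num)).2
  have hs0 := ha.sin_pos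
  obtain ⟨hb1, hc1⟩ := cos_sq_lt_of_gramDet_pos ha hb hc hG
  rcases cos_le_half hb ha2 hb1 with hb2 | hb2
  · rcases cos_le_half hc ha2 hc1 with hc2 | hc2
    · right
      refine (vertexNorm_le (z := 0) ha hb hc (Or.inl hb2) hb2.le hc2.le).trans ?_
      rw [h0]
      nlinarith
    · exact Or.inl ⟨hb2, hc2⟩
  · right
    have hc2 : Real.cos c = 0 :=
      (ha.cos_eq_zero_or hb hc hG (by rw [h0]; linarith)).resolve_left (by rw [hb2]; norm_num)
    have hsb := (sin_bounds (l := 0) (u := 0.86603) hb.sin_pos (by rw [hb2]; norm_num)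
      (by rw [hb2]; norm_num) (by norm_num)).2
    have hsb0 := hb.sin_pos
    rw [vertexNorm_eq, gramDet_eq, hb2, hc2, h0]
    have h1 : Real.sin a * Real.sin b ≤ 0.58779 * 0.86603 := by gcongr
    have h4 : Real.sin a * Real.sin b + (1 + √5) / 4 * (1 / 2) + 0 ≤ 0.9137 := by linarith
    have h6 : (Real.sin a * Real.sin b + (1 + √5) / 4 * (1 / 2) + 0) ^ 2 ≤ 0.9137 ^ 2 :=
      pow_le_pow_left₀ (by positivity) h4 2
    nlinarith

/-- After division by sin² α₁₂ the separated bounds are 4, 5.74 and 5.5 for α₁₂ = π/2, π/3 and π/4,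
and 3 for α₁₂ ≤ π/6, with g ≥ 0 simply dropped. Only α₁₂ = π/5 can exceed 5.74, and there g is
needed. -/
lemma edgeCosh_sub_edgeTerm_le {a b c d e : ℝ} (ha : IsSubmultiple a) (hb : IsSubmultiple b)
    (hc : IsSubmultiple c) (hd : IsSubmultiple d) (he : IsSubmultiple e)
    (hG : 0 < gramDet a b c) (hG' : 0 < gramDet a d e) :
    edgeCosh a b c d e - edgeTerm a b c d e ≤ extremalValue * Real.sin a ^ 2 := by
  have hle := edgeCosh_le hG hG'
  have hg := edgeTerm_nonneg ha hb hc hd he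
  have hT := extremalValue_bounds
  have hs := Real.sin_sq a
  rcases ha.cos_cases with h0 | h0 | h0 | h0 | h0
  · have h1 := vertexNorm_le_four ha hb hc hG h0
    have h2 := vertexNorm_le_four ha hd he hG' h0
    rw [sin_eq_one_of_cos_eq_zero ha h0]
    linarith
  · have h1 := vertexNorm_le_of_cos_eq_half ha hb hc hG h0
    have h2 := vertexNorm_le_of_cos_eq_half ha hd he hG' h0
    rw [hs, h0]
    linarith
  · have h1 := vertexNorm_le_of_cos_eq_sqrt_two ha hb hc hG h0
    have h2 := vertexNorm_le_of_cos_eq_sqrt_two ha hd he hG' h0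
    rw [hs, h0, div_pow, Real.sq_sqrt (by norm_num)]
    linarith
  · have h5 := sqrt_five_bounds
    have hsq : √5 ^ 2 = (5 : ℝ) := Real.sq_sqrt (by norm_num)
    have hcos : Real.cos (Real.pi / 5) = Real.cos a := by rw [Real.cos_pi_div_five, h0]
    have hsin : Real.sin (Real.pi / 5) = Real.sin a := by
      have h1 := Real.sin_sq (Real.pi / 5)
      rw [hcos, ← hs] at h1
      exact (pow_left_inj₀ (isSubmultiple_pi_div 5 (by norm_num)).sin_pos.le ha.sin_pos.le
        two_ne_zero).mp h1
    have hs0 : 0 < Real.sin a ^ 2 := pow_pos ha.sin_pos 2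
    have hval : extremalValue * Real.sin a ^ 2 = Real.sin a ^ 2 - 1 / 4 +
        (1 + Real.cos a) * (Real.sin a + 1 / 2) ^ 2 - 1 / 4 := by
      rw [extremalValue, hcos, hsin, div_mul_cancel₀ _ hs0.ne']
    have hs3 : Real.sin a ^ 2 = (5 - √5) / 8 := by rw [hs, h0]; nlinarith
    have hN : Real.sin a ^ 2 - 1 / 4 + (1 + Real.cos a) * (Real.sin a + 1 / 2) ^ 2 < 2.24 := by
      have : extremalValue * Real.sin a ^ 2 < 5.75 * Real.sin a ^ 2 := by gcongr; exact hT.2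
      linarith
    -- The value is reached only when both ends have angles (π/2, π/3); then g = 1/4. One such end
    -- together with a different one gives at most (2.24 + 1.61)/2, below 5.74 sin²(π/5).
    rcases vertexNorm_pi_div_five ha hb hc hG h0 with ⟨h1, h2⟩ | h1 <;>
    rcases vertexNorm_pi_div_five ha hd he hG' h0 with ⟨h3, h4⟩ | h3
    · rw [vertexNorm_of_cos_eq_zero_half hb h1 h2, vertexNorm_of_cos_eq_zero_half hd h3 h4] at hle
      rw [hval, edgeTerm, h1, h2, h3, h4]
      linarith
    · rw [vertexNorm_of_cos_eq_zero_half hb h1 h2] at hle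
      have : 5.74 * Real.sin a ^ 2 ≤ extremalValue * Real.sin a ^ 2 := by gcongr; exact hT.1.le
      linarith
    · rw [vertexNorm_of_cos_eq_zero_half hd h3 h4] at hle
      have : 5.74 * Real.sin a ^ 2 ≤ extremalValue * Real.sin a ^ 2 := by gcongr; exact hT.1.le
      linarith
    · have : 5.74 * Real.sin a ^ 2 ≤ extremalValue * Real.sin a ^ 2 := by gcongr; exact hT.1.le
      linarith
  · have h2 := sqrt_two_bounds
    have h3 := Real.sq_sqrt (show (0 : ℝ) ≤ 3 by norm_num)
    have h3' := sqrt_three_bounds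
    have ha2 : √2 / 2 ≤ Real.cos a := by linarith
    have key : ∀ b c, IsSubmultiple b → IsSubmultiple c → 0 < gramDet a b c →
        vertexNorm a b c ≤ 3 * Real.sin a ^ 2 := by
      intro b c hb hc hG
      have zero : ∀ x, IsSubmultiple x → Real.cos x ^ 2 < 1 - Real.cos a ^ 2 →
          Real.cos x = 0 := by
        intro x hx hlt
        refine (cos_le_half hx ha2 hlt).resolve_right fun h => ?_
        rw [h] at hlt
        nlinarith
      obtain ⟨hb1, hc1⟩ := cos_sq_lt_of_gramDet_pos ha hb hc hG
      have hb0 := zero b hb hb1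
      refine (vertexNorm_le (z := 0) ha hb hc (Or.inl hb0) hb0.le (zero c hc hc1).le).trans ?_
      have := Real.cos_le_one a
      have := sq_nonneg (Real.sin a)
      rw [add_zero]
      nlinarith
    have h4 := key b c hb hc hG
    have h5 := key d e hd he hG'
    have : 5.74 * Real.sin a ^ 2 ≤ extremalValue * Real.sin a ^ 2 := by gcongr; exact hT.1.le
    have := sq_nonneg (Real.sin a)
    linarith

namespace RidgeType

lemma IsSpherical.t_le_extremalValue {α : RidgeType} (h : α.IsSpherical) :
    α.t ≤ extremalValue := by
  have hG := h.cofactor44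
  have hG' := h.cofactor33
  rw [RidgeType.cofactor44] at hG
  rw [RidgeType.cofactor33] at hG'
  rw [h.t_eq, div_le_iff₀ (pow_pos h.a12.sin_pos 2), sub_le_iff_le_add]
  have h1 := edgeCosh_sub_edgeTerm_le h.a12 h.a13 h.a23 h.a14 h.a24 hG hG'
  have h2 := edgeCosh_sub_edgeTerm_le h.a12 h.a23 h.a13 h.a24 h.a14
    (by rwa [gramDet_swap]) (by rwa [gramDet_swap])
  rw [← edgeTerm_swap] at h2
  change _ ≤ _ + edgeTerm α.a12 α.a13 α.a23 α.a14 α.a24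
  exact max_le (by linarith) (by linarith)

lemma isSpherical_extremalType : extremalType.IsSpherical := by
  have h2 : IsSubmultiple (Real.pi / 2) := ⟨2, le_rfl, by norm_num⟩
  have h3 : IsSubmultiple (Real.pi / 3) := ⟨3, by norm_num, by norm_num⟩
  have h5 : IsSubmultiple (Real.pi / 5) := ⟨5, by norm_num, by norm_num⟩
  have hG : 0 < gramDet (Real.pi / 5) (Real.pi / 3) (Real.pi / 2) := by
    have := sqrt_five_bounds
    rw [gramDet_eq, Real.cos_pi_div_five, Real.cos_pi_div_two, Real.cos_pi_div_three]
    nlinarith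
  exact ⟨h5, h3, h3, h2, h2, hG, hG⟩

lemma t_extremalType : extremalType.t = extremalValue := by
  have h := isSpherical_extremalType
  refine le_antisymm h.t_le_extremalValue ?_
  rw [h.t_eq, extremalValue]
  have hs : 0 < Real.sin (Real.pi / 5) := h.a12.sin_pos
  have hG := h.cofactor44
  rw [RidgeType.cofactor44, gramDet_swap] at hG
  change 0 < gramDet (Real.pi / 5) (Real.pi / 2) (Real.pi / 3) at hG
  change _ ≤ _ / Real.sin (Real.pi / 5) ^ 2
  gcongr
  · change _ ≤ max _ (edgeCosh (Real.pi / 5) (Real.pi / 2) (Real.pi / 3) (Real.pi / 2)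
      (Real.pi / 3))
    -- The maximum is attained by F₃₄: the facet F₂ carries the right angles. Its two ends agree, so
    -- the AM–GM bound is exact.
    refine le_max_of_le_right ?_
    rw [edgeCosh_self hG, vertexNorm_of_cos_eq_zero_half (b := Real.pi / 2) h.a23 Real.cos_pi_div_two
      Real.cos_pi_div_three]
  · simp only [gTerm, extremalType, Real.cos_pi_div_two, Real.cos_pi_div_three]
    norm_num

end RidgeType

/-! ### The bound exceeds 1 -/

lemma IsSubmultiple.cos_eq_zero_or_half_le {a : ℝ} (h : IsSubmultiple a) :
    Real.cos a = 0 ∨ 1 / 2 ≤ Real.cos a := by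
  by_cases h0 : Real.cos a = 0
  · exact Or.inl h0
  · exact Or.inr (h.half_le_cos h0)

lemma lt_edgeCosh_of_right {a b c d e : ℝ} (ha : IsSubmultiple a)
    (hc : IsSubmultiple c) (hb : IsSubmultiple b) (hd : IsSubmultiple d) (he : IsSubmultiple e)
    (hG : 0 < gramDet a b c) (hG' : 0 < gramDet a d e)
    (h1 : Real.cos b = 0) (h2 : Real.cos d = 0) (ha0 : 1 / 2 ≤ Real.cos a) :
    Real.sin a ^ 2 + edgeTerm a b c d e < edgeCosh a b c d e := by
  refine lt_of_lt_of_le ?_ (le_edgeCosh hG hG')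
  have := ha.sin_pos
  have := hc.cos_nonneg
  have := he.cos_nonneg
  have : 0 ≤ √(gramDet a b c) * √(gramDet a d e) := by positivity
  rw [edgeTerm, h1, h2, sin_eq_one_of_cos_eq_zero hb h1, sin_eq_one_of_cos_eq_zero hd h2]
  have : 0 < Real.cos a * (Real.sin a * Real.sin a) := by positivity
  have : 0 ≤ Real.cos a * (Real.sin a * (Real.cos c + Real.cos e) + Real.cos c * Real.cos e) := by
    positivity
  have : 0 ≤ Real.sin a * (Real.cos c + Real.cos e) := by positivity
  linarith

lemma lt_edgeCosh_of_opposite {a b c d e : ℝ} (ha : IsSubmultiple a) (hb : IsSubmultiple b)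
    (hc : IsSubmultiple c) (hd : IsSubmultiple d) (he : IsSubmultiple e)
    (hG : 0 < gramDet a b c) (hG' : 0 < gramDet a d e)
    (h1 : Real.cos b = 0) (h2 : Real.cos e = 0) (ha0 : 1 / 2 ≤ Real.cos a) :
    Real.sin a ^ 2 + edgeTerm a b c d e < edgeCosh a b c d e := by
  refine lt_of_lt_of_le ?_ (le_edgeCosh hG hG')
  have hs := ha.sin_pos
  have hc0 := hc.cos_nonneg
  have hd0 := hd.cos_nonneg
  have hsd := hd.sin_pos
  have : 0 ≤ √(gramDet a b c) * √(gramDet a d e) := by positivity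
  rw [edgeTerm, h1, h2, sin_eq_one_of_cos_eq_zero hb h1]
  have hs1 := Real.sin_le_one a
  -- At the end with α₂₄ = π/2, positivity of the Gram determinant says that the other two angles
  -- add up to more than π/2.
  have hlt : Real.cos a < Real.sin d := by
    have h4 := (cos_sq_lt_of_gramDet_pos ha hd he hG').1
    have h5 := Real.sin_sq d
    exact lt_of_pow_lt_pow_left₀ 2 hsd.le (by linarith)
  set Z := (1 + Real.cos a) * (Real.sin a * Real.sin d + Real.cos a * Real.cos d) with hZ
  have hZ1 : Real.sin a < Z := by
    rcases hd.cos_eq_zero_or_half_le with h | h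
    · rw [hZ, h, sin_eq_one_of_cos_eq_zero hd h]
      nlinarith
    · have t1 : (1 / 2 : ℝ) * (1 / 2) ≤ Real.cos a * Real.cos d := by gcongr
      have t2 : Real.sin a * (1 / 2) ≤ Real.sin a * Real.sin d := by gcongr; linarith
      have t3 : (1 + 1 / 2) * (Real.sin a * (1 / 2) + 1 / 2 * (1 / 2)) ≤ Z := by
        rw [hZ]; gcongr
      linarith
  have hZ2 : Real.cos a * Real.cos d ≤ Z := by
    have t1 : 0 ≤ Real.cos a * (Real.cos a * Real.cos d) := by positivity
    have t2 : 0 < (1 + Real.cos a) * (Real.sin a * Real.sin d) := by positivity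
    rw [hZ]; linarith
  have t1 := mul_lt_mul_of_pos_left hZ1 hs
  have t2 := mul_le_mul_of_nonneg_left hZ2 hc0
  calc _ = Real.sin a * Real.sin a + Real.cos c * (Real.cos a * Real.cos d) := by ring
    _ < Real.sin a * Z + Real.cos c * Z := by linarith
    _ ≤ √(gramDet a b c) * √(gramDet a d e) + (Real.sin a * Z + Real.cos c * Z) := by linarith
    _ = _ := by rw [hZ]; ring

lemma gramDet_of_cos_eq_zero {a b c : ℝ} (h : Real.cos a = 0) :
    gramDet a b c = Real.sin b ^ 2 - Real.cos c ^ 2 := by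
  rw [gramDet_eq, h, Real.sin_sq]; ring

/-- `y + √(r² - y²) ≥ r`. -/
lemma le_add_sqrt_sub {r y : ℝ} (hy : 0 ≤ y) (h : 0 ≤ r ^ 2 - y ^ 2) :
    r ≤ y + √(r ^ 2 - y ^ 2) := by
  have h1 := Real.sq_sqrt h
  have h2 := Real.sqrt_nonneg (r ^ 2 - y ^ 2)
  refine abs_le_of_sq_le_sq' ?_ (by positivity) |>.2
  nlinarith [mul_nonneg hy h2]

lemma cos_eq_zero_or_half_of_lt_sin {b : ℝ} (hb : IsSubmultiple b) (h : Real.cos b < Real.sin b) :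
    (Real.cos b = 0 ∧ Real.sin b = 1) ∨ (Real.cos b = 1 / 2 ∧ 0.866 < Real.sin b ∧
      Real.sin b ^ 2 = 3 / 4) := by
  have h1 := Real.sin_sq b
  by_cases h0 : Real.cos b = 0
  · exact Or.inl ⟨h0, sin_eq_one_of_cos_eq_zero hb h0⟩
  · have h2 : Real.cos b = 1 / 2 := by
      refine hb.cos_eq_half h0 ?_
      by_contra! h3
      have h4 := sqrt_two_bounds
      have h5 := Real.sq_sqrt (show (0 : ℝ) ≤ 2 by norm_num)
      have h6 : √2 / 2 ≤ Real.cos b := by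
        have := sqrt_five_bounds; have := sqrt_three_bounds
        rcases hb.cos_cases with h | h | h | h | h <;> linarith
      nlinarith
    rw [h2] at h1
    have h3 : Real.sin b ^ 2 = 3 / 4 := by linarith
    exact Or.inr ⟨h2, (sin_bounds (u := 1) hb.sin_pos (by rw [h2]; norm_num)
      (by rw [h2]; norm_num) (by norm_num)).1, h3⟩

lemma lt_edgeCosh_of_cos_eq_zero {a b c d e : ℝ} (ha : IsSubmultiple a) (hb : IsSubmultiple b)
    (hc : IsSubmultiple c) (hd : IsSubmultiple d) (he : IsSubmultiple e)
    (hG : 0 < gramDet a b c) (hG' : 0 < gramDet a d e) (ha0 : Real.cos a = 0)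
    (h1 : Real.cos b < Real.sin b) (h2 : Real.cos d < Real.sin d) :
    Real.sin a ^ 2 + edgeTerm a b c d e < edgeCosh a b c d e := by
  refine lt_of_lt_of_le ?_ (le_edgeCosh hG hG')
  have r1 : 0 < √(gramDet a b c) := Real.sqrt_pos.mpr hG
  have r2 : 0 < √(gramDet a d e) := Real.sqrt_pos.mpr hG'
  rw [gramDet_of_cos_eq_zero ha0] at hG hG' r1 r2 ⊢
  rw [gramDet_of_cos_eq_zero ha0]
  have q1 := le_add_sqrt_sub hc.cos_nonneg hG.le
  have q2 := le_add_sqrt_sub he.cos_nonneg hG'.le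
  have hc0 := hc.cos_nonneg
  have he0 := he.cos_nonneg
  rw [edgeTerm, ha0, sin_eq_one_of_cos_eq_zero ha ha0]
  set R := √(Real.sin b ^ 2 - Real.cos c ^ 2) with hR
  set R' := √(Real.sin d ^ 2 - Real.cos e ^ 2) with hR'
  have rr : 0 < R * R' := mul_pos r1 r2
  have zero_c : Real.cos c = 0 → R = Real.sin b := fun h => by
    rw [hR, h, zero_pow two_ne_zero, sub_zero, Real.sqrt_sq hb.sin_pos.le]
  have zero_e : Real.cos e = 0 → R' = Real.sin d := fun h => by
    rw [hR', h, zero_pow two_ne_zero, sub_zero, Real.sqrt_sq hd.sin_pos.le]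
  have goal : 1 + Real.cos b * Real.cos d < R * R' + Real.sin b * Real.sin d +
      Real.sin b * Real.cos e + Real.cos c * Real.sin d → 1 ^ 2 + (0 * Real.cos b * Real.cos e +
      0 * Real.cos d * Real.cos c + Real.cos b * Real.cos d + Real.cos c * Real.cos e) <
      R * R' + (1 + 0) * ((1 * Real.sin b + 0 * Real.cos b + Real.cos c) *
        (1 * Real.sin d + 0 * Real.cos d + Real.cos e)) := fun h => by linarith
  apply goal
  -- An angle π/n larger than π/4 is π/2 or π/3, so four combinations remain.
  rcases cos_eq_zero_or_half_of_lt_sin hb h1 with ⟨b0, b1⟩ | ⟨b0, b1, b2⟩ <;>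
  rcases cos_eq_zero_or_half_of_lt_sin hd h2 with ⟨d0, d1⟩ | ⟨d0, d1, d2⟩
  · rw [b0, b1, d0, d1]; linarith
  · have q := mul_le_mul_of_nonneg_right q1 hd.sin_pos.le
    rw [b1] at q
    rw [b0, b1, d0]
    rcases he.cos_eq_zero_or_half_le with h | h
    · rw [h, zero_e h]
      linarith
    · have := mul_nonneg hc0 hd.sin_pos.le
      linarith
  · have q := mul_le_mul_of_nonneg_right q2 hb.sin_pos.le
    rw [d1] at q
    rw [b0, d0, d1]
    rcases hc.cos_eq_zero_or_half_le with h | h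
    · rw [h, zero_c h]
      linarith
    · have := mul_nonneg he0 hb.sin_pos.le
      linarith
  · have hbd : Real.sin b = Real.sin d :=
      (pow_left_inj₀ hb.sin_pos.le hd.sin_pos.le two_ne_zero).mp (by rw [b2, d2])
    have p1 := mul_le_mul_of_nonneg_right q1 hd.sin_pos.le
    have p2 := mul_le_mul_of_nonneg_right q2 hd.sin_pos.le
    rw [hbd] at p1
    rw [b0, d0, hbd]
    rcases he.cos_eq_zero_or_half_le with h | h
    · rw [h, zero_e h]
      linarith
    rcases hc.cos_eq_zero_or_half_le with h' | h'
    · rw [h', zero_c h', hbd]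
      linarith
    · have t1 := mul_le_mul_of_nonneg_left h hd.sin_pos.le
      have t2 := mul_le_mul_of_nonneg_left h' hd.sin_pos.le
      linarith

/-- The hypothesis for α₁₂ = π/2 is essential: for the spherical types (π/2, π/n, π/2, π/2, π/n) the
value of t tends to 0. For the other α₁₂ each end has a right angle on F₁ or F₂, and exchanging F₁
with F₂ leaves two configurations. -/
lemma RidgeType.IsSpherical.one_lt_t {α : RidgeType} (h : α.IsSpherical)
    (h0 : Real.cos α.a12 = 0 →
      (Real.cos α.a13 < Real.sin α.a13 ∧ Real.cos α.a14 < Real.sin α.a14) ∨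
        Real.cos α.a23 < Real.sin α.a23 ∧ Real.cos α.a24 < Real.sin α.a24) : 1 < α.t := by
  have hG := h.cofactor44
  have hG' := h.cofactor33
  rw [RidgeType.cofactor44] at hG
  rw [RidgeType.cofactor33] at hG'
  have hGs := hG
  have hGs' := hG'
  rw [gramDet_swap] at hGs hGs'
  have key : Real.sin α.a12 ^ 2 + edgeTerm α.a12 α.a13 α.a23 α.a14 α.a24 <
        edgeCosh α.a12 α.a13 α.a23 α.a14 α.a24 ∨
      Real.sin α.a12 ^ 2 + edgeTerm α.a12 α.a23 α.a13 α.a24 α.a14 <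
        edgeCosh α.a12 α.a23 α.a13 α.a24 α.a14 := by
    rcases h.a12.cos_eq_zero_or_half_le with ha | ha
    · rcases h0 ha with ⟨h1, h2⟩ | ⟨h1, h2⟩
      · exact Or.inl (lt_edgeCosh_of_cos_eq_zero h.a12 h.a13 h.a23 h.a14 h.a24 hG hG' ha h1 h2)
      · exact Or.inr (lt_edgeCosh_of_cos_eq_zero h.a12 h.a23 h.a13 h.a24 h.a14 hGs hGs' ha h1 h2)
    · have ha0 : Real.cos α.a12 ≠ 0 := by linarith
      rcases h.a12.cos_eq_zero_or h.a13 h.a23 hG ha0 with h1 | h1 <;>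
      rcases h.a12.cos_eq_zero_or h.a14 h.a24 hG' ha0 with h2 | h2
      · exact Or.inl (lt_edgeCosh_of_right h.a12 h.a23 h.a13 h.a14 h.a24 hG hG' h1 h2 ha)
      · exact Or.inl (lt_edgeCosh_of_opposite h.a12 h.a13 h.a23 h.a14 h.a24 hG hG' h1 h2 ha)
      · exact Or.inr (lt_edgeCosh_of_opposite h.a12 h.a23 h.a13 h.a24 h.a14 hGs hGs' h1 h2 ha)
      · exact Or.inr (lt_edgeCosh_of_right h.a12 h.a13 h.a23 h.a24 h.a14 hGs hGs' h1 h2 ha)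
  rw [h.t_eq, lt_div_iff₀ (pow_pos h.a12.sin_pos 2), one_mul, lt_sub_iff_add_lt]
  rcases key with key | key
  · exact lt_max_of_lt_left key
  · rw [← edgeTerm_swap] at key
    exact lt_max_of_lt_right key

/-! ### Ridges of outermost edges -/

/-- The multiple w of the component of g orthogonal to e and f has square sin² a · G. It is
orthogonal to the timelike v, and x shows that it is nonzero. -/
lemma gramDet_pos_of_vertex {v x : Hyp3} {e f g : Mink} {a b c : ℝ} (he : mink e e = 1)
    (hf : mink f f = 1) (hg : mink g g = 1) (hm : mink e f ^ 2 < 1)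
    (ha : -mink e f = Real.cos a) (hb : -mink e g = Real.cos b) (hc : -mink f g = Real.cos c)
    (hve : mink v e = 0) (hvf : mink v f = 0) (hvg : mink v g = 0)
    (hxe : mink x e = 0) (hxf : mink x f = 0) (hxg : mink x g ≠ 0) : 0 < gramDet a b c := by
  have e1 : mink e f = -Real.cos a := by linarith
  have e2 : mink e g = -Real.cos b := by linarith
  have e3 : mink f g = -Real.cos c := by linarith
  have hs : 0 < 1 - Real.cos a ^ 2 := by rw [e1] at hm; linarith
  set w : Mink := (1 - Real.cos a ^ 2) • g + (Real.cos b + Real.cos a * Real.cos c) • e +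
    (Real.cos c + Real.cos a * Real.cos b) • f with hw
  have hw0 : w ≠ 0 := by
    intro h
    have h1 : mink x w = 0 := by rw [h]; simp
    simp only [hw, mink_add_right, mink_smul_right, hxe, hxf, mul_zero, add_zero] at h1
    exact hxg ((mul_eq_zero.mp h1).resolve_left hs.ne')
  have hpos := mink_self_pos_of_hyp (v := v) (y := w)
    (by simp only [hw, mink_add_right, mink_smul_right, hve, hvf, hvg]; ring) hw0
  have hww : mink w w = (1 - Real.cos a ^ 2) * gramDet a b c := by
    simp only [hw, mink_add_right, mink_smul_right, mink_add_left, mink_smul_left, he, hf, hg,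
      mink_comm g e, mink_comm g f, mink_comm f e, e1, e2, e3]
    rw [gramDet_eq]; ring
  rw [hww] at hpos
  exact pos_of_mul_pos_right hpos hs.le

namespace IsIrredundant

variable {P E : Set Hyp3} {S : Finset Mink} {u : Fin 4 → Mink}

lemma isSubmultiple_dihedralAngle (h : IsIrredundant P S) (hC : IsCoxeterPolytope P) {e f : Mink}
    (he : e ∈ S) (hf : f ∈ S) (hef : e ≠ f) {v : Hyp3} (hve : mink v e = 0) (hvf : mink v f = 0) :
    IsSubmultiple (dihedralAngle e f) ∧ -mink e f = Real.cos (dihedralAngle e f) := by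
  obtain ⟨n, hn, h1, h2⟩ := h.exists_dihedralAngle hC he hf hef hve hvf
  exact ⟨⟨n, hn, h1⟩, by rw [h1, h2]⟩

/-- The incidences of a ridge. -/
lemma ridge_spec (h : IsIrredundant P S) (hR : IsRidge P E u) :
    (∀ i, u i ∈ S) ∧ u 0 ≠ u 1 ∧ u 0 ≠ u 2 ∧ u 0 ≠ u 3 ∧ u 1 ≠ u 2 ∧ u 1 ≠ u 3 ∧
      E = faceOf P (u 0) ∩ faceOf P (u 1) ∧
      (∃ v : Hyp3, mink v (u 0) = 0 ∧ mink v (u 1) = 0 ∧ mink v (u 2) = 0) ∧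
      (∃ w : Hyp3, mink w (u 0) = 0 ∧ mink w (u 1) = 0 ∧ mink w (u 3) = 0) ∧
      (∃ x : Hyp3, mink x (u 0) = 0 ∧ mink x (u 1) = 0 ∧ mink x (u 2) ≠ 0) ∧
      ∃ x : Hyp3, mink x (u 0) = 0 ∧ mink x (u 1) = 0 ∧ mink x (u 3) ≠ 0 := by
  have hS : ∀ i, u i ∈ S := fun i => h.isFacetNormal_iff.mp (hR.facet i)
  obtain ⟨v, w, -, -, -, hv, hw, hv2, hw3⟩ := hR.framing
  have point : ∀ g, ¬ E ⊆ faceOf P g →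
      ∃ x : Hyp3, mink x (u 0) = 0 ∧ mink x (u 1) = 0 ∧ mink x g ≠ 0 := by
    intro g hg
    obtain ⟨x, hx, hxg⟩ := Set.not_subset.mp hg
    exact ⟨x, (hR.left hx).2, (hR.right hx).2, fun h0 => hxg ⟨(hR.left hx).1, h0⟩⟩
  exact ⟨hS, hR.ne, fun h0 => hR.not_left (h0 ▸ hR.left), fun h0 => hR.not_right (h0 ▸ hR.left),
    fun h0 => hR.not_left (h0 ▸ hR.right), fun h0 => hR.not_right (h0 ▸ hR.right),
    (h.edge_spec hR.edge (hS 0) (hS 1) hR.ne (fun x hx => (hR.left hx).2)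
      (fun x hx => (hR.right hx).2)).1,
    ⟨v, (hR.left hv).2, (hR.right hv).2, hv2.2⟩, ⟨w, (hR.left hw).2, (hR.right hw).2, hw3.2⟩,
    point _ hR.not_left, point _ hR.not_right⟩

lemma isSpherical_ridgeType (h : IsIrredundant P S) (hC : IsCoxeterPolytope P)
    (hR : IsRidge P E u) : (ridgeType u).IsSpherical := by
  obtain ⟨hS, h01, h02, h03, h12, h13, -, ⟨v, v0, v1, v2⟩, ⟨w, w0, w1, w3⟩, ⟨x, x0, x1, x2⟩,
    y, y0, y1, y3⟩ := h.ridge_spec hR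
  have a01 := h.isSubmultiple_dihedralAngle hC (hS 0) (hS 1) h01 v0 v1
  have a02 := h.isSubmultiple_dihedralAngle hC (hS 0) (hS 2) h02 v0 v2
  have a03 := h.isSubmultiple_dihedralAngle hC (hS 0) (hS 3) h03 w0 w3
  have a12 := h.isSubmultiple_dihedralAngle hC (hS 1) (hS 2) h12 v1 v2
  have a13 := h.isSubmultiple_dihedralAngle hC (hS 1) (hS 3) h13 w1 w3
  have hm := h.mink_sq_lt_one_of_mem (hS 0) (hS 1) h01 v0 v1
  exact ⟨a01.1, a02.1, a03.1, a12.1, a13.1,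
    gramDet_pos_of_vertex (h.unit _ (hS 0)) (h.unit _ (hS 1)) (h.unit _ (hS 3)) hm a01.2 a03.2
      a13.2 w0 w1 w3 y0 y1 y3,
    gramDet_pos_of_vertex (h.unit _ (hS 0)) (h.unit _ (hS 1)) (h.unit _ (hS 2)) hm a01.2 a02.2
      a12.2 v0 v1 v2 x0 x1 x2⟩

/-- Comparison of the distances from `O` to two edges of a facet, in terms of the distances to the
facets. -/
lemma outermost_inequality (h : IsIrredundant P S) (hC : IsCoxeterPolytope P) {e f g : Mink}
    {a b : ℝ} (he : e ∈ S) (hf : f ∈ S) (hg : g ∈ S) (hef : e ≠ f) (heg : e ≠ g)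
    (ha : IsSubmultiple a) (hb : IsSubmultiple b) (hae : -mink e f = Real.cos a)
    (hbe : -mink e g = Real.cos b) {O : Hyp3} (hO : ∀ e ∈ S, mink O e < 0)
    (hout : ∀ E', IsEdge P E' → setDist {O} E' ≤ setDist {O} (faceOf P e ∩ faceOf P f)) :
    (-mink O g + Real.cos b * -mink O e) * Real.sin a ≤
      Real.sin b * (-mink O f + Real.cos a * -mink O e) := by
  have e1 : mink e f = -Real.cos a := by linarith
  have e2 : mink e g = -Real.cos b := by linarith
  have sa := Real.sin_sq a
  have sb := Real.sin_sq b
  have sa0 := ha.sin_pos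
  have sb0 := hb.sin_pos
  have m1 : mink e f ^ 2 < 1 := by rw [e1]; nlinarith
  have m2 : mink e g ^ 2 < 1 := by rw [e2]; nlinarith
  have hle := hout _ (h.isEdge_of_mink_sq_lt_one hC he hg heg m2)
  have hcosh := Real.cosh_le_cosh.mpr (by
    rwa [abs_of_nonneg (setDist_nonneg _ _), abs_of_nonneg (setDist_nonneg _ _)] :
      |setDist {O} (faceOf P e ∩ faceOf P g)| ≤ |setDist {O} (faceOf P e ∩ faceOf P f)|)
  have hsq := pow_le_pow_left₀ (Real.cosh_pos _).le hcosh 2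
  rw [h.cosh_setDist_edge_sq hC he hg heg m2 hO, h.cosh_setDist_edge_sq hC he hf hef m1 hO, e1, e2,
    neg_sq, neg_sq, ← sa, ← sb, add_le_add_iff_left,
    div_le_div_iff₀ (by positivity) (by positivity)] at hsq
  have hf0 := hO f hf
  have he0 := hO e he
  have := ha.cos_nonneg
  have : 0 ≤ -mink O f + Real.cos a * -mink O e :=
    add_nonneg (by linarith) (mul_nonneg this (by linarith))
  refine abs_le_of_sq_le_sq' ?_ (by positivity) |>.2
  -- Pythagoras through the projection of O to the facet of e: the summand with `mink O e ^ 2` is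
  -- common to both edges and cancels, and the rest is a comparison of squares.
  have t1 : (mink O e ^ 2 + mink O g ^ 2 - 2 * -Real.cos b * (mink O e * mink O g)) =
      (-mink O g + Real.cos b * -mink O e) ^ 2 + mink O e ^ 2 * Real.sin b ^ 2 := by
    rw [sb]; ring
  have t2 : (mink O e ^ 2 + mink O f ^ 2 - 2 * -Real.cos a * (mink O e * mink O f)) =
      (-mink O f + Real.cos a * -mink O e) ^ 2 + mink O e ^ 2 * Real.sin a ^ 2 := by
    rw [sa]; ring
  rw [t1, t2] at hsq
  nlinarith

theorem width_lt_t (h : IsIrredundant P S) (hC : IsCompactCoxeterPolytope P)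
    {O : Hyp3} (hO : ∀ e ∈ S, mink O e < 0) (hE : IsOutermostEdge P O E) (hR : IsRidge P E u) :
    width P u < (ridgeType u).t := by
  have hsph := h.isSpherical_ridgeType hC.1 hR
  obtain ⟨hS, h01, h02, h03, h12, h13, hEeq, ⟨v, v0, v1, v2⟩, ⟨w, w0, w1, w3⟩, -⟩ :=
    h.ridge_spec hR
  have a01 := (h.isSubmultiple_dihedralAngle hC.1 (hS 0) (hS 1) h01 v0 v1).2
  have a02 := (h.isSubmultiple_dihedralAngle hC.1 (hS 0) (hS 2) h02 v0 v2).2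
  have a03 := (h.isSubmultiple_dihedralAngle hC.1 (hS 0) (hS 3) h03 w0 w3).2
  have a12 := (h.isSubmultiple_dihedralAngle hC.1 (hS 1) (hS 2) h12 v1 v2).2
  have a13 := (h.isSubmultiple_dihedralAngle hC.1 (hS 1) (hS 3) h13 w1 w3).2
  have a10 : -mink (u 1) (u 0) = Real.cos (dihedralAngle (u 0) (u 1)) := by rw [mink_comm, a01]
  have hout := hE.2
  rw [hEeq] at hout
  have hout' := hout
  rw [Set.inter_comm] at hout'
  set α := ridgeType u with hα
  change -mink (u 0) (u 1) = Real.cos α.a12 at a01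
  change -mink (u 1) (u 0) = Real.cos α.a12 at a10
  change -mink (u 0) (u 2) = Real.cos α.a13 at a02
  change -mink (u 0) (u 3) = Real.cos α.a14 at a03
  change -mink (u 1) (u 2) = Real.cos α.a23 at a12
  change -mink (u 1) (u 3) = Real.cos α.a24 at a13
  have i02 := h.outermost_inequality hC.1 (hS 0) (hS 1) (hS 2) h01 h02 hsph.a12 hsph.a13 a01 a02
    hO hout
  have i03 := h.outermost_inequality hC.1 (hS 0) (hS 1) (hS 3) h01 h03 hsph.a12 hsph.a14 a01 a03
    hO hout
  have i12 := h.outermost_inequality hC.1 (hS 1) (hS 0) (hS 2) h01.symm h12 hsph.a12 hsph.a23 a10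
    a12 hO hout'
  have i13 := h.outermost_inequality hC.1 (hS 1) (hS 0) (hS 3) h01.symm h13 hsph.a12 hsph.a24 a10
    a13 hO hout'
  have b0 := hO _ (hS 0)
  have b1 := hO _ (hS 1)
  have b2 := hO _ (hS 2)
  have b3 := hO _ (hS 3)
  have s0 := h.unit _ (hS 0)
  have s1 := h.unit _ (hS 1)
  have s2 := h.unit _ (hS 2)
  have s3 := h.unit _ (hS 3)
  have hlt : -mink (u 2) (u 3) < α.t := by
    rw [hsph.t_eq, lt_div_iff₀ (pow_pos hsph.a12.sin_pos 2), lt_sub_iff_add_lt, mul_comm]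
    rcases le_total (-mink O (u 1)) (-mink O (u 0)) with hb | hb
    · exact lt_max_of_lt_left (neg_mink_mul_add_lt s0 s1 s2 s3 a01 a02 a03 a12 a13
        hsph.a12.cos_nonneg hsph.a13.cos_nonneg hsph.a14.cos_nonneg hsph.a23.cos_nonneg
        hsph.a24.cos_nonneg hsph.a12.sin_pos hsph.a13.sin_pos hsph.a14.sin_pos
        hsph.a12.cos_half_pos b0 b1 b2 b3 hb i02 i03)
    · have := neg_mink_mul_add_lt s1 s0 s2 s3 a10 a12 a13 a02 a03
        hsph.a12.cos_nonneg hsph.a23.cos_nonneg hsph.a24.cos_nonneg hsph.a13.cos_nonneg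
        hsph.a14.cos_nonneg hsph.a12.sin_pos hsph.a23.sin_pos hsph.a24.sin_pos
        hsph.a12.cos_half_pos b1 b0 b2 b3 hb i12 i13
      refine lt_max_of_lt_right (lt_of_eq_of_lt ?_ this)
      rw [RidgeType.gTerm]; ring
  have hone : 1 < α.t := by
    refine hsph.one_lt_t fun h0 => ?_
    have hs := sin_eq_one_of_cos_eq_zero hsph.a12 h0
    -- For a right dihedral angle the outermost inequality reads z + x cos b ≤ y sin b with y ≤ x
    -- and z > 0, which forces b > π/4.
    have key : ∀ {x y : ℝ} {b : ℝ}, 0 < x → 0 < y → 0 < Real.sin b → ∀ {z : ℝ}, y ≤ x → 0 < z →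
        (z + Real.cos b * x) * Real.sin α.a12 ≤ Real.sin b * (y + Real.cos α.a12 * x) →
        Real.cos b < Real.sin b := by
      intro x y b hx hy hb z hyx hz hle
      rw [hs, h0] at hle
      have : Real.cos b * x < Real.sin b * x := by nlinarith
      exact lt_of_mul_lt_mul_right this hx.le
    have n0 := neg_pos.mpr b0
    have n1 := neg_pos.mpr b1
    have n2 := neg_pos.mpr b2
    have n3 := neg_pos.mpr b3
    rcases le_total (-mink O (u 1)) (-mink O (u 0)) with hb | hb
    · exact Or.inl ⟨key n0 n1 hsph.a13.sin_pos hb n2 i02, key n0 n1 hsph.a14.sin_pos hb n3 i03⟩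
    · exact Or.inr ⟨key n1 n0 hsph.a23.sin_pos hb n2 i12, key n1 n0 hsph.a24.sin_pos hb n3 i13⟩
  exact (h.cosh_setDist_facets_le hC (hS 2) (hS 3)).trans_lt (max_lt hone hlt)

end IsIrredundant

/-! ### The tetrahedron with the extremal ridge -/

lemma IsIrredundant.mem_interior {P : Set Hyp3} {S : Finset Mink} (h : IsIrredundant P S)
    {O : Hyp3} (hO : ∀ e ∈ S, mink O e < 0) : O ∈ interior P := by
  have hopen : IsOpen {x : Hyp3 | ∀ e ∈ S, mink x e < 0} := by
    have : {x : Hyp3 | ∀ e ∈ S, mink x e < 0} = ⋂ e ∈ S, {x : Hyp3 | mink x e < 0} := by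
      ext; simp
    rw [this]
    exact isOpen_biInter_finset fun e _ => isOpen_lt (continuous_mink_left e) continuous_const
  exact interior_maximal (fun x hx => (h.mem_iff x).mpr fun e he => (hx e he).le) hopen hO

namespace Tetrahedron

/-- The square root of the golden ratio. -/
noncomputable def root : ℝ := √((1 + √5) / 2)

lemma root_sq : root ^ 2 = (1 + √5) / 2 := Real.sq_sqrt (by positivity)

/-- This is φ² = φ + 1 for φ = `root ^ 2`; the exact identities for the tetrahedron reduce to it. -/
lemma root_pow_four : root ^ 4 = root ^ 2 + 1 := by
  have h5 : √5 ^ 2 = (5 : ℝ) := Real.sq_sqrt (by norm_num)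
  have : root ^ 4 = (root ^ 2) ^ 2 := by ring
  rw [this, root_sq]
  linarith

lemma root_bounds : 1.27 < root ∧ root < 1.28 := by
  have := sqrt_five_bounds
  exact ⟨Real.lt_sqrt_of_sq_lt (by linarith), (Real.sqrt_lt' (by norm_num)).mpr (by linarith)⟩

/-- The unit outer normals of the facets. -/
noncomputable def normal : Fin 4 → Mink :=
  ![![root * (root ^ 2 - 1) / 2, root ^ 2 / 2, 1 / 2, 1 / 2], ![0, -1, 0, 0], ![0, 0, -1, 0],
    ![0, 0, 0, -1]]

lemma mink_normal_zero (x : Mink) : mink x (normal 0) =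
    -(x 0 * (root * (root ^ 2 - 1) / 2)) + x 1 * (root ^ 2 / 2) + x 2 / 2 + x 3 / 2 := by
  simp [mink, normal]; ring

lemma mink_normal_one (x : Mink) : mink x (normal 1) = -x 1 := by simp [mink, normal]

lemma mink_normal_two (x : Mink) : mink x (normal 2) = -x 2 := by simp [mink, normal]

lemma mink_normal_three (x : Mink) : mink x (normal 3) = -x 3 := by simp [mink, normal]

/-- The last three normals are orthonormal. The spatial entries φ/2, 1/2, 1/2 of the first are the
required cosines, and its time entry is then fixed up to sign by (e, e) = 1; its square is (φ -
1)/4. -/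
lemma mink_normal_self (i : Fin 4) : mink (normal i) (normal i) = 1 := by
  fin_cases i
  · change mink (normal 0) (normal 0) = 1
    rw [mink_normal_zero]
    simp only [normal, Matrix.cons_val_zero, Matrix.cons_val_one, Matrix.cons_val]
    linear_combination (1 / 2 - root ^ 2 / 4) * root_pow_four
  · change mink (normal 1) (normal 1) = 1
    rw [mink_normal_one]; simp [normal]
  · change mink (normal 2) (normal 2) = 1
    rw [mink_normal_two]; simp [normal]
  · change mink (normal 3) (normal 3) = 1
    rw [mink_normal_three]; simp [normal]

lemma mink_normal_zero_one : mink (normal 0) (normal 1) = -Real.cos (Real.pi / 5) := by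
  rw [mink_normal_one, Real.cos_pi_div_five]
  simp only [normal, Matrix.cons_val_zero, Matrix.cons_val_one]
  rw [root_sq]; ring

lemma mink_normal_zero_two : mink (normal 0) (normal 2) = -Real.cos (Real.pi / 3) := by
  rw [mink_normal_two, Real.cos_pi_div_three]; simp [normal]

lemma mink_normal_zero_three : mink (normal 0) (normal 3) = -Real.cos (Real.pi / 3) := by
  rw [mink_normal_three, Real.cos_pi_div_three]; simp [normal]

lemma mink_normal_one_two : mink (normal 1) (normal 2) = -Real.cos (Real.pi / 2) := by
  rw [mink_normal_two, Real.cos_pi_div_two]; simp [normal]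

lemma mink_normal_one_three : mink (normal 1) (normal 3) = -Real.cos (Real.pi / 2) := by
  rw [mink_normal_three, Real.cos_pi_div_two]; simp [normal]

lemma mink_normal_two_three : mink (normal 2) (normal 3) = -Real.cos (Real.pi / 2) := by
  rw [mink_normal_three, Real.cos_pi_div_two]; simp [normal]

lemma dihedralAngle_eq {e f : Mink} {n : ℕ} (hn : 1 ≤ n)
    (h : mink e f = -Real.cos (Real.pi / n)) : dihedralAngle e f = Real.pi / n := by
  have h1 : (1 : ℝ) ≤ n := by exact_mod_cast hn
  rw [dihedralAngle, h, neg_neg, Real.arccos_cos (by positivity)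
    (div_le_self Real.pi_pos.le h1)]

lemma exists_mink_normal {i j : Fin 4} (hij : i < j) :
    ∃ n : ℕ, 2 ≤ n ∧ mink (normal i) (normal j) = -Real.cos (Real.pi / n) := by
  fin_cases i <;> fin_cases j <;> first | exact absurd hij (by decide) | skip
  · exact ⟨5, by norm_num, mod_cast mink_normal_zero_one⟩
  · exact ⟨3, by norm_num, mod_cast mink_normal_zero_two⟩
  · exact ⟨3, by norm_num, mod_cast mink_normal_zero_three⟩
  · exact ⟨2, by norm_num, mod_cast mink_normal_one_two⟩
  · exact ⟨2, by norm_num, mod_cast mink_normal_one_three⟩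
  · exact ⟨2, by norm_num, mod_cast mink_normal_two_three⟩

/-- The set of the unit outer normals of the facets. -/
noncomputable def normals : Finset Mink := (Set.finite_range normal).toFinset

lemma mem_normals {e : Mink} : e ∈ normals ↔ ∃ i, normal i = e := by simp [normals]

lemma normal_mem (i : Fin 4) : normal i ∈ normals := mem_normals.mpr ⟨i, rfl⟩

/-- The compact Coxeter tetrahedron `[5, 3^{1,1}]`. -/
def tetrahedron : Set Hyp3 := ⋂ e ∈ normals, halfSpace e

lemma mem_tetrahedron {x : Hyp3} : x ∈ tetrahedron ↔ ∀ i, mink x (normal i) ≤ 0 := by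
  simp [tetrahedron, mem_normals, halfSpace]

lemma exists_hyp {z : Mink} (h : mink z z < 0) (h0 : 0 < z 0) : ∃ x : Hyp3, ∀ e,
    (mink x e = 0 ↔ mink z e = 0) ∧ (mink x e < 0 ↔ mink z e < 0) :=
  ⟨toHyp z ⟨h, h0⟩, fun e => ⟨mink_toHyp_eq_zero_iff _ e, mink_toHyp_neg_iff _ e⟩⟩

lemma isIrredundant : IsIrredundant tetrahedron normals := by
  obtain ⟨h1, h2⟩ := root_bounds
  have h4 := root_pow_four
  have hr : 0.6 < root ^ 2 - 1 := by nlinarith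
  have hr' : root ^ 2 < 1.64 := by nlinarith
  have hrr : 0.76 < root * (root ^ 2 - 1) := by nlinarith
  have rel : ∀ i, ∃ z : Hyp3, mink z (normal i) = 0 ∧
      ∀ j, j ≠ i → mink z (normal j) < 0 := by
    intro i
    have key : ∀ z : Mink, mink z z < 0 → 0 < z 0 → mink z (normal i) = 0 →
        (∀ j, j ≠ i → mink z (normal j) < 0) →
        ∃ z : Hyp3, mink z (normal i) = 0 ∧ ∀ j, j ≠ i → mink z (normal j) < 0 := by
      intro z hz hz0 hi hj
      obtain ⟨x, hx⟩ := exists_hyp hz hz0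
      exact ⟨x, (hx _).1.mpr hi, fun j h => (hx _).2.mpr (hj j h)⟩
    fin_cases i
    -- With spatial part (1, 1, 1), membership in the first plane forces x₀ = (φ + 2)/(root · (φ -
    -- 1)), which equals (φ + 2) · root because φ(φ - 1) = 1. In the other cases the time entry 10
    -- is merely large.
    · refine key ![root ^ 3 + 2 * root, 1, 1, 1] ?_ ?_ ?_ ?_
      · simp [mink]; nlinarith
      · simp; positivity
      · change mink _ (normal 0) = 0
        rw [mink_normal_zero]; simp
        linear_combination (-(root ^ 2 + 2) / 2) * h4
      · intro j hj
        fin_cases j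
        · exact absurd rfl hj
        · exact (mink_normal_one _).trans_lt (by simp)
        · exact (mink_normal_two _).trans_lt (by simp)
        · exact (mink_normal_three _).trans_lt (by simp)
    · refine key ![10, 0, 1, 1] ?_ ?_ ?_ ?_
      · simp [mink]; norm_num
      · simp
      · exact (mink_normal_one _).trans (by simp)
      · intro j hj
        fin_cases j
        · exact (mink_normal_zero _).trans_lt (by simp; linarith)
        · exact absurd rfl hj
        · exact (mink_normal_two _).trans_lt (by simp)
        · exact (mink_normal_three _).trans_lt (by simp)
    · refine key ![10, 1, 0, 1] ?_ ?_ ?_ ?_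
      · simp [mink]; norm_num
      · simp
      · exact (mink_normal_two _).trans (by simp)
      · intro j hj
        fin_cases j
        · exact (mink_normal_zero _).trans_lt (by simp; linarith)
        · exact (mink_normal_one _).trans_lt (by simp)
        · exact absurd rfl hj
        · exact (mink_normal_three _).trans_lt (by simp)
    · refine key ![10, 1, 1, 0] ?_ ?_ ?_ ?_
      · simp [mink]; norm_num
      · simp
      · exact (mink_normal_three _).trans (by simp)
      · intro j hj
        fin_cases j
        · exact (mink_normal_zero _).trans_lt (by simp; linarith)
        · exact (mink_normal_one _).trans_lt (by simp)
        · exact (mink_normal_two _).trans_lt (by simp)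
        · exact absurd rfl hj
  refine ⟨?_, fun x => ?_, ?_, ?_⟩
  · intro e he
    obtain ⟨i, rfl⟩ := mem_normals.mp he
    exact mink_normal_self i
  · rw [mem_tetrahedron]
    simp [mem_normals]
  · obtain ⟨x, hx⟩ := exists_hyp (z := ![10, 1, 1, 1]) (by simp [mink]; norm_num) (by simp)
    refine ⟨x, fun e he => ?_⟩
    obtain ⟨i, rfl⟩ := mem_normals.mp he
    rw [(hx _).2]
    fin_cases i
    · exact (mink_normal_zero _).trans_lt (by simp; linarith)
    · exact (mink_normal_one _).trans_lt (by simp)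
    · exact (mink_normal_two _).trans_lt (by simp)
    · exact (mink_normal_three _).trans_lt (by simp)
  · intro e he
    obtain ⟨i, rfl⟩ := mem_normals.mp he
    obtain ⟨z, hz, hzj⟩ := rel i
    refine ⟨z, hz, fun f hf hfe => ?_⟩
    obtain ⟨j, rfl⟩ := mem_normals.mp hf
    exact hzj j (by rintro rfl; exact hfe rfl)

lemma isCoxeterPolytope : IsCoxeterPolytope tetrahedron := by
  obtain ⟨O, hO⟩ := isIrredundant.exists_strict
  refine ⟨⟨⟨normals, isIrredundant.unit, rfl⟩, O, isIrredundant.mem_interior hO⟩, ?_⟩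
  intro e f he hf hef _
  obtain ⟨i, rfl⟩ := mem_normals.mp (isIrredundant.isFacetNormal_iff.mp he)
  obtain ⟨j, rfl⟩ := mem_normals.mp (isIrredundant.isFacetNormal_iff.mp hf)
  rcases lt_trichotomy i j with hij | rfl | hij
  · obtain ⟨n, hn, h⟩ := exists_mink_normal hij
    exact ⟨n, hn, dihedralAngle_eq (by omega) h⟩
  · exact absurd rfl hef
  · obtain ⟨n, hn, h⟩ := exists_mink_normal hij
    exact ⟨n, hn, dihedralAngle_eq (by omega) (by rwa [mink_comm])⟩

lemma isCompact : IsCompact tetrahedron := by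
  rw [Subtype.isCompact_iff]
  -- On the hyperboloid 0 < x₀ is equivalent to 1 ≤ x₀, which is a closed condition.
  have himage : (Subtype.val '' tetrahedron : Set Mink) =
      {x | mink x x = -1} ∩ {x | 1 ≤ x 0} ∩ ⋂ i, {x | mink x (normal i) ≤ 0} := by
    ext x
    simp only [Set.mem_image, Set.mem_inter_iff, Set.mem_ofPred_eq, Set.mem_iInter]
    constructor
    · rintro ⟨x, hx, rfl⟩
      refine ⟨⟨x.2.1, ?_⟩, mem_tetrahedron.mp hx⟩
      have h1 := x.2.1
      have h2 := x.2.2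
      simp only [mink] at h1
      nlinarith [sq_nonneg ((x : Mink) 1), sq_nonneg ((x : Mink) 2), sq_nonneg ((x : Mink) 3)]
    · rintro ⟨⟨h1, h2⟩, h3⟩
      exact ⟨⟨x, h1, by linarith⟩, mem_tetrahedron.mpr h3, rfl⟩
  rw [himage]
  have hc : ∀ e : Mink, Continuous fun x : Mink => mink x e := fun e => by unfold mink; fun_prop
  have hcc : Continuous fun x : Mink => mink x x := by unfold mink; fun_prop
  refine (isCompact_univ_pi fun _ : Fin 4 => isCompact_Icc (a := (-2 : ℝ)) (b := 2)).of_isClosed_subset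
    (((isClosed_eq hcc continuous_const).inter
      (isClosed_le continuous_const (continuous_apply 0))).inter
      (isClosed_iInter fun i => isClosed_le (hc _) continuous_const)) ?_
  rintro x ⟨⟨h1, h2⟩, h3⟩
  simp only [Set.mem_iInter, Set.mem_ofPred_eq] at h1 h2 h3
  obtain ⟨r1, r2⟩ := root_bounds
  have r4 := root_pow_four
  have c0 := h3 0
  have c1 := h3 1
  have c2 := h3 2
  have c3 := h3 3
  rw [mink_normal_zero] at c0
  rw [mink_normal_one] at c1
  rw [mink_normal_two] at c2
  rw [mink_normal_three] at c3
  have n1 : 0 ≤ x 1 := by linarith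
  have n2 : 0 ≤ x 2 := by linarith
  have n3 : 0 ≤ x 3 := by linarith
  have rr : 1.6 < root ^ 2 := by nlinarith
  have rr' : root ^ 2 < 1.64 := by nlinarith
  -- The first facet bounds the spatial coordinates by x₀. Squaring gives x₀² - 1 ≤ (φ - 1) x₀² with
  -- φ - 1 < 1, which bounds x₀.
  have hsum : x 1 + x 2 + x 3 ≤ root * (root ^ 2 - 1) * x 0 := by nlinarith
  have hsq : (x 1 + x 2 + x 3) ^ 2 ≤ (root ^ 2 - 1) * x 0 ^ 2 := by
    refine (pow_le_pow_left₀ (by positivity) hsum 2).trans (le_of_eq ?_)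
    linear_combination (root ^ 2 - 1) * x 0 ^ 2 * r4
  have hx0 : x 0 ≤ 2 := by
    simp only [mink] at h1
    have p1 := mul_nonneg n1 n2
    have p2 := mul_nonneg n1 n3
    have p3 := mul_nonneg n2 n3
    nlinarith
  have hb : ∀ i, x i ^ 2 ≤ 2 ^ 2 := by
    have : x 0 ^ 2 ≤ 2 ^ 2 := pow_le_pow_left₀ (by linarith) hx0 2
    simp only [mink] at h1
    intro i
    fin_cases i
    · exact this
    all_goals
      simp only [Fin.mk_one, Fin.reduceFinMk]
      nlinarith [sq_nonneg (x 1), sq_nonneg (x 2), sq_nonneg (x 3)]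
  exact fun i _ => abs_le.mp (abs_le_of_sq_le_sq (hb i) (by norm_num))

lemma exists_vertices : ∃ v w : Hyp3,
    (mink v (normal 0) = 0 ∧ mink v (normal 1) = 0 ∧ mink v (normal 2) = 0 ∧
      mink v (normal 3) < 0) ∧
    mink w (normal 0) = 0 ∧ mink w (normal 1) = 0 ∧ mink w (normal 2) < 0 ∧
      mink w (normal 3) = 0 := by
  obtain ⟨r1, -⟩ := root_bounds
  have r4 := root_pow_four
  refine ⟨⟨![root ^ 2, 0, 0, root], ?_, ?_⟩, ⟨![root ^ 2, 0, root, 0], ?_, ?_⟩, ?_, ?_⟩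
  · simp [mink]; linarith
  · simp; positivity
  · simp [mink]; linarith
  · simp; positivity
  · simp only [mink_normal_zero, mink_normal_one, mink_normal_two, mink_normal_three]
    simp
    exact ⟨by linear_combination (-root / 2) * r4, by linarith⟩
  · simp only [mink_normal_zero, mink_normal_one, mink_normal_two, mink_normal_three]
    simp
    exact ⟨by linear_combination (-root / 2) * r4, by linarith⟩

lemma isRidge : IsRidge tetrahedron (faceOf tetrahedron (normal 0) ∩ faceOf tetrahedron (normal 1))
    normal := by
  obtain ⟨v, w, ⟨v0, v1, v2, v3⟩, w0, w1, w2, w3⟩ := exists_vertices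
  have hne : normal 0 ≠ normal 1 := fun h => by
    have := congrFun h 2
    simp [normal] at this
  have hv : v ∈ tetrahedron := by
    rw [mem_tetrahedron]
    intro i
    fin_cases i
    exacts [v0.le, v1.le, v2.le, v3.le]
  have hw : w ∈ tetrahedron := by
    rw [mem_tetrahedron]
    intro i
    fin_cases i
    exacts [w0.le, w1.le, w2.le, w3.le]
  have hm := isIrredundant.mink_sq_lt_one_of_mem (normal_mem 0) (normal_mem 1) hne v0 v1
  have hvE : v ∈ faceOf tetrahedron (normal 0) ∩ faceOf tetrahedron (normal 1) :=
    ⟨⟨hv, v0⟩, hv, v1⟩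
  have hwE : w ∈ faceOf tetrahedron (normal 0) ∩ faceOf tetrahedron (normal 1) :=
    ⟨⟨hw, w0⟩, hw, w1⟩
  exact
    { edge := isIrredundant.isEdge_of_mink_sq_lt_one isCoxeterPolytope (normal_mem 0)
        (normal_mem 1) hne hm
      facet := fun i => isIrredundant.isFacetNormal_iff.mpr (normal_mem i)
      ne := hne
      left := Set.inter_subset_left
      right := Set.inter_subset_right
      framing := ⟨v, w,
        isIrredundant.isVertex_of_mem (normal_mem 0) (normal_mem 1) (normal_mem 2) hne hv v0 v1 v2
          w0 w1 w2.ne,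
        isIrredundant.isVertex_of_mem (normal_mem 0) (normal_mem 1) (normal_mem 3) hne hw w0 w1 w3
          v0 v1 v3.ne,
        fun h => by rw [h] at v2; exact w2.ne v2, hvE, hwE,
        ⟨hv, v2⟩, hw, w3⟩
      not_left := fun h => w2.ne (h hwE).2
      not_right := fun h => v3.ne (h hvE).2 }

lemma ridgeType_normal : ridgeType normal = extremalType := by
  ext
  · exact mod_cast dihedralAngle_eq (n := 5) (by norm_num) (mod_cast mink_normal_zero_one)
  · exact mod_cast dihedralAngle_eq (n := 3) (by norm_num) (mod_cast mink_normal_zero_two)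
  · exact mod_cast dihedralAngle_eq (n := 3) (by norm_num) (mod_cast mink_normal_zero_three)
  · exact mod_cast dihedralAngle_eq (n := 2) (by norm_num) (mod_cast mink_normal_one_two)
  · exact mod_cast dihedralAngle_eq (n := 2) (by norm_num) (mod_cast mink_normal_one_three)

end Tetrahedron

lemma extremalType_mem_allTypes : extremalType ∈ allTypes :=
  ⟨_, _, _, ⟨Tetrahedron.isCoxeterPolytope, Tetrahedron.isCompact⟩, Tetrahedron.isRidge,
    Tetrahedron.ridgeType_normal⟩

lemma t_le_of_mem_allTypes {α : RidgeType} (hα : α ∈ allTypes) : α.t ≤ extremalType.t := by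
  obtain ⟨P, E, u, hP, hR, rfl⟩ := hα
  obtain ⟨S, h⟩ := hP.1.1.exists_isIrredundant
  rw [RidgeType.t_extremalType]
  exact (h.isSpherical_ridgeType hP.1 hR).t_le_extremalValue

end LobachevskyThree

theorem theoremA :
    (∀ P : Set Hyp3, IsCompactCoxeterPolytope P →
      (∃ (E : Set Hyp3) (u : Fin 4 → Mink),
        IsRidge P E u ∧ width P u < (ridgeType u).t) ∧
      (∀ O ∈ interior P,
        (∃ E : Set Hyp3, IsOutermostEdge P O E) ∧
        ∀ E : Set Hyp3, IsOutermostEdge P O E →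
          (∃ u : Fin 4 → Mink, IsRidge P E u) ∧
          ∀ u : Fin 4 → Mink, IsRidge P E u → width P u < (ridgeType u).t)) ∧
    extremalType ∈ allTypes ∧
    (∀ α ∈ allTypes, α.t ≤ extremalType.t) ∧
    extremalType.t < 5.75 := by
  have outermost : ∀ P : Set Hyp3, IsCompactCoxeterPolytope P → ∀ O ∈ interior P,
      (∃ E : Set Hyp3, IsOutermostEdge P O E) ∧
        ∀ E : Set Hyp3, IsOutermostEdge P O E →
          (∃ u : Fin 4 → Mink, IsRidge P E u) ∧
          ∀ u : Fin 4 → Mink, IsRidge P E u → width P u < (ridgeType u).t := by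
    intro P hP O hO
    obtain ⟨S, h⟩ := hP.1.1.exists_isIrredundant
    have hO' : ∀ e ∈ S, mink O e < 0 := fun e he =>
      mink_neg_of_mem_interior hO (h.unit e he) (h.subset_halfSpace he)
    exact ⟨h.exists_isOutermostEdge hP O, fun E hE =>
      ⟨h.exists_isRidge hP hE.1, fun u hu => h.width_lt_t hP hO' hE hu⟩⟩
  refine ⟨fun P hP => ⟨?_, outermost P hP⟩, extremalType_mem_allTypes,
    fun α hα => t_le_of_mem_allTypes hα, ?_⟩
  · obtain ⟨O, hO⟩ := hP.1.1.2
    obtain ⟨⟨E, hE⟩, h⟩ := outermost P hP O hO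
    obtain ⟨⟨u, hu⟩, hw⟩ := h E hE
    exact ⟨E, u, hu, hw u hu⟩
  · rw [RidgeType.t_extremalType]
    exact extremalValue_bounds.2
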